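/- Let $\alpha>0$, let $\Phi_\alpha^{-1}(y)=(\ln(1/y))^{-1/\alpha}$, $0<y<1$, be the quantile function of the standard $\alpha$-Fréchet law, and let $N\ge 1$, $K\ge 2$. For a non-negative signal $f:\{1,\dots,N\}\to[0,\infty)$, numbers $\tilde Z_j(i)$ ($1\le j\le K$, $1\le i\le N$) and $i_0\in\{1,\dots,N\}$ put $$E_j(f)=\max_{1\le i\le N} f(i)\tilde Z_j(i),\qquad g_j(i_0)=E_j(f)/\tilde Z_j(i_0),\qquad \hat f(i_0)=g_{(1)}(i_0),$$ where $g_{(1)}(i_0)\le g_{(2)}(i_0)\le\dots\le g_{(K)}(i_0)$ are the sorted values $g_j(i_0)$, and let $\mathrm{criterion}(i_0)=1$ if $g_{(1)}(i_0)=g_{(2)}(i_0)$ and $\mathrm{criterion}(i_0)=0$ otherwise. There is a constant $C>0$, depending only on $\alpha$, with the following two properties. (1) Let $\delta>0$, $0<\gamma<\delta/(4KN)$ and $$\beta\le C\,\frac{\delta}{K^2[\ln(NK^2/\delta)]^{1/\alpha}} .$$ Let $U_j(i)$ be uniformly distributed on $(0,1)$ and let $\tilde Z_j(i)$ be random variables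 such that the $KN$ pairs $(U_j(i),\tilde Z_j(i))$ are independent and, almost surely, $|\tilde Z_j(i)-\Phi_\alpha^{-1}(U_j(i))|\le\beta$ whenever $U_j(i)\in[\gamma,1-\gamma]$. (So $\tilde Z_j(i)$ is a version of precision $\beta$ of the ideal standard $\alpha$-Fréchet variable $\Phi_\alpha^{-1}(U_j(i))$.) Then, for every signal $f\ge 0$ and every $i_0$, $$\mathbb P\big(\hat f(i_0)\ne f(i_0)\ \text{and}\ \mathrm{criterion}(i_0)=1\big)\le\delta .$$ (2) The bound also holds for a streaming algorithm with small storage. Let $N\ge2$, $0<\delta\le 1/2$, $0<\varepsilon<1$, $Q=\log_2(N)\ln(1/\delta)/\varepsilon^\alpha$, and let the size $K\ge2$ of the sketch and the number of bits of the maximal value $M$ of the signal be at most $Q^{O(1)}$. Then there is an algorithm that uses $Q^{O(1)}$ bits of storage (truly random seed bits, working memory and program text included) and $Q^{O(1)}$ bit operations per stream item and has the following properties. From its seed it produces, by Nisan's generator (with some pairwise independent family of hash functions), one block of bits for each $i\in\{1,\dots,N\}$. It takes $K$ disjoint pieces of $\ell$ bits from the $i$-th block and turns the $j$-th piece by a fixed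 table into a non-negative rational number $\tilde Z_j(i)$ with a fixed denominator. For some $0<\gamma<\delta/(4KN)$ and some $\beta$ as in (1), the table entry at the first $\ell$ binary digits of $u$ differs from $\Phi_\alpha^{-1}(u)$ by at most $\beta$, for all $u\in[\gamma,1-\gamma]$. On every stream of pairs $(i,v)$ with $v\in\{0,\dots,M\}$, which defines the signal $f(i)=\max\{v:(i,v)\text{ occurs}\}$ ($0$ if there is none), and for every $i_0$, it outputs exactly $\hat f(i_0)$ and $\mathrm{criterion}(i_0)$ for these $\tilde Z_j(i)$, and, for a uniformly random seed, $$\mathbb P\big(\hat f(i_0)\ne f(i_0)\ \text{and}\ \mathrm{criterion}(i_0)=1\big)\le\delta .$$ Here the constants in $Q^{O(1)}$ (a factor and an exponent) for the algorithm depend only on $\alpha$ and on the corresponding constants in the assumptions on $K$ and $M$. The algorithm is a straight-line program, for given $\alpha,N,K,M,\delta,\varepsilon$, over registers of $w$ bits with the usual arithmetic, bitwise, comparison and selection instructions; an instruction is charged $w^2$ bit operations. -/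

import Mathlib

/-! Max-stable sketches, the point estimator and its criterion -/

/-- The inverse `y ↦ (ln (1/y))^(-1/α)`, `0 < y < 1`, of the distribution function
`x ↦ exp (-x^(-α))`, `x > 0`, of a standard `α`-Fréchet variable. -/
noncomputable def frechetInv (α y : ℝ) : ℝ := (Real.log (1 / y)) ^ (-(1 / α))

/-- The max-stable sketch `E_j(f) = max_i f(i) z_j(i)`. -/
noncomputable def sketch {N K : ℕ} (f : Fin N → ℝ) (z : Fin K → Fin N → ℝ) (j : Fin K) : ℝ :=
  ⨆ i, f i * z j i

/-- The ratios `g_j(i₀) = E_j(f) / z_j(i₀)`. -/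
noncomputable def sketchRatio {N K : ℕ} (f : Fin N → ℝ) (z : Fin K → Fin N → ℝ) (i₀ : Fin N)
    (j : Fin K) : ℝ :=
  sketch f z j / z j i₀

/-- The order statistics `g_(1) ≤ g_(2) ≤ ⋯ ≤ g_(K)` (indexed from `0`). -/
noncomputable def orderStat {K : ℕ} (g : Fin K → ℝ) (r : Fin K) : ℝ := g (Tuple.sort g r)

/-- The point estimate `g_(1)(i₀)`. -/
noncomputable def pointEstimate {N K : ℕ} (hK : 2 ≤ K) (f : Fin N → ℝ) (z : Fin K → Fin N → ℝ)
    (i₀ : Fin N) : ℝ :=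
  orderStat (sketchRatio f z i₀) ⟨0, by omega⟩

open Classical in
/-- The criterion: `1` if `g_(1)(i₀) = g_(2)(i₀)`, and `0` if `g_(1)(i₀) < g_(2)(i₀)`. -/
noncomputable def criterion {N K : ℕ} (hK : 2 ≤ K) (f : Fin N → ℝ) (z : Fin K → Fin N → ℝ)
    (i₀ : Fin N) : ℕ :=
  if orderStat (sketchRatio f z i₀) ⟨0, by omega⟩ = orderStat (sketchRatio f z i₀) ⟨1, by omega⟩
  then 1 else 0

/-- The quantity `δ / (K² [ln (N K² / δ)]^(1/α))` with which the precision is compared. -/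
noncomputable def precisionScale (α δ : ℝ) (N K : ℕ) : ℝ :=
  δ / ((K : ℝ) ^ 2 * (Real.log (N * (K : ℝ) ^ 2 / δ)) ^ (1 / α))

/-! A machine model for streaming algorithms: straight-line programs on words of `w` bits -/

/-- Instructions of a machine with `R` registers of `w` bits. The first argument is the register
that receives the result. There are no jumps and there is no indirect addressing. -/
inductive Instr (w R : ℕ) : Type
  | const (d : Fin R) (v : BitVec w)
  | add (d a b : Fin R)
  | sub (d a b : Fin R)
  | mul (d a b : Fin R)
  | div (d a b : Fin R)
  | mod (d a b : Fin R)
  | and (d a b : Fin R)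
  | or (d a b : Fin R)
  | xor (d a b : Fin R)
  | shl (d a b : Fin R)
  | shr (d a b : Fin R)
  | lt (d a b : Fin R)
  | sel (d c a b : Fin R)

/-- The effect of one instruction on the memory. Arithmetic is unsigned, modulo `2 ^ w`. -/
def Instr.exec {w R : ℕ} (m : Fin R → BitVec w) : Instr w R → (Fin R → BitVec w)
  | .const d v => Function.update m d v
  | .add d a b => Function.update m d (m a + m b)
  | .sub d a b => Function.update m d (m a - m b)
  | .mul d a b => Function.update m d (m a * m b)
  | .div d a b => Function.update m d (m a / m b)
  | .mod d a b => Function.update m d (m a % m b)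
  | .and d a b => Function.update m d (m a &&& m b)
  | .or d a b => Function.update m d (m a ||| m b)
  | .xor d a b => Function.update m d (m a ^^^ m b)
  | .shl d a b => Function.update m d (m a <<< (m b).toNat)
  | .shr d a b => Function.update m d (m a >>> (m b).toNat)
  | .lt d a b => Function.update m d (if (m a).toNat < (m b).toNat then 1#w else 0#w)
  | .sel d c a b => Function.update m d (if m c = 0#w then m b else m a)

/-- Run a straight-line program. -/
def runProgram {w R : ℕ} (p : List (Instr w R)) (m : Fin R → BitVec w) : Fin R → BitVec w :=
  p.foldl Instr.exec m

/-- A randomized streaming algorithm with words of `w` bits, whose random words are indexed by `σ`.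
It consists of a number of registers, the places of the random words, of the current input item
`(i, v)` (or of the index of a query) and of the output, and of two programs: one is run on each
stream item, and the other one on each query. -/
structure StreamMachine (w : ℕ) (σ : Type) where
  /-- number of registers -/
  R : ℕ
  /-- registers that hold the random words at the beginning -/
  seedReg : σ ↪ Fin R
  /-- register of the index of an item or of a query -/
  idxReg : Fin R
  /-- register of the value of an item -/
  valReg : Fin R
  /-- numerator of the reported estimate -/
  numReg : Fin R
  /-- denominator of the reported estimate -/
  denReg : Fin R
  /-- reported value of the criterion -/
  critReg : Fin R
  /-- program for a stream item -/
  update : List (Instr w R)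
  /-- program for a query -/
  query : List (Instr w R)

namespace StreamMachine

variable {w : ℕ} {σ : Type} (S : StreamMachine w σ)

/-- At the beginning the memory holds the random words, and zeros elsewhere. -/
noncomputable def init (seed : σ → BitVec w) : Fin S.R → BitVec w :=
  Function.extend S.seedReg seed (fun _ => 0#w)

/-- One stream item `(i, v)` is loaded and treated. -/
def step {N : ℕ} (m : Fin S.R → BitVec w) (item : Fin N × ℕ) : Fin S.R → BitVec w :=
  runProgram S.update
    (Function.update (Function.update m S.idxReg (BitVec.ofNat w item.1))
      S.valReg (BitVec.ofNat w item.2))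

/-- Memory after the whole stream and then the query about the index `i₀`. -/
noncomputable def final {N : ℕ} (seed : σ → BitVec w) (stream : List (Fin N × ℕ)) (i₀ : Fin N) :
    Fin S.R → BitVec w :=
  runProgram S.query
    (Function.update (stream.foldl S.step (S.init seed)) S.idxReg (BitVec.ofNat w i₀))

/-- The reported estimate of the signal at `i₀`. -/
noncomputable def estimate {N : ℕ} (seed : σ → BitVec w) (stream : List (Fin N × ℕ))
    (i₀ : Fin N) : ℝ :=
  ((S.final seed stream i₀ S.numReg).toNat : ℝ) / ((S.final seed stream i₀ S.denReg).toNat : ℝ)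

/-- The reported value of the criterion at `i₀`. -/
noncomputable def crit {N : ℕ} (seed : σ → BitVec w) (stream : List (Fin N × ℕ))
    (i₀ : Fin N) : ℕ :=
  (S.final seed stream i₀ S.critReg).toNat

/-- Storage in bits: all registers, the random words included, and the text of both programs, at an
operation code of `4` bits, at most four register numbers and at most one constant for each
instruction. -/
def storage : ℕ :=
  S.R * w + (S.update.length + S.query.length) * (4 + 4 * Nat.size S.R + w)

/-- Bit operations per stream item, where an instruction on words of `w` bits is charged `w ^ 2`
(which covers schoolbook multiplication and division). -/
def opsPerItem : ℕ := S.update.length * w ^ 2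

end StreamMachine

/-- The signal described by a stream of pairs `(i, v)`: the value at `i` is the maximum of the
values observed with index `i`, and `0` if there is none. If every index occurs at most once, then
the stream consists of the pairs `(i, f i)` themselves. -/
def streamSignal {N : ℕ} (stream : List (Fin N × ℕ)) (i : Fin N) : ℕ :=
  stream.foldr (fun item s => if item.1 = i then max item.2 s else s) 0

/-! Finite precision Fréchet variables driven by the generator of Nisan -/

/-- A universal (pairwise independent) family of hash functions from `w`-bit words to `w`-bit words,
whose members are described by `q` words: for `x ≠ x'` the values of a random member at `x` and `x'`
are independent and uniformly distributed. -/
structure HashFamily (w q : ℕ) where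
  hash : (Fin q → BitVec w) → BitVec w → BitVec w
  pairwise : ∀ x x' : BitVec w, x ≠ x' → ∀ y y' : BitVec w,
    Nat.card {κ : Fin q → BitVec w // hash κ x = y ∧ hash κ x' = y'} * (2 ^ w) ^ 2
      = Nat.card (Fin q → BitVec w)

/-- The generator of Nisan: `G_0(x) = x`, and `G_{k+1}(x, h_1, …, h_{k+1})` is the concatenation of
`G_k(x, h_1, …, h_k)` and `G_k(h_{k+1}(x), h_1, …, h_k)`. It produces `2 ^ k` blocks. -/
def nisanGenerator {B : Type} : (k : ℕ) → (Fin k → B → B) → B → List B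
  | 0, _, x => [x]
  | k + 1, h, x =>
      nisanGenerator k (fun t => h t.castSucc) x ++
        nisanGenerator k (fun t => h t.castSucc) (h (Fin.last k) x)

/-- Finite precision pseudo-random Fréchet variables for sketches of size `K` of signals on `N`
points. The `i`-th block of Nisan's generator provides, for each `j < K`, a number of `l` bits, that
is, a finite precision version of a number `U_j(i)` in `(0,1)`; a table turns it into a multiple of
`1 / D`. -/
structure NisanVariables (N K : ℕ) where
  /-- block length, in bits -/
  w : ℕ
  /-- number of hash functions -/
  k : ℕ
  /-- number of words describing a hash function -/
  q : ℕ
  /-- number of bits for each variable -/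
  l : ℕ
  /-- the variables are multiples of `1 / D` -/
  D : ℕ
  family : HashFamily w q
  table : BitVec l → ℕ
  enough_blocks : N ≤ 2 ^ k
  enough_bits : K * l ≤ w
  D_pos : 0 < D

namespace NisanVariables

variable {N K : ℕ} (G : NisanVariables N K)

/-- The random words: one initial block, and `q` words for each of the `k` hash functions. -/
abbrev SeedIndex : Type := Option (Fin G.k × Fin G.q)

/-- The `i`-th block of the generator. -/
def block (seed : G.SeedIndex → BitVec G.w) (i : Fin N) : BitVec G.w :=
  (nisanGenerator G.k (fun t => G.family.hash (fun b => seed (some (t, b)))) (seed none)).getD i 0#G.w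

/-- The pseudo-random variables. -/
noncomputable def vars (seed : G.SeedIndex → BitVec G.w) (j : Fin K) (i : Fin N) : ℝ :=
  (G.table ((G.block seed i).extractLsb' (j * G.l) G.l) : ℝ) / G.D

/-- Precision `β` on `[γ, 1 - γ]`: if the `l` bits are the leading binary digits of `u`, then the
variable differs by at most `β` from the ideal `α`-Fréchet variable obtained from `u`. -/
def Precise (α γ β : ℝ) : Prop :=
  ∀ u ∈ Set.Icc γ (1 - γ),
    |(G.table (BitVec.ofNat G.l ⌊(2 : ℝ) ^ G.l * u⌋₊) : ℝ) / G.D - frechetInv α u| ≤ β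

end NisanVariables

/-- Probability of an event when the random words are independent and uniformly distributed. -/
noncomputable def seedProb {w : ℕ} {σ : Type} (A : (σ → BitVec w) → Prop) : ℝ :=
  (Nat.card {seed : σ → BitVec w // A seed} : ℝ) / (Nat.card (σ → BitVec w) : ℝ)

/-- The quantity `log₂(N) ln(1/δ) / ε^α`. -/
noncomputable def costScale (α δ ε : ℝ) (N : ℕ) : ℝ :=
  Real.logb 2 N * Real.log (1 / δ) / ε ^ α

section

open MeasureTheory ProbabilityTheory

/-! The Fréchet quantile function and its distribution function -/

/-! Independent variables. If the criterion is `1` and the estimate is wrong, two different indices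
`j`, `j'` have equal ratios `g_j = g_j'` that differ from `f(i₀)`. A ratio `g_j ≠ f(i₀)` with
`Z_j(i₀) > 0` means that the maximum `E_j` is attained away from `i₀`, so `E_j` does not involve
`Z_j(i₀)`. The equality then reads `Z_j(i₀) = S` with `S = max_{i ≠ i₀} f(i) Z_j(i) / g_j'`, and `S`
is independent of `U_j(i₀)`. The Fréchet law has a bounded density, that is, a distribution function
with some Lipschitz constant `c`; hence the ideal variable lies within `β` of `S` with probability
at most `2cβ` (`measure_collision_le`). A union bound over `K²` pairs, and over the `K` events that
`U_j(i₀)` leaves `[γ, 1 - γ]`, gives `δ` with `C = 1/(8c)` (`failureBound_of_lipschitz`).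

Pseudo-random variables. Whether the estimate fails depends only on the signal, not on the order of
the stream. For a fixed signal it is decided by a finite automaton that reads one block per index,
in the order of the indices, and stores the `K` partial maxima and the `K` variables at `i₀`.
Nisan's generator changes the probability of any set of final states of an automaton with state
space `St` by at most `2^k |St|² / √(2^w)` for blocks of `w` bits (`expect_nisan_le`). At each
doubling of the generator a random hash function decouples the two halves, by a second moment
computation (`expect_abs_hash_mixing_le`). Since `log |St|` is polynomial in the size of the
instance, so is a block length that makes this error at most `δ/2`. For truly random blocks the
pieces of `l` bits are the leading digits of independent uniform numbers, and the first part applies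
with `δ/2` (`seedProb_frechetNisan_le`).

The machine. The table is not stored but computed in fixed point. On a geometric grid the values
`x^(-α)` form a geometric progression, so the distribution function needs only products of stored
constants `exp(-λ 2^t)`; a binary search inverts it (`quantileFix_precise`). A block is reached
along a path of length `k` in the tree of the generator, with random affine maps over the field with
two elements as hash functions. Ratios are compared by cross-multiplication, so the output is exact
(`sketchMachine_correct`). Everything is written as assignments that compile to straight-line code
of polynomial length. -/

theorem rpow_mul_exp_neg_le {y s : ℝ} (hy : 0 < y) (hs : 0 ≤ s) :
    y ^ s * Real.exp (-y) ≤ 1 + (Nat.factorial ⌈s⌉₊ : ℝ) := by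
  -- Below `1` the power is at most `1`; above `1` the exponent may be rounded up, and one term of
  -- the exponential series controls the integral power.
  have h1 : y ^ s ≤ 1 + y ^ ⌈s⌉₊ := by
    rcases le_total y 1 with h | h
    · have := Real.rpow_le_one hy.le h hs
      have : 0 ≤ y ^ ⌈s⌉₊ := by positivity
      linarith
    · have := Real.rpow_le_rpow_of_exponent_le h (Nat.le_ceil s)
      rw [Real.rpow_natCast] at this
      linarith
  have h2 := Real.pow_div_factorial_le_exp y hy.le ⌈s⌉₊
  rw [div_le_iff₀ (by positivity)] at h2
  have h3 : 1 ≤ Real.exp y := Real.one_le_exp hy.le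
  rw [Real.exp_neg, ← div_eq_mul_inv, div_le_iff₀ (Real.exp_pos y)]
  nlinarith

/-- The distribution function of a standard `α`-Fréchet variable, on the positive half-line. -/
noncomputable def frechetCdf (α x : ℝ) : ℝ := Real.exp (-x ^ (-α))

theorem hasDerivAt_frechetCdf {α x : ℝ} (hx : 0 < x) :
    HasDerivAt (frechetCdf α) (Real.exp (-x ^ (-α)) * (α * x ^ (-α - 1))) x := by
  have h := ((Real.hasDerivAt_rpow_const (p := -α) (Or.inl hx.ne')).neg).exp
  exact h.congr_deriv (by simp only [Pi.neg_apply]; ring)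

/-- With `y = x^(-α)` the density `α x^(-α-1) exp(-x^(-α))` becomes `α y^(1+1/α) exp(-y)`, which is
bounded. -/
theorem exists_frechetCdf_lipschitz {α : ℝ} (hα : 0 < α) :
    ∃ c : ℝ, 0 < c ∧ ∀ x y : ℝ, 0 < x → x ≤ y → frechetCdf α y - frechetCdf α x ≤ c * (y - x) := by
  refine ⟨α * (1 + (Nat.factorial ⌈1 + 1 / α⌉₊ : ℝ)), by positivity, fun x y hx hxy => ?_⟩
  refine (convex_Ioi (0 : ℝ)).image_sub_le_mul_sub_of_deriv_le
    (fun z hz => (hasDerivAt_frechetCdf hz).continuousAt.continuousWithinAt)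
    (fun z hz => (hasDerivAt_frechetCdf (interior_subset hz)).differentiableAt.differentiableWithinAt)
    (fun z hz => ?_) x hx y (hx.trans_le hxy) hxy
  have hz : 0 < z := interior_subset hz
  rw [(hasDerivAt_frechetCdf hz).deriv]
  have h := rpow_mul_exp_neg_le (Real.rpow_pos_of_pos hz (-α)) (s := 1 + 1 / α) (by positivity)
  rw [← Real.rpow_mul hz.le, show -α * (1 + 1 / α) = -α - 1 by field_simp; ring] at h
  calc _ = α * (z ^ (-α - 1) * Real.exp (-z ^ (-α))) := by ring
    _ ≤ _ := by gcongr

theorem log_one_div_pos {u : ℝ} (hu : u ∈ Set.Ioo (0 : ℝ) 1) : 0 < Real.log (1 / u) :=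
  Real.log_pos (by rw [lt_div_iff₀ hu.1]; linarith [hu.2])

theorem frechetInv_pos {α u : ℝ} (hu : u ∈ Set.Ioo (0 : ℝ) 1) : 0 < frechetInv α u :=
  Real.rpow_pos_of_pos (log_one_div_pos hu) _

theorem frechetCdf_frechetInv {α u : ℝ} (hα : 0 < α) (hu : u ∈ Set.Ioo (0 : ℝ) 1) :
    frechetCdf α (frechetInv α u) = u := by
  unfold frechetCdf frechetInv
  rw [← Real.rpow_mul (log_one_div_pos hu).le, show -(1 / α) * -α = 1 by field_simp, Real.rpow_one,
    one_div, Real.log_inv, neg_neg, Real.exp_log hu.1]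

theorem measurable_frechetInv (α : ℝ) : Measurable (frechetInv α) := by
  unfold frechetInv
  fun_prop

theorem frechetInv_le_frechetInv {α u v : ℝ} (hα : 0 < α) (hu : 0 < u) (hv : v < 1) (huv : u ≤ v) :
    frechetInv α u ≤ frechetInv α v := by
  unfold frechetInv
  refine Real.rpow_le_rpow_of_nonpos (log_one_div_pos ⟨hu.trans_le huv, hv⟩) ?_ (by
    simp only [Left.neg_nonpos_iff]; positivity)
  exact Real.log_le_log (by have := hu.trans_le huv; positivity) (one_div_le_one_div_of_le hu huv)

/-- Two points of the set have quantiles at distance at most `2β`; applying the distribution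
function, the points themselves are at distance at most `2cβ`. The volume of a subset of the line is
at most its diameter. -/
theorem volume_abs_frechetInv_sub_le {α c : ℝ} (hα : 0 < α) (hc : 0 < c)
    (hlip : ∀ x y : ℝ, 0 < x → x ≤ y → frechetCdf α y - frechetCdf α x ≤ c * (y - x)) (s β : ℝ) :
    (volume.restrict (Set.Ioo (0 : ℝ) 1)) {u | |frechetInv α u - s| ≤ β}
      ≤ ENNReal.ofReal (2 * c * β) := by
  rw [Measure.restrict_apply (by
    have := measurable_frechetInv α
    exact measurableSet_le (by fun_prop) measurable_const)]
  refine (Real.volume_le_diam _).trans (Metric.ediam_le ?_)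
  have key : ∀ u ∈ {u | |frechetInv α u - s| ≤ β} ∩ Set.Ioo (0 : ℝ) 1,
      ∀ v ∈ {u | |frechetInv α u - s| ≤ β} ∩ Set.Ioo (0 : ℝ) 1, u ≤ v →
      edist u v ≤ ENNReal.ofReal (2 * c * β) := by
    rintro u ⟨hu, hu'⟩ v ⟨hv, hv'⟩ huv
    rw [edist_dist, Real.dist_eq, abs_sub_comm, abs_of_nonneg (by linarith)]
    refine ENNReal.ofReal_le_ofReal ?_
    have h := hlip _ _ (frechetInv_pos (α := α) hu') (frechetInv_le_frechetInv hα hu'.1 hv'.2 huv)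
    rw [frechetCdf_frechetInv hα hu', frechetCdf_frechetInv hα hv'] at h
    have h1 := abs_le.1 (show |_| ≤ β from hu)
    have h2 := abs_le.1 (show |_| ≤ β from hv)
    have : c * (frechetInv α v - frechetInv α u) ≤ c * (2 * β) := by gcongr; linarith
    linarith
  intro u hu v hv
  rcases le_total u v with h | h
  · exact key u hu v hv h
  · rw [edist_comm]; exact key v hv u hu h

/-! Collisions of ratios -/

/-- Fubini: condition on `S` and use the bound for each fixed value. -/
theorem measure_abs_sub_le_of_indepFun {Ω : Type*} [MeasurableSpace Ω] {P : Measure Ω}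
    [IsProbabilityMeasure P] {X S : Ω → ℝ} (hX : Measurable X) (hS : Measurable S)
    (h : IndepFun S X P) {b : ENNReal} {β : ℝ} (hb : ∀ s, P {ω | |X ω - s| ≤ β} ≤ b) :
    P {ω | |X ω - S ω| ≤ β} ≤ b := by
  have hm : MeasurableSet {q : ℝ × ℝ | |q.2 - q.1| ≤ β} :=
    measurableSet_le (by fun_prop) measurable_const
  have h1 : P {ω | |X ω - S ω| ≤ β} = (P.map (fun ω => (S ω, X ω))) {q : ℝ × ℝ | |q.2 - q.1| ≤ β} := by
    rw [Measure.map_apply (by fun_prop) hm]; rfl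
  have := Measure.isProbabilityMeasure_map (μ := P) hS.aemeasurable
  rw [h1, (indepFun_iff_map_prod_eq_prod_map_map hS.aemeasurable hX.aemeasurable).1 h,
    Measure.prod_apply hm]
  calc _ ≤ ∫⁻ _, b ∂(P.map S) := by
        refine lintegral_mono fun s => ?_
        rw [Measure.map_apply hX (measurable_prodMk_left hm)]
        exact hb s
    _ = b := by simp

/-- The term at `i₀` is then strictly below the maximum, and it is non-negative, so replacing it by
`0` leaves the maximum unchanged. The right-hand side mentions `z j i₀` only through the ratio,
which is later replaced by the equal ratio of another index. -/
theorem sketch_eq_of_ratio_ne {N K : ℕ} {f : Fin N → ℝ} (hf : ∀ i, 0 ≤ f i)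
    {z : Fin K → Fin N → ℝ} {i₀ : Fin N} {j : Fin K} (hz : 0 < z j i₀)
    (hne : sketchRatio f z i₀ j ≠ f i₀) :
    0 < sketchRatio f z i₀ j ∧
      z j i₀ = (⨆ i, f i * (if i = i₀ then 0 else z j i)) / sketchRatio f z i₀ j := by
  have : Nonempty (Fin N) := ⟨i₀⟩
  obtain ⟨i, hi⟩ := exists_eq_ciSup_of_finite (f := fun i => f i * z j i)
  have hle : ∀ i, f i * z j i ≤ sketch f z j := fun i => le_ciSup (f := fun i => f i * z j i)
    (Set.finite_range _).bddAbove i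
  have hi' : f i * z j i = sketch f z j := hi
  have hlt : f i₀ * z j i₀ < sketch f z j := by
    refine lt_of_le_of_ne (hle i₀) fun h => hne ?_
    rw [sketchRatio, ← h, mul_div_cancel_right₀ _ hz.ne']
  have hne' : i ≠ i₀ := by
    rintro rfl; exact hlt.ne hi'
  have hpos : 0 < sketch f z j := (mul_nonneg (hf i₀) hz.le).trans_lt hlt
  have heq : (⨆ i, f i * (if i = i₀ then 0 else z j i)) = sketch f z j := by
    refine le_antisymm (ciSup_le fun i' => ?_) ?_
    · by_cases h : i' = i₀
      · simpa [h] using hpos.le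
      · simpa [h] using hle i'
    · rw [← hi']
      refine le_trans (by simp [hne']) (le_ciSup (f := fun i => f i * (if i = i₀ then 0 else z j i))
        (Set.finite_range _).bddAbove i)
  refine ⟨div_pos hpos hz, ?_⟩
  rw [heq, sketchRatio]
  field_simp

/-- The formula for `S` uses only pairs other than `(j, i₀)`: the term at `i₀` has been removed from
the `j`-th maximum, and the ratio belongs to `j' ≠ j`. -/
theorem exists_indepFun_threshold {N K : ℕ} {Ω : Type*} [MeasurableSpace Ω] {P : Measure Ω}
    [IsProbabilityMeasure P] {U Z : Fin K → Fin N → Ω → ℝ} (hU : ∀ j i, Measurable (U j i))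
    (hZ : ∀ j i, Measurable (Z j i))
    (hind : iIndepFun (fun (p : Fin K × Fin N) (ω : Ω) => (U p.1 p.2 ω, Z p.1 p.2 ω)) P)
    (f : Fin N → ℝ) (i₀ : Fin N) {j j' : Fin K} (hj : j' ≠ j) :
    ∃ S : Ω → ℝ, Measurable S ∧ IndepFun S (U j i₀) P ∧
      ∀ ω, S ω = (⨆ i, f i * (if i = i₀ then 0 else Z j i ω)) /
        sketchRatio f (fun j i => Z j i ω) i₀ j' := by
  classical
  obtain ⟨T, hT⟩ : ∃ T : Finset (Fin K × Fin N), ∀ p, p ∈ T ↔ p ≠ (j, i₀) :=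
    ⟨Finset.univ.erase (j, i₀), by simp⟩
  -- Reads the second coordinate of a pair in `T`; the missing pair `(j, i₀)` is read as `0`,
  -- exactly as in the formula for `S`.
  let ext : Fin K × Fin N → (T → ℝ × ℝ) → ℝ := fun p v => if h : p ∈ T then (v ⟨p, h⟩).2 else 0
  have hext : ∀ p, Measurable (ext p) := fun p => by
    by_cases h : p ∈ T
    · simp only [ext, h, dite_true]; fun_prop
    · simp only [ext, h, dite_false]; fun_prop
  let W : Ω → T → ℝ × ℝ := fun ω p => (U p.1.1 p.1.2 ω, Z p.1.1 p.1.2 ω)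
  have hW : Measurable W := measurable_pi_lambda _ fun p => (hU _ _).prodMk (hZ _ _)
  let φ : (T → ℝ × ℝ) → ℝ := fun v =>
    (⨆ i, f i * ext (j, i) v) / ((⨆ i, f i * ext (j', i) v) / ext (j', i₀) v)
  have hφ : Measurable φ :=
    (Measurable.iSup fun i => (hext _).const_mul _).div
      ((Measurable.iSup fun i => (hext _).const_mul _).div (hext _))
  have hextW : ∀ p ω, ext p (W ω) = if p = (j, i₀) then 0 else Z p.1 p.2 ω := fun p ω => by
    by_cases h : p = (j, i₀) <;> simp [ext, W, hT, h]
  refine ⟨φ ∘ W, hφ.comp hW, ?_, fun ω => ?_⟩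
  · have h0 := hind.indepFun_finset T {(j, i₀)}
      (by rw [Finset.disjoint_singleton_right, hT]; simp) fun p => (hU _ _).prodMk (hZ _ _)
    have hψ : Measurable (fun v : (({(j, i₀)} : Finset (Fin K × Fin N)) → ℝ × ℝ) =>
        (v ⟨(j, i₀), by simp⟩).1) := by fun_prop
    have h1 := IndepFun.comp h0 hφ hψ
    exact h1
  · simp only [Function.comp_apply, φ, hextW, sketchRatio, sketch, Prod.mk.injEq, hj, false_and,
      if_false, true_and]

theorem measure_collision_le {N K : ℕ} {α c : ℝ} (hα : 0 < α) (hc : 0 < c)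
    (hlip : ∀ x y : ℝ, 0 < x → x ≤ y → frechetCdf α y - frechetCdf α x ≤ c * (y - x)) {β : ℝ}
    {Ω : Type*} [MeasurableSpace Ω] {P : Measure Ω} [IsProbabilityMeasure P]
    {U Z : Fin K → Fin N → Ω → ℝ} (hU : ∀ j i, Measurable (U j i)) (hZ : ∀ j i, Measurable (Z j i))
    (hunif : ∀ j i, P.map (U j i) = volume.restrict (Set.Ioo 0 1))
    (hind : iIndepFun (fun (p : Fin K × Fin N) (ω : Ω) => (U p.1 p.2 ω, Z p.1 p.2 ω)) P)
    {f : Fin N → ℝ} (hf : ∀ i, 0 ≤ f i) (i₀ : Fin N) {j j' : Fin K} (hj : j' ≠ j) :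
    P {ω | U j i₀ ω ∈ Set.Ioo (0 : ℝ) 1 ∧ |Z j i₀ ω - frechetInv α (U j i₀ ω)| ≤ β ∧
        sketchRatio f (fun j i => Z j i ω) i₀ j = sketchRatio f (fun j i => Z j i ω) i₀ j' ∧
        sketchRatio f (fun j i => Z j i ω) i₀ j ≠ f i₀} ≤ ENNReal.ofReal (4 * c * β) := by
  set X : Ω → ℝ := fun ω => frechetInv α (U j i₀ ω) with hXdef
  have hXm : Measurable X := (measurable_frechetInv α).comp (hU j i₀)
  obtain ⟨S, hSm, hSU, hS⟩ := exists_indepFun_threshold hU hZ hind f i₀ hj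
  have hSX : IndepFun S X P := hSU.comp measurable_id (measurable_frechetInv α)
  have hb : ∀ s, P {ω | |X ω - s| ≤ β} ≤ ENNReal.ofReal (2 * c * β) := fun s => by
    have hm : MeasurableSet {u | |frechetInv α u - s| ≤ β} := by
      have := measurable_frechetInv α
      exact measurableSet_le (by fun_prop) measurable_const
    have := volume_abs_frechetInv_sub_le hα hc hlip s β
    rwa [← hunif j i₀, Measure.map_apply (hU j i₀) hm] at this
  have hsub : {ω | U j i₀ ω ∈ Set.Ioo (0 : ℝ) 1 ∧ |Z j i₀ ω - frechetInv α (U j i₀ ω)| ≤ β ∧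
        sketchRatio f (fun j i => Z j i ω) i₀ j = sketchRatio f (fun j i => Z j i ω) i₀ j' ∧
        sketchRatio f (fun j i => Z j i ω) i₀ j ≠ f i₀}
      ⊆ {ω | |X ω - S ω| ≤ β} ∪ {ω | |X ω - 0| ≤ β} := by
    rintro ω ⟨hu, hβ, heq, hne⟩
    -- The perturbed variable need not be positive. If it is not, the positive ideal variable is
    -- within `β` of `0`, which costs another `2cβ`; otherwise `Z j i₀ = S`.
    rcases le_or_gt (Z j i₀ ω) 0 with hz | hz
    · right
      have h1 : 0 < X ω := frechetInv_pos hu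
      have h2 := (abs_le.1 hβ).1
      simp only [Set.mem_ofPred_eq, sub_zero, abs_of_pos h1]
      simp only [hXdef] at h1 ⊢
      linarith
    · left
      have hs := (sketch_eq_of_ratio_ne hf (z := fun j i => Z j i ω) hz hne).2
      have : S ω = Z j i₀ ω := by
        rw [hS, ← heq, ← hs]
      simp only [Set.mem_ofPred_eq, this, hXdef]
      rwa [abs_sub_comm]
  refine (measure_mono hsub).trans ((measure_union_le _ _).trans ?_)
  refine (add_le_add (measure_abs_sub_le_of_indepFun hXm hSm hSX hb) (hb 0)).trans ?_
  rcases le_total 0 β with h | h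
  · rw [← ENNReal.ofReal_add (by positivity) (by positivity)]
    exact ENNReal.ofReal_le_ofReal (by linarith)
  · rw [ENNReal.ofReal_of_nonpos (by nlinarith)]; simp

/-! ### The union bound for independent variables -/

theorem exists_collision_of_criterion {N K : ℕ} {hK : 2 ≤ K} {f : Fin N → ℝ}
    {z : Fin K → Fin N → ℝ} {i₀ : Fin N} (h : pointEstimate hK f z i₀ ≠ f i₀)
    (hc : criterion hK f z i₀ = 1) :
    ∃ j j', j' ≠ j ∧ sketchRatio f z i₀ j = sketchRatio f z i₀ j' ∧ sketchRatio f z i₀ j ≠ f i₀ := by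
  refine ⟨Tuple.sort (sketchRatio f z i₀) ⟨0, by omega⟩, Tuple.sort (sketchRatio f z i₀) ⟨1, by omega⟩,
    by simp, ?_, h⟩
  unfold criterion at hc
  split_ifs at hc with h'
  exact h'

/-- Since `N K² / δ ≥ 4 > e`, the logarithmic factor is at least `1`. The union bound needs only
precision of order `δ / K²`. -/
theorem precisionScale_le {α δ : ℝ} {N K : ℕ} (hα : 0 < α) (hN : 1 ≤ N) (hK : 2 ≤ K) (hδ : 0 < δ)
    (hδ1 : δ ≤ 1) : 0 ≤ precisionScale α δ N K ∧ precisionScale α δ N K ≤ δ / (K : ℝ) ^ 2 := by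
  have hN' : (1 : ℝ) ≤ N := by exact_mod_cast hN
  have hK' : (2 : ℝ) ≤ K := by exact_mod_cast hK
  have h4 : 4 ≤ N * (K : ℝ) ^ 2 / δ := by
    rw [le_div_iff₀ hδ]; nlinarith
  have hlog : 1 ≤ Real.log (N * (K : ℝ) ^ 2 / δ) := by
    rw [Real.le_log_iff_exp_le (by linarith)]
    linarith [Real.exp_one_lt_d9]
  have h1 : 1 ≤ Real.log (N * (K : ℝ) ^ 2 / δ) ^ (1 / α) :=
    Real.one_le_rpow hlog (by positivity)
  unfold precisionScale
  refine ⟨by positivity, ?_⟩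
  gcongr
  exact le_mul_of_one_le_right (by positivity) h1

universe u in
/-- The bound for the failure probability of a sketch in terms of independent variables whose
precision is at most `C` times `precisionScale`. -/
def FailureBound (α C : ℝ) : Prop :=
  ∀ (N K : ℕ) (hK : 2 ≤ K) (δ γ β : ℝ), 0 < δ → 0 < γ → γ < δ / (4 * K * N) →
    β ≤ C * precisionScale α δ N K →
    ∀ (Ω : Type u) [MeasurableSpace Ω] (P : Measure Ω) [IsProbabilityMeasure P]
      (U Z : Fin K → Fin N → Ω → ℝ),
      (∀ j i, Measurable (U j i)) → (∀ j i, Measurable (Z j i)) →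
      (∀ j i, P.map (U j i) = volume.restrict (Set.Ioo 0 1)) →
      iIndepFun (fun (p : Fin K × Fin N) (ω : Ω) => (U p.1 p.2 ω, Z p.1 p.2 ω)) P →
      (∀ᵐ ω ∂P, ∀ j i, U j i ω ∈ Set.Icc γ (1 - γ) →
        |Z j i ω - frechetInv α (U j i ω)| ≤ β) →
      ∀ (f : Fin N → ℝ), (∀ i, 0 ≤ f i) → ∀ i₀ : Fin N,
        P.real {ω | pointEstimate hK f (fun j i => Z j i ω) i₀ ≠ f i₀ ∧
          criterion hK f (fun j i => Z j i ω) i₀ = 1} ≤ δ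

universe u in
-- The `K` events that `U_j(i₀)` leaves `[γ, 1 - γ]` cost `2γ` each, at most `δ/2` in total; the
-- `K²` collisions cost `4cβ` each, again at most `δ/2` when `β ≤ δ / (8cK²)`. Outside these events
-- the variables at `i₀` have precision `β` and no collision occurs.
theorem failureBound_of_lipschitz {α c : ℝ} (hα : 0 < α) (hc : 0 < c)
    (hlip : ∀ x y : ℝ, 0 < x → x ≤ y → frechetCdf α y - frechetCdf α x ≤ c * (y - x)) :
    FailureBound.{u} α (1 / (8 * c)) := by
  intro N K hK δ γ β hδ hγ hγδ hβ Ω _ P _ U Z hU hZ hunif hind hprec f hf i₀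
  rcases le_total 1 δ with h1 | h1
  · exact measureReal_le_one.trans h1
  have hN : 1 ≤ N := Nat.one_le_iff_ne_zero.2 fun h => by subst h; exact i₀.elim0
  have hN' : (1 : ℝ) ≤ N := by exact_mod_cast hN
  have hK' : (2 : ℝ) ≤ K := by exact_mod_cast hK
  obtain ⟨hs0, hs1⟩ := precisionScale_le hα hN hK hδ h1
  -- `β` may be negative, in which case precision `β` still implies precision `0`.
  have hβ' : max β 0 ≤ δ / (8 * c * (K : ℝ) ^ 2) := by
    refine max_le ?_ (by positivity)
    calc β ≤ 1 / (8 * c) * (δ / (K : ℝ) ^ 2) := hβ.trans (by gcongr)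
      _ = _ := by field_simp
  let bad : Fin K → Set Ω := fun j => {ω | U j i₀ ω ∉ Set.Icc γ (1 - γ)}
  let coll : Fin K × Fin K → Set Ω := fun q => {ω | q.2 ≠ q.1 ∧ U q.1 i₀ ω ∈ Set.Ioo (0 : ℝ) 1 ∧
    |Z q.1 i₀ ω - frechetInv α (U q.1 i₀ ω)| ≤ max β 0 ∧
        sketchRatio f (fun j i => Z j i ω) i₀ q.1 = sketchRatio f (fun j i => Z j i ω) i₀ q.2 ∧
        sketchRatio f (fun j i => Z j i ω) i₀ q.1 ≠ f i₀}
  have hbad : ∀ j, P.real (bad j) ≤ 2 * γ := fun j => by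
    have hle : γ ≤ 1 - γ := by
      have : δ / (4 * K * N) ≤ 1 / 8 := by
        rw [div_le_div_iff₀ (by positivity) (by norm_num)]; nlinarith
      linarith
    have e : bad j = U j i₀ ⁻¹' (Set.Icc γ (1 - γ))ᶜ := rfl
    have : (P.map (U j i₀)) (Set.Icc γ (1 - γ))ᶜ ≤ ENNReal.ofReal (2 * γ) := by
      rw [hunif, Measure.restrict_apply measurableSet_Icc.compl]
      have : (Set.Icc γ (1 - γ))ᶜ ∩ Set.Ioo 0 1 ⊆ Set.Ioo 0 γ ∪ Set.Ioo (1 - γ) 1 := by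
        rintro u ⟨h, h'⟩
        simp only [Set.mem_compl_iff, Set.mem_Icc, not_and_or, not_le] at h
        rcases h with h | h
        · exact Or.inl ⟨h'.1, h⟩
        · exact Or.inr ⟨h, h'.2⟩
      refine (measure_mono this).trans ((measure_union_le _ _).trans ?_)
      rw [Real.volume_Ioo, Real.volume_Ioo, ← ENNReal.ofReal_add (by linarith) (by linarith)]
      exact ENNReal.ofReal_le_ofReal (by linarith)
    rw [Measure.map_apply (hU j i₀) measurableSet_Icc.compl, ← e] at this
    exact ENNReal.toReal_le_of_le_ofReal (by positivity) this
  have hcoll : ∀ q, P.real (coll q) ≤ 4 * c * max β 0 := fun q => by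
    have hnn : 0 ≤ 4 * c * max β 0 := by positivity
    by_cases hq : q.2 = q.1
    · have : coll q = ∅ := by ext ω; simp [coll, hq]
      simpa [this] using hnn
    · refine ENNReal.toReal_le_of_le_ofReal hnn ?_
      have := measure_collision_le (β := max β 0) hα hc hlip hU hZ hunif hind hf i₀ hq
      refine (measure_mono ?_).trans this
      exact fun ω hω => hω.2
  have hsub : ({ω | pointEstimate hK f (fun j i => Z j i ω) i₀ ≠ f i₀ ∧
      criterion hK f (fun j i => Z j i ω) i₀ = 1} : Set Ω) ≤ᵐ[P] ((⋃ j, bad j) ∪ ⋃ q, coll q : Set Ω) := by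
    filter_upwards [hprec] with ω hω h
    obtain ⟨j, j', hj, heq, hne⟩ := exists_collision_of_criterion h.1 h.2
    by_cases hu : U j i₀ ω ∈ Set.Icc γ (1 - γ)
    · refine Or.inr (Set.mem_iUnion.2 ⟨(j, j'), hj, ⟨?_, ?_⟩, ?_, heq, hne⟩)
      · linarith [hu.1]
      · linarith [hu.2]
      · exact (hω j i₀ hu).trans (le_max_left _ _)
    · exact Or.inl (Set.mem_iUnion.2 ⟨j, hu⟩)
  have hfin : P.real {ω | pointEstimate hK f (fun j i => Z j i ω) i₀ ≠ f i₀ ∧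
      criterion hK f (fun j i => Z j i ω) i₀ = 1} ≤ P.real ((⋃ j, bad j) ∪ ⋃ q, coll q) :=
    ENNReal.toReal_mono (measure_ne_top _ _) (measure_mono_ae hsub)
  calc _ ≤ _ := hfin
    _ ≤ P.real (⋃ j, bad j) + P.real (⋃ q, coll q) := measureReal_union_le _ _
    _ ≤ ∑ j, P.real (bad j) + ∑ q, P.real (coll q) :=
      add_le_add (measureReal_iUnion_fintype_le _) (measureReal_iUnion_fintype_le _)
    _ ≤ ∑ _j : Fin K, 2 * γ + ∑ _q : Fin K × Fin K, 4 * c * max β 0 :=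
      add_le_add (Finset.sum_le_sum fun j _ => hbad j) (Finset.sum_le_sum fun q _ => hcoll q)
    _ = K * (2 * γ) + K ^ 2 * (4 * c * max β 0) := by
      simp only [Finset.sum_const, Finset.card_univ, Fintype.card_fin, Fintype.card_prod,
        nsmul_eq_mul]
      push_cast
      ring
    _ ≤ K * (2 * (δ / (4 * K * 1))) + K ^ 2 * (4 * c * (δ / (8 * c * (K : ℝ) ^ 2))) := by
      gcongr
      exact hγδ.le.trans (by gcongr)
    _ = δ := by field_simp; norm_num

end

section

open scoped BigOperators
open Finset

/-! The generator of Nisan against automata -/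

/-- By pairwise independence the values at `x` and `x'` are independent and uniform, so the
expectation of the product is the square of the mean of `φ`. -/
theorem sum_mul_hash_eq_zero {B H : Type} [Fintype B] [Fintype H] [DecidableEq B] [Nonempty B]
    {hash : H → B → B} {x x' : B}
    (hpw : ∀ y y', ((univ.filter fun κ => hash κ x = y ∧ hash κ x' = y').card : ℝ)
      * (Fintype.card B : ℝ) ^ 2 = Fintype.card H)
    {φ : B → ℝ} (hφ : ∑ y, φ y = 0) : ∑ κ, φ (hash κ x) * φ (hash κ x') = 0 := by
  have hn : (Fintype.card B : ℝ) ≠ 0 := by exact_mod_cast Fintype.card_ne_zero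
  have h1 : ∀ κ, φ (hash κ x) * φ (hash κ x')
      = ∑ y, ∑ y', if hash κ x = y ∧ hash κ x' = y' then φ y * φ y' else 0 := fun κ => by
    simp [ite_and]
  have h2 : ∀ y y', (∑ κ, if hash κ x = y ∧ hash κ x' = y' then φ y * φ y' else 0)
      = (Fintype.card H / (Fintype.card B : ℝ) ^ 2) * (φ y * φ y') := fun y y' => by
    rw [← sum_filter, sum_const, nsmul_eq_mul, ← hpw y y']
    field_simp
  calc ∑ κ, φ (hash κ x) * φ (hash κ x')
      = ∑ y, ∑ y', ∑ κ, if hash κ x = y ∧ hash κ x' = y' then φ y * φ y' else 0 := by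
        simp_rw [h1]
        rw [sum_comm]
        refine sum_congr rfl fun y _ => ?_
        rw [sum_comm]
    _ = 0 := by simp_rw [h2, ← mul_sum, hφ]; simp

/-- A random member of a pairwise independent family decouples the two halves of a product. -/
theorem expect_abs_hash_mixing_le {B H : Type} [Fintype B] [Fintype H] [DecidableEq B] [Nonempty B]
    [Nonempty H] {hash : H → B → B}
    (hpw : ∀ x x', x ≠ x' → ∀ y y',
      ((univ.filter fun κ => hash κ x = y ∧ hash κ x' = y').card : ℝ)
        * (Fintype.card B : ℝ) ^ 2 = Fintype.card H)
    {f g : B → ℝ} (hf : ∀ x, f x ∈ Set.Icc (0 : ℝ) 1) (hg : ∀ x, g x ∈ Set.Icc (0 : ℝ) 1) :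
    𝔼 κ, |𝔼 x, f x * g (hash κ x) - (𝔼 x, f x) * 𝔼 x, g x| ≤ 1 / √(Fintype.card B : ℝ) := by
  have hn : (0 : ℝ) < Fintype.card B := by exact_mod_cast Fintype.card_pos
  -- Centring `g` turns the difference into an average of `f x * φ (hash κ x)`, a sum of pairwise
  -- uncorrelated terms in `κ`.
  set φ : B → ℝ := fun y => g y - 𝔼 x, g x with hφdef
  have hφ0 : ∑ y, φ y = 0 := by
    rw [hφdef, sum_sub_distrib, Fintype.expect_eq_sum_div_card, sum_const, nsmul_eq_mul, card_univ]
    field_simp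
    ring
  have hEg : 𝔼 x, g x ∈ Set.Icc (0 : ℝ) 1 :=
    ⟨expect_nonneg fun x _ => (hg x).1, expect_le univ_nonempty fun x _ => (hg x).2⟩
  have hφ1 : ∀ y, |φ y| ≤ 1 := fun y => by
    rw [abs_le]; constructor <;> simp only [hφdef] <;> linarith [(hg y).1, (hg y).2, hEg.1, hEg.2]
  have hX : ∀ κ, 𝔼 x, f x * g (hash κ x) - (𝔼 x, f x) * 𝔼 x, g x = 𝔼 x, f x * φ (hash κ x) :=
    fun κ => by simp only [hφdef, mul_sub, expect_sub_distrib, expect_mul]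
  -- Cauchy–Schwarz reduces the claim to the second moment; in the expanded square only the diagonal
  -- `x = x'` survives, a fraction `1 / |B|` of all pairs.
  have hsq : (𝔼 κ, |𝔼 x, f x * φ (hash κ x)|) ^ 2 ≤ 𝔼 κ, (𝔼 x, f x * φ (hash κ x)) ^ 2 := by
    have := expect_mul_sq_le_sq_mul_sq univ (fun κ => |𝔼 x, f x * φ (hash κ x)|) fun _ => (1 : ℝ)
    simpa using this
  have hdiag : ∀ x x', |𝔼 κ, φ (hash κ x) * φ (hash κ x')| ≤ if x = x' then 1 else 0 :=
    fun x x' => by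
      split_ifs with h
      · refine (abs_expect_le _ _).trans (expect_le univ_nonempty fun κ _ => ?_)
        rw [abs_mul]
        exact mul_le_one₀ (hφ1 _) (abs_nonneg _) (hφ1 _)
      · rw [Fintype.expect_eq_sum_div_card, sum_mul_hash_eq_zero (hpw x x' h) hφ0]; simp
  have hvar : 𝔼 κ, (𝔼 x, f x * φ (hash κ x)) ^ 2 ≤ 1 / (Fintype.card B : ℝ) := by
    calc 𝔼 κ, (𝔼 x, f x * φ (hash κ x)) ^ 2
        = 𝔼 x, 𝔼 x', (f x * f x') * 𝔼 κ, φ (hash κ x) * φ (hash κ x') := by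
          simp_rw [pow_two, expect_mul_expect, mul_expect]
          rw [expect_comm]
          refine expect_congr rfl fun x _ => ?_
          rw [expect_comm]
          refine expect_congr rfl fun x' _ => expect_congr rfl fun κ _ => ?_
          ring
      _ ≤ 𝔼 x : B, 𝔼 x' : B, if x = x' then (1 : ℝ) else 0 := by
          refine expect_le_expect fun x _ => expect_le_expect fun x' _ => ?_
          refine (le_abs_self _).trans ?_
          rw [abs_mul]
          refine (mul_le_of_le_one_left (abs_nonneg _) ?_).trans (hdiag x x')
          rw [abs_of_nonneg (mul_nonneg (hf x).1 (hf x').1)]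
          exact mul_le_one₀ (hf x).2 (hf x').1 (hf x').2
      _ = 1 / (Fintype.card B : ℝ) := by
          simp
  simp_rw [hX]
  refine Real.le_sqrt_of_sq_le (hsq.trans hvar) |>.trans ?_
  rw [Real.sqrt_div zero_le_one, Real.sqrt_one]

/-! ### Automata reading truly random and pseudo-random blocks -/

section Automaton

set_option linter.unusedSectionVars false

variable {B St : Type}

/-- Final state of a time-dependent automaton that starts at time `o` and reads a list of blocks. -/
def runAutomaton (τ : ℕ → St → B → St) : ℕ → St → List B → St
  | _, a, [] => a
  | o, a, b :: l => runAutomaton τ (o + 1) (τ o a b) l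

theorem runAutomaton_append (τ : ℕ → St → B → St) (o : ℕ) (a : St) (l l' : List B) :
    runAutomaton τ o a (l ++ l') = runAutomaton τ (o + l.length) (runAutomaton τ o a l) l' := by
  induction l generalizing o a with
  | nil => simp [runAutomaton]
  | cons b l ih => simp [runAutomaton, ih, add_assoc, add_comm 1]

theorem length_nisanGenerator (k : ℕ) (h : Fin k → B → B) (x : B) :
    (nisanGenerator k h x).length = 2 ^ k := by
  induction k generalizing x with
  | zero => rfl
  | succ k ih => simp [nisanGenerator, ih, pow_succ, mul_two]

variable [Fintype B] [Fintype St] [DecidableEq St]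

/-- Probability that the automaton is in state `c` after `n` truly random blocks. -/
noncomputable def automatonDist (τ : ℕ → St → B → St) : ℕ → ℕ → St → St → ℝ
  | 0, _, a, c => if a = c then 1 else 0
  | n + 1, o, a, c => 𝔼 b, automatonDist τ n (o + 1) (τ o a b) c

/-- The Chapman–Kolmogorov equation. -/
theorem automatonDist_add (τ : ℕ → St → B → St) (m n o : ℕ) (a c : St) :
    automatonDist τ (m + n) o a c
      = ∑ s, automatonDist τ m o a s * automatonDist τ n (o + m) s c := by
  induction m generalizing o a with
  | zero => simp [automatonDist]
  | succ m ih =>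
    rw [add_right_comm]
    simp only [automatonDist, ih, expect_mul]
    rw [expect_sum_comm]
    simp_rw [add_assoc, add_comm 1]

theorem automatonDist_nonneg (τ : ℕ → St → B → St) (n o : ℕ) (a c : St) :
    0 ≤ automatonDist τ n o a c := by
  induction n generalizing o a with
  | zero => simp only [automatonDist]; split_ifs <;> norm_num
  | succ n ih => exact expect_nonneg fun b _ => ih _ _

theorem sum_automatonDist [Nonempty B] (τ : ℕ → St → B → St) (n o : ℕ) (a : St) :
    ∑ c, automatonDist τ n o a c = 1 := by
  induction n generalizing o a with
  | zero => simp [automatonDist]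
  | succ n ih =>
    simp only [automatonDist]
    rw [← expect_sum_comm]
    simp [ih]

theorem automatonDist_eq_expect [Nonempty B] (τ : ℕ → St → B → St) (n o : ℕ) (a c : St) :
    automatonDist τ n o a c
      = 𝔼 b : Fin n → B, if runAutomaton τ o a (List.ofFn b) = c then (1 : ℝ) else 0 := by
  induction n generalizing o a with
  | zero => simp [automatonDist, runAutomaton]
  | succ n ih =>
    rw [← Fintype.expect_equiv (Fin.consEquiv fun _ => B)
      (fun q => if runAutomaton τ o a (List.ofFn (Fin.consEquiv (fun _ => B) q)) = c
        then (1 : ℝ) else 0) _ (fun _ => rfl), ← univ_product_univ, expect_product]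
    simp only [automatonDist, ih]
    refine expect_congr rfl fun b _ => expect_congr rfl fun l _ => ?_
    simp [Fin.consEquiv, List.ofFn_succ, runAutomaton]

/-- The generator yields `2 ^ k` blocks, while only the first `N` matter; an automaton that freezes
at time `N` ignores the rest. -/
theorem automatonDist_eq_of_stationary [Nonempty B] {τ : ℕ → St → B → St} {N : ℕ}
    (hτ : ∀ o, N ≤ o → ∀ a b, τ o a b = a) {n : ℕ} (hn : N ≤ n) (a c : St) :
    automatonDist τ n 0 a c = automatonDist τ N 0 a c := by
  have h : ∀ m o s, N ≤ o → automatonDist τ m o s c = if s = c then 1 else 0 := fun m => by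
    induction m with
    | zero => intro o s _; rfl
    | succ m ih => intro o s ho; simp [automatonDist, hτ o ho, ih _ _ (ho.trans (Nat.le_succ o))]
  obtain ⟨m, rfl⟩ := Nat.exists_eq_add_of_le hn
  rw [automatonDist_add]
  simp [zero_add, h m N _ le_rfl]

variable {H : Type}

/-- Probability that the automaton is in state `c` after the blocks of the generator. -/
noncomputable def nisanDist (hash : H → B → B) (τ : ℕ → St → B → St) (k : ℕ) (κ : Fin k → H)
    (o : ℕ) (a c : St) : ℝ :=
  𝔼 x, if runAutomaton τ o a (nisanGenerator k (fun t => hash (κ t)) x) = c then (1 : ℝ) else 0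

theorem nisanDist_nonneg (hash : H → B → B) (τ : ℕ → St → B → St) (k : ℕ) (κ : Fin k → H)
    (o : ℕ) (a c : St) : 0 ≤ nisanDist hash τ k κ o a c :=
  expect_nonneg fun x _ => by split_ifs <;> norm_num

theorem sum_nisanDist [Nonempty B] (hash : H → B → B) (τ : ℕ → St → B → St) (k : ℕ) (κ : Fin k → H)
    (o : ℕ) (a : St) : ∑ c, nisanDist hash τ k κ o a c = 1 := by
  unfold nisanDist
  rw [← expect_sum_comm]
  simp

/-- The two halves of the output come from `x` and `hash l x`. With `X` the true joint probability
of an intermediate state `s` and a final state `c`, `P`, `P'` the laws of the half-length generator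
and `D`, `D'` those of random blocks, `X - D D' = (X - P P') + (P - D) P' + D (P' - D')`. The first
term is the dependence between the halves; the other two are errors of the shorter generator,
weighted by probabilities. -/
theorem sum_abs_nisanDist_succ_le [Nonempty B] (hash : H → B → B) (τ : ℕ → St → B → St) (k : ℕ)
    (κ : Fin k → H) (l : H) (o : ℕ) (a : St) :
    ∑ c, |nisanDist hash τ (k + 1) (Fin.snoc κ l : Fin (k + 1) → H) o a c
        - automatonDist τ (2 ^ (k + 1)) o a c|
      ≤ (∑ c, ∑ s, |𝔼 x,
            (if runAutomaton τ o a (nisanGenerator k (fun t => hash (κ t)) x) = s then (1 : ℝ) else 0)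
            * (if runAutomaton τ (o + 2 ^ k) s (nisanGenerator k (fun t => hash (κ t)) (hash l x)) = c
                then (1 : ℝ) else 0)
            - nisanDist hash τ k κ o a s * nisanDist hash τ k κ (o + 2 ^ k) s c|)
        + ∑ s, |nisanDist hash τ k κ o a s - automatonDist τ (2 ^ k) o a s|
        + ∑ s, automatonDist τ (2 ^ k) o a s *
            ∑ c, |nisanDist hash τ k κ (o + 2 ^ k) s c - automatonDist τ (2 ^ k) (o + 2 ^ k) s c| := by
  have hsplit : ∀ c, nisanDist hash τ (k + 1) (Fin.snoc κ l : Fin (k + 1) → H) o a c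
      = ∑ s, 𝔼 x,
            (if runAutomaton τ o a (nisanGenerator k (fun t => hash (κ t)) x) = s then (1 : ℝ) else 0)
            * (if runAutomaton τ (o + 2 ^ k) s (nisanGenerator k (fun t => hash (κ t)) (hash l x)) = c
                then (1 : ℝ) else 0) := fun c => by
    rw [← expect_sum_comm]
    refine expect_congr rfl fun x _ => ?_
    simp only [nisanGenerator, runAutomaton_append, length_nisanGenerator, Fin.snoc_castSucc,
      Fin.snoc_last, ite_mul, one_mul, zero_mul, Finset.sum_ite_eq, mem_univ, if_true]
  have hP := fun s => sum_nisanDist hash τ k κ (o + 2 ^ k) s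
  have hP0 := fun s c => nisanDist_nonneg hash τ k κ (o + 2 ^ k) s c
  have hD0 := fun s => automatonDist_nonneg τ (2 ^ k) o a s
  set X := fun s c => 𝔼 x,
            (if runAutomaton τ o a (nisanGenerator k (fun t => hash (κ t)) x) = s then (1 : ℝ) else 0)
            * (if runAutomaton τ (o + 2 ^ k) s (nisanGenerator k (fun t => hash (κ t)) (hash l x)) = c
                then (1 : ℝ) else 0)
  set P := nisanDist hash τ k κ o a
  set P' := nisanDist hash τ k κ (o + 2 ^ k)
  set D := automatonDist τ (2 ^ k) o a
  set D' := automatonDist τ (2 ^ k) (o + 2 ^ k)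
  have hpt : ∀ c, |nisanDist hash τ (k + 1) (Fin.snoc κ l : Fin (k + 1) → H) o a c
        - automatonDist τ (2 ^ (k + 1)) o a c|
      ≤ ∑ s, |X s c - P s * P' s c| + ∑ s, |P s - D s| * P' s c + ∑ s, D s * |P' s c - D' s c| :=
    fun c => by
      rw [hsplit, pow_succ, mul_two, automatonDist_add, ← sum_sub_distrib, ← sum_add_distrib,
        ← sum_add_distrib]
      refine (abs_sum_le_sum_abs _ _).trans (sum_le_sum fun s _ => ?_)
      calc |X s c - D s * D' s c|
          = |(X s c - P s * P' s c) + (P s - D s) * P' s c + D s * (P' s c - D' s c)| := by ring_nf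
        _ ≤ |X s c - P s * P' s c| + |(P s - D s) * P' s c| + |D s * (P' s c - D' s c)| :=
          abs_add_three _ _ _
        _ = _ := by rw [abs_mul, abs_mul, abs_of_nonneg (hP0 s c), abs_of_nonneg (hD0 s)]
  refine (sum_le_sum fun c _ => hpt c).trans ?_
  rw [sum_add_distrib, sum_add_distrib]
  refine add_le_add (add_le_add le_rfl ?_) ?_
  · rw [sum_comm]
    simp_rw [← mul_sum, hP, mul_one]
    exact le_rfl
  · rw [sum_comm]
    simp_rw [← mul_sum]
    exact le_rfl

/-- The generator fools automata with few states, on average over the hash functions. -/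
theorem expect_sum_abs_nisanDist_sub_le [Nonempty B] [DecidableEq B] [Fintype H] [Nonempty H]
    {hash : H → B → B}
    (hpw : ∀ x x', x ≠ x' → ∀ y y',
      ((univ.filter fun κ => hash κ x = y ∧ hash κ x' = y').card : ℝ)
        * (Fintype.card B : ℝ) ^ 2 = Fintype.card H)
    (τ : ℕ → St → B → St) (k o : ℕ) (a : St) :
    𝔼 κ : Fin k → H, ∑ c, |nisanDist hash τ k κ o a c - automatonDist τ (2 ^ k) o a c|
      ≤ (2 ^ k - 1) * ((Fintype.card St : ℝ) ^ 2 * (1 / √(Fintype.card B : ℝ))) := by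
  set ρ : ℝ := (Fintype.card St : ℝ) ^ 2 * (1 / √(Fintype.card B : ℝ)) with hρ
  induction k generalizing o a with
  | zero => simp [nisanDist, automatonDist, nisanGenerator, runAutomaton]
  | succ k ih =>
    -- With the other hash functions fixed, the last one decouples the halves up to `1 / √|B|` for
    -- each of the `|St|²` pairs of an intermediate and a final state.
    have hmix : ∀ κ : Fin k → H, 𝔼 l : H, (∑ c, ∑ s, |𝔼 x,
            (if runAutomaton τ o a (nisanGenerator k (fun t => hash (κ t)) x) = s then (1 : ℝ) else 0)
            * (if runAutomaton τ (o + 2 ^ k) s (nisanGenerator k (fun t => hash (κ t)) (hash l x)) = c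
                then (1 : ℝ) else 0)
            - nisanDist hash τ k κ o a s * nisanDist hash τ k κ (o + 2 ^ k) s c|) ≤ ρ := fun κ => by
      rw [expect_sum_comm]
      simp_rw [expect_sum_comm univ univ]
      have h01 : ∀ p : Prop, [Decidable p] → (if p then (1 : ℝ) else 0) ∈ Set.Icc (0 : ℝ) 1 := by
        intro p _; split_ifs <;> simp
      refine (sum_le_sum fun c _ => sum_le_sum fun s _ => expect_abs_hash_mixing_le hpw
        (f := fun x => if runAutomaton τ o a (nisanGenerator k (fun t => hash (κ t)) x) = s
          then (1 : ℝ) else 0)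
        (g := fun y => if runAutomaton τ (o + 2 ^ k) s (nisanGenerator k (fun t => hash (κ t)) y) = c
          then (1 : ℝ) else 0) (fun x => h01 _) (fun y => h01 _)).trans (le_of_eq ?_)
      simp only [sum_const, card_univ, nsmul_eq_mul, hρ]
      ring
    rw [← Fintype.expect_equiv (Fin.snocEquiv fun _ => H)
      (fun q => ∑ c, |nisanDist hash τ (k + 1) (Fin.snocEquiv (fun _ => H) q) o a c
        - automatonDist τ (2 ^ (k + 1)) o a c|) _ (fun _ => rfl), ← univ_product_univ,
      expect_product, expect_comm]
    calc _ ≤ 𝔼 κ : Fin k → H, (ρ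
            + ∑ s, |nisanDist hash τ k κ o a s - automatonDist τ (2 ^ k) o a s|
            + ∑ s, automatonDist τ (2 ^ k) o a s *
              ∑ c, |nisanDist hash τ k κ (o + 2 ^ k) s c
                - automatonDist τ (2 ^ k) (o + 2 ^ k) s c|) := by
          refine expect_le_expect fun κ _ => ?_
          refine (expect_le_expect fun l _ => sum_abs_nisanDist_succ_le hash τ k κ l o a).trans ?_
          rw [expect_add_distrib, expect_add_distrib, Fintype.expect_const, Fintype.expect_const]
          gcongr
          exact hmix κ
      -- The error satisfies `e (k+1) ≤ ρ + 2 e k` with `e 0 = 0`, whence the factor `2 ^ k - 1`.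
      _ ≤ ρ + (2 ^ k - 1) * ρ + ∑ s, automatonDist τ (2 ^ k) o a s * ((2 ^ k - 1) * ρ) := by
          rw [expect_add_distrib, expect_add_distrib, Fintype.expect_const]
          refine add_le_add (add_le_add le_rfl (ih o a)) ?_
          rw [expect_sum_comm]
          refine sum_le_sum fun s _ => ?_
          rw [← mul_expect]
          exact mul_le_mul_of_nonneg_left (ih _ s) (automatonDist_nonneg _ _ _ _ _)
      _ = (2 ^ (k + 1) - 1) * ρ := by
          rw [← sum_mul, sum_automatonDist]
          ring

/-- Acceptance probabilities under the generator and under truly random blocks. -/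
theorem expect_nisan_le [Nonempty B] [DecidableEq B] [Fintype H] [Nonempty H]
    {hash : H → B → B}
    (hpw : ∀ x x', x ≠ x' → ∀ y y',
      ((univ.filter fun κ => hash κ x = y ∧ hash κ x' = y').card : ℝ)
        * (Fintype.card B : ℝ) ^ 2 = Fintype.card H)
    {τ : ℕ → St → B → St} {N k : ℕ} (hN : N ≤ 2 ^ k) (hτ : ∀ o, N ≤ o → ∀ a b, τ o a b = a)
    (a : St) (bad : St → Prop) [DecidablePred bad] :
    𝔼 κ : Fin k → H, 𝔼 x,
        (if bad (runAutomaton τ 0 a (nisanGenerator k (fun t => hash (κ t)) x)) then (1 : ℝ) else 0)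
      ≤ (𝔼 b : Fin N → B, if bad (runAutomaton τ 0 a (List.ofFn b)) then (1 : ℝ) else 0)
        + 2 ^ k * ((Fintype.card St : ℝ) ^ 2 * (1 / √(Fintype.card B : ℝ))) := by
  have hfib : ∀ s : St, (if bad s then (1 : ℝ) else 0)
      = ∑ c ∈ univ.filter bad, if s = c then (1 : ℝ) else 0 := fun s => by simp
  have h1 : ∀ κ : Fin k → H, (𝔼 x,
        (if bad (runAutomaton τ 0 a (nisanGenerator k (fun t => hash (κ t)) x)) then (1 : ℝ) else 0))
      = ∑ c ∈ univ.filter bad, nisanDist hash τ k κ 0 a c := fun κ => by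
    unfold nisanDist
    rw [← expect_sum_comm]
    exact expect_congr rfl fun x _ => hfib _
  have h2 : (𝔼 b : Fin N → B, if bad (runAutomaton τ 0 a (List.ofFn b)) then (1 : ℝ) else 0)
      = ∑ c ∈ univ.filter bad, automatonDist τ (2 ^ k) 0 a c := by
    simp_rw [automatonDist_eq_of_stationary hτ hN, automatonDist_eq_expect]
    rw [← expect_sum_comm]
    exact expect_congr rfl fun x _ => hfib _
  -- Restricting to the bad final states can only decrease the sum of the absolute differences.
  have h3 : ∀ κ : Fin k → H, ∑ c ∈ univ.filter bad, nisanDist hash τ k κ 0 a c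
      ≤ ∑ c ∈ univ.filter bad, automatonDist τ (2 ^ k) 0 a c
        + ∑ c, |nisanDist hash τ k κ 0 a c - automatonDist τ (2 ^ k) 0 a c| := fun κ => by
    rw [← sub_le_iff_le_add', ← sum_sub_distrib]
    refine (sum_le_sum fun c _ => le_abs_self _).trans ?_
    exact sum_le_sum_of_subset_of_nonneg (filter_subset _ _) fun _ _ _ => abs_nonneg _
  simp_rw [h1]
  rw [h2]
  refine (expect_le_expect fun κ _ => h3 κ).trans ?_
  rw [expect_add_distrib, Fintype.expect_const]
  refine add_le_add le_rfl ((expect_sum_abs_nisanDist_sub_le hpw τ k 0 a).trans ?_)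
  gcongr
  linarith

end Automaton

end

/-! Fixed point arithmetic for the Fréchet quantile function -/

/-- The number `exp (-lam 2^t)`, rounded down to `p` binary digits. -/
noncomputable def expConst (p : ℕ) (lam : ℝ) (t : ℕ) : ℕ :=
  ⌊(2 : ℝ) ^ p * Real.exp (-(lam * 2 ^ t))⌋₊

/-- Multiplication by `exp (-lam 2^t)` if the bit `t` of `Y` is set. -/
noncomputable def powStep (p : ℕ) (lam : ℝ) (Y acc t : ℕ) : ℕ :=
  if Y.testBit t then acc * expConst p lam t / 2 ^ p else acc

/-- Fixed point version of `exp (-lam Y)` for `Y < 2 ^ n`. -/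
noncomputable def powFix (p : ℕ) (lam : ℝ) (n Y : ℕ) : ℕ :=
  (List.range n).foldl (powStep p lam Y) (2 ^ p)

theorem powFix_succ (p : ℕ) (lam : ℝ) (n Y : ℕ) :
    powFix p lam (n + 1) Y = powStep p lam Y (powFix p lam n Y) n := by
  simp [powFix, List.range_succ]

theorem expConst_le {p : ℕ} {lam : ℝ} (hlam : 0 ≤ lam) (t : ℕ) : expConst p lam t ≤ 2 ^ p := by
  refine Nat.floor_le_of_le ?_
  push_cast
  refine mul_le_of_le_one_right (by positivity) (Real.exp_le_one_iff.2 ?_)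
  have : 0 ≤ lam * 2 ^ t := by positivity
  linarith

theorem foldl_powStep_le {p : ℕ} {lam : ℝ} (hlam : 0 ≤ lam) (n Y : ℕ) : powFix p lam n Y ≤ 2 ^ p := by
  induction n with
  | zero => simp [powFix]
  | succ n ih =>
    rw [powFix_succ, powStep]
    split_ifs
    · exact Nat.div_le_of_le_mul (Nat.mul_le_mul ih (expConst_le hlam n))
    · exact ih

/-- All roundings go down, which gives the lower bound. Each bit that is set loses at most two
units, one from the rounded constant and one from the division; earlier errors do not grow, because
all factors are at most `1`. -/
theorem powFix_mod_approx {p : ℕ} {lam : ℝ} (hlam : 0 ≤ lam) (n Y : ℕ) :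
    (powFix p lam n Y : ℝ) / 2 ^ p ≤ Real.exp (-(lam * (Y % 2 ^ n : ℕ))) ∧
      Real.exp (-(lam * (Y % 2 ^ n : ℕ))) ≤ (powFix p lam n Y : ℝ) / 2 ^ p + 2 * n / 2 ^ p := by
  have hP : (0 : ℝ) < 2 ^ p := by positivity
  induction n with
  | zero => simp [powFix, Nat.mod_one]
  | succ n ih =>
    rw [powFix_succ, Nat.mod_pow_succ, ← Nat.toNat_testBit, powStep]
    by_cases hb : Y.testBit n
    · simp only [hb, if_true, Bool.toNat_true, mul_one]
      set A := powFix p lam n Y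
      have hA1 : (A : ℝ) / 2 ^ p ≤ 1 := by
        rw [div_le_one hP]; exact_mod_cast foldl_powStep_le hlam n Y
      set e := Real.exp (-(lam * (Y % 2 ^ n : ℕ)))
      set c := Real.exp (-(lam * 2 ^ n)) with hc
      have hec : Real.exp (-(lam * ((Y % 2 ^ n + 2 ^ n : ℕ) : ℝ))) = e * c := by
        rw [← Real.exp_add]; push_cast; ring_nf
      rw [hec]
      have he0 : 0 < e := Real.exp_pos _
      have he1 : e ≤ 1 := Real.exp_le_one_iff.2 (by
        have : 0 ≤ lam * (Y % 2 ^ n : ℕ) := by positivity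
        linarith)
      have hC1 : (expConst p lam n : ℝ) / 2 ^ p ≤ c := by
        rw [div_le_iff₀ hP, mul_comm]; exact Nat.floor_le (by positivity)
      have hC2 : c ≤ (expConst p lam n : ℝ) / 2 ^ p + 1 / 2 ^ p := by
        rw [← add_div, le_div_iff₀ hP, mul_comm]; exact (Nat.lt_floor_add_one _).le
      have hCle : (expConst p lam n : ℝ) / 2 ^ p ≤ 1 := by
        rw [div_le_one hP]; exact_mod_cast expConst_le hlam n
      set C := (expConst p lam n : ℝ) / 2 ^ p
      have hC0 : 0 ≤ C := by positivity
      have hA0 : 0 ≤ (A : ℝ) / 2 ^ p := by positivity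
      have hAC : (A : ℝ) / 2 ^ p * C = (A * expConst p lam n : ℕ) / (2 ^ p : ℕ) / 2 ^ p := by
        push_cast; simp only [C]; field_simp
      have hlo : ((A * expConst p lam n / 2 ^ p : ℕ) : ℝ) / 2 ^ p ≤ A / 2 ^ p * C := by
        rw [hAC]; gcongr; exact Nat.cast_div_le
      have hhi : (A : ℝ) / 2 ^ p * C ≤ ((A * expConst p lam n / 2 ^ p : ℕ) : ℝ) / 2 ^ p + 1 / 2 ^ p := by
        rw [hAC, ← add_div]; gcongr
        rw [← Nat.floor_div_eq_div (K := ℝ)]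
        exact (Nat.lt_floor_add_one _).le
      constructor
      · exact hlo.trans (mul_le_mul ih.1 hC1 hC0 he0.le)
      · have h1 : e * c ≤ A / 2 ^ p * C + (1 / 2 ^ p + 2 * n / 2 ^ p) := by
          have h3 : e * (c - C) ≤ 1 * (1 / 2 ^ p) :=
            mul_le_mul he1 (by linarith) (by linarith) zero_le_one
          have h4 : (e - A / 2 ^ p) * C ≤ 2 * n / 2 ^ p * 1 :=
            mul_le_mul (by linarith [ih.2]) hCle hC0 (by positivity)
          nlinarith
        push_cast
        have h2 : (2 : ℝ) * (n + 1) / 2 ^ p = 1 / 2 ^ p + (1 / 2 ^ p + 2 * n / 2 ^ p) := by ring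
        rw [h2]
        linarith
    · simp only [hb, Bool.toNat_false, mul_zero, add_zero]
      refine ⟨ih.1, ih.2.trans ?_⟩
      gcongr
      · simp
      · exact Nat.le_succ n

theorem powFix_approx {p : ℕ} {lam : ℝ} (hlam : 0 ≤ lam) {n Y : ℕ} (hY : Y < 2 ^ n) :
    (powFix p lam n Y : ℝ) / 2 ^ p ≤ Real.exp (-(lam * Y)) ∧
      Real.exp (-(lam * Y)) ≤ (powFix p lam n Y : ℝ) / 2 ^ p + 2 * n / 2 ^ p := by
  have := powFix_mod_approx (p := p) hlam n Y
  rwa [Nat.mod_eq_of_lt hY] at this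

/-- One step of a binary search for the last argument that passes a test. -/
def searchStep (test : ℕ → Prop) [DecidablePred test] (R t : ℕ) : ℕ :=
  if test (R + 2 ^ t) then R + 2 ^ t else R

/-- Binary search in `{0, …, 2 ^ T - 1}`. -/
def binSearch (test : ℕ → Prop) [DecidablePred test] (T : ℕ) : ℕ :=
  (List.range T).reverse.foldl (searchStep test) 0

/-- The invariant is that `R` is `0` or passes the test, while `R + 2 ^ t` is the right end or fails
it. The test is not assumed monotone, so monotonicity of the rounded distribution function is never
needed. -/
theorem foldl_searchStep_spec (test : ℕ → Prop) [DecidablePred test] (T t R : ℕ)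
    (h0 : R = 0 ∨ test R) (hle : R + 2 ^ t ≤ 2 ^ T) (h1 : R + 2 ^ t = 2 ^ T ∨ ¬test (R + 2 ^ t)) :
    ((List.range t).reverse.foldl (searchStep test) R = 0 ∨
        test ((List.range t).reverse.foldl (searchStep test) R)) ∧
      (List.range t).reverse.foldl (searchStep test) R + 1 ≤ 2 ^ T ∧
      ((List.range t).reverse.foldl (searchStep test) R + 1 = 2 ^ T ∨
        ¬test ((List.range t).reverse.foldl (searchStep test) R + 1)) := by
  induction t generalizing R with
  | zero => simpa using ⟨h0, hle, h1⟩
  | succ t ih =>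
    rw [List.range_succ, List.reverse_append]
    simp only [List.reverse_singleton, List.cons_append, List.nil_append, List.foldl_cons]
    rw [pow_succ, mul_two, ← add_assoc] at hle h1
    unfold searchStep
    split_ifs with h
    · exact ih _ (Or.inr h) hle h1
    · exact ih _ h0 (by have := Nat.zero_le (2 ^ t); linarith) (Or.inr h)

theorem binSearch_spec (test : ℕ → Prop) [DecidablePred test] (T : ℕ) :
    (binSearch test T = 0 ∨ test (binSearch test T)) ∧ binSearch test T + 1 ≤ 2 ^ T ∧
      (binSearch test T + 1 = 2 ^ T ∨ ¬test (binSearch test T + 1)) :=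
  foldl_searchStep_spec test T T 0 (Or.inl rfl) (by simp) (Or.inl (by simp))

/-- Logarithmic mesh of the grid on `[2^(-h), 2^h]` in which the quantile is searched. -/
noncomputable def gridMesh (p h : ℕ) : ℝ := 2 * h * Real.log 2 / 2 ^ p

/-- The points of the grid. -/
noncomputable def gridPoint (p h R : ℕ) : ℝ :=
  2 ^ h * Real.exp (-(gridMesh p h * (2 ^ p - 1 - R)))

/-- The value of `x ^ (-α)` at the first point of the grid. -/
noncomputable def gridScale (α : ℝ) (p h : ℕ) : ℝ := gridPoint p h 0 ^ (-α)

/-- Fixed point version of the distribution function at a point of the grid. -/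
noncomputable def cdfFix (α : ℝ) (p h R : ℕ) : ℕ :=
  powFix p (gridScale α p h / 2 ^ p) (p + 1) (powFix p (α * gridMesh p h) p R)

/-- Fixed point version of the quantile function. -/
noncomputable def quantileFix (α : ℝ) (p h U : ℕ) : ℕ :=
  2 ^ h * powFix p (gridMesh p h) p (2 ^ p - 1 - binSearch (fun R => cdfFix α p h R ≤ U) p) + 1

/-! ### Accuracy of the fixed point quantile function -/

theorem gridMesh_nonneg (p h : ℕ) : 0 ≤ gridMesh p h := by
  unfold gridMesh
  have := Real.log_nonneg one_le_two
  positivity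

theorem gridPoint_pos (p h R : ℕ) : 0 < gridPoint p h R := by
  unfold gridPoint; positivity

/-- The grid is geometric, hence so is the sequence of the values `x^(-α)`. This is what makes the
distribution function computable by two nested calls of `powFix`, without logarithms or powers. -/
theorem gridPoint_rpow (α : ℝ) (p h R : ℕ) :
    gridPoint p h R ^ (-α) = gridScale α p h * Real.exp (-(α * gridMesh p h * R)) := by
  have h1 : gridPoint p h R = gridPoint p h 0 * Real.exp (gridMesh p h * R) := by
    unfold gridPoint
    rw [mul_assoc, ← Real.exp_add]
    congr 2
    push_cast
    ring
  rw [h1, Real.mul_rpow (gridPoint_pos p h 0).le (Real.exp_pos _).le, ← Real.exp_mul, gridScale]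
  congr 2
  ring

theorem exp_neg_sub_exp_neg_le {a b : ℝ} (ha : 0 ≤ a) (hab : a ≤ b) :
    Real.exp (-a) - Real.exp (-b) ≤ b - a := by
  have h1 : Real.exp (-b) = Real.exp (-a) * Real.exp (-(b - a)) := by rw [← Real.exp_add]; ring_nf
  have h2 := Real.one_sub_le_exp_neg (b - a)
  have h3 : Real.exp (-a) ≤ 1 := Real.exp_le_one_iff.2 (by linarith)
  have h4 : Real.exp (-(b - a)) ≤ 1 := Real.exp_le_one_iff.2 (by linarith)
  rw [h1]
  nlinarith [Real.exp_pos (-a)]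

/-- Error bound for `cdfFix`. -/
noncomputable def cdfError (α : ℝ) (p h : ℕ) : ℝ := 2 * (p + 1) * (1 + gridScale α p h) / 2 ^ p

/-- The inner exponential is accurate to `2p / 2^p`, which the factor `gridScale` magnifies; `exp
(-·)` is 1-Lipschitz on the positive half-line and does not increase this error, and the outer
exponential adds `2(p+1) / 2^p`. -/
theorem abs_cdfFix_sub_le {α : ℝ} (hα : 0 < α) {p h R : ℕ} (hR : R < 2 ^ p) :
    |(cdfFix α p h R : ℝ) / 2 ^ p - frechetCdf α (gridPoint p h R)| ≤ cdfError α p h := by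
  have hy0 : 0 ≤ gridScale α p h := (Real.rpow_pos_of_pos (gridPoint_pos p h 0) _).le
  have hl : 0 ≤ α * gridMesh p h := mul_nonneg hα.le (gridMesh_nonneg p h)
  have hP : (0 : ℝ) < 2 ^ p := by positivity
  obtain ⟨a1, a2⟩ := powFix_approx (p := p) hl hR
  -- The inner value may equal `2 ^ p`, so the outer exponent needs `p + 1` bits.
  have hY : powFix p (α * gridMesh p h) p R < 2 ^ (p + 1) :=
    (foldl_powStep_le hl p R).trans_lt (Nat.pow_lt_pow_right one_lt_two (Nat.lt_succ_self p))
  obtain ⟨b1, b2⟩ := powFix_approx (p := p) (div_nonneg hy0 hP.le) hY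
  unfold frechetCdf cdfFix
  rw [gridPoint_rpow]
  set Y := powFix p (α * gridMesh p h) p R
  set y := gridScale α p h
  set E := Real.exp (-(α * gridMesh p h * R))
  rw [show y / 2 ^ p * (Y : ℝ) = y * (Y / 2 ^ p) by ring] at b1 b2
  have c1 := exp_neg_sub_exp_neg_le (a := y * (Y / 2 ^ p)) (b := y * E) (by positivity) (by gcongr)
  have c2 : Real.exp (-(y * E)) ≤ Real.exp (-(y * (Y / 2 ^ p))) :=
    Real.exp_le_exp.2 (by have : y * (Y / 2 ^ p) ≤ y * E := by gcongr
                          linarith)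
  have c3 : y * E - y * (Y / 2 ^ p) ≤ y * (2 * p / 2 ^ p) := by
    rw [← mul_sub]; gcongr; linarith
  have d1 : y * (2 * p / 2 ^ p) ≤ cdfError α p h := by
    unfold cdfError
    rw [← mul_div_assoc]
    refine div_le_div_of_nonneg_right ?_ hP.le
    nlinarith [hy0, Nat.cast_nonneg (α := ℝ) p]
  have d2 : 2 * ((p + 1 : ℕ) : ℝ) / 2 ^ p ≤ cdfError α p h := by
    unfold cdfError
    push_cast
    refine div_le_div_of_nonneg_right ?_ hP.le
    nlinarith [hy0, Nat.cast_nonneg (α := ℝ) p]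
  rw [abs_le]
  constructor <;> linarith

theorem frechetInv_frechetCdf {α x : ℝ} (hα : 0 < α) (hx : 0 < x) :
    frechetInv α (frechetCdf α x) = x := by
  unfold frechetInv frechetCdf
  rw [one_div, ← Real.exp_neg, Real.log_exp, neg_neg, ← Real.rpow_mul hx.le,
    show -α * -(1 / α) = 1 by field_simp, Real.rpow_one]

theorem frechetCdf_mem_Ioo {α x : ℝ} (hx : 0 < x) : frechetCdf α x ∈ Set.Ioo (0 : ℝ) 1 := by
  have := Real.rpow_pos_of_pos hx (-α)
  exact ⟨Real.exp_pos _, by simpa [frechetCdf] using this⟩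

/-- A Lipschitz constant of the quantile function on `[c, 1 - c]`. -/
noncomputable def quantileLip (α c : ℝ) : ℝ := 1 / α * c ^ (-(1 / α) - 1) / c

/-- The derivative is `(1/α) ln(1/x)^(-1/α-1) / x`, and on `[c, 1 - c]` both `x` and `ln(1/x) ≥ 1 -
x` are at least `c`. -/
theorem abs_frechetInv_sub_le {α c u v : ℝ} (hα : 0 < α) (hc : 0 < c) (hu : u ∈ Set.Icc c (1 - c))
    (hv : v ∈ Set.Icc c (1 - c)) : |frechetInv α u - frechetInv α v| ≤ quantileLip α c * |u - v| := by
  have hderiv : ∀ x ∈ Set.Icc c (1 - c), HasDerivAt (frechetInv α)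
      (-(1 / α) * Real.log (1 / x) ^ (-(1 / α) - 1) * -x⁻¹) x := fun x hx => by
    have hx0 : 0 < x := hc.trans_le hx.1
    have hl : 0 < Real.log (1 / x) := log_one_div_pos ⟨hx0, by linarith [hx.2]⟩
    have h1 : HasDerivAt (fun x => Real.log (1 / x)) (-x⁻¹) x := by
      have := (Real.hasDerivAt_log hx0.ne').neg
      refine this.congr_of_eventuallyEq (Filter.Eventually.of_forall fun y => ?_)
      simp
    exact (h1.rpow_const (p := -(1 / α)) (Or.inl hl.ne')).congr_deriv (by ring)
  refine (convex_Icc c (1 - c)).norm_image_sub_le_of_norm_deriv_le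
    (fun x hx => (hderiv x hx).differentiableAt) (fun x hx => ?_) hv hu
  have hx0 : 0 < x := hc.trans_le hx.1
  have hl : c ≤ Real.log (1 / x) := by
    rw [one_div, Real.log_inv]
    linarith [Real.log_le_sub_one_of_pos hx0, hx.2]
  rw [(hderiv x hx).deriv, Real.norm_eq_abs]
  have e : -(1 / α) * Real.log (1 / x) ^ (-(1 / α) - 1) * -x⁻¹
      = 1 / α * Real.log (1 / x) ^ (-(1 / α) - 1) / x := by ring
  have hp : Real.log (1 / x) ^ (-(1 / α) - 1) ≤ c ^ (-(1 / α) - 1) :=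
    Real.rpow_le_rpow_of_nonpos hc hl (by have : 0 < 1 / α := by positivity
                                          linarith)
  have h0 : 0 ≤ Real.log (1 / x) ^ (-(1 / α) - 1) := Real.rpow_nonneg (hc.le.trans hl) _
  rw [e, abs_of_nonneg (by positivity)]
  unfold quantileLip
  gcongr
  exact hx.1

/-- The search stops at an `R` whose grid point has distribution function at most `u + η` while that
of the next point is at least `u - η`, with `η = cdfError`; the ends of the grid are covered by
`hlow` and `hhigh`. The four error terms are: `η` transported by the Lipschitz quantile function,
the distance of neighbouring grid points, the evaluation of the grid point by `powFix`, and the `+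
1` in `quantileFix` that keeps the variable positive. -/
theorem quantileFix_precise {α γ : ℝ} (hα : 0 < α) (hγ : 0 < γ) {p h : ℕ}
    (hlow : gridPoint p h 0 ≤ frechetInv α γ) (hhigh : frechetInv α (1 - γ) ≤ 2 ^ h)
    (herr : cdfError α p h ≤ γ / 2) {u : ℝ} (hu : u ∈ Set.Icc γ (1 - γ)) :
    |(quantileFix α p h ⌊(2 : ℝ) ^ p * u⌋₊ : ℝ) / 2 ^ p - frechetInv α u|
      ≤ quantileLip α (γ / 2) * cdfError α p h + gridMesh p h * 2 ^ h + 2 * p * 2 ^ h / 2 ^ p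
        + 1 / 2 ^ p := by
  have hP : (0 : ℝ) < 2 ^ p := by positivity
  have hu0 : 0 < u := hγ.trans_le hu.1
  have hη : 0 ≤ cdfError α p h := by
    have : 0 ≤ gridScale α p h := (Real.rpow_pos_of_pos (gridPoint_pos p h 0) _).le
    unfold cdfError; positivity
  have hΛ : 0 ≤ quantileLip α (γ / 2) := by unfold quantileLip; positivity
  set U := ⌊(2 : ℝ) ^ p * u⌋₊
  obtain ⟨s1, s2, s3⟩ := binSearch_spec (fun R => cdfFix α p h R ≤ U) p
  unfold quantileFix
  set R := binSearch (fun R => cdfFix α p h R ≤ U) p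
  have hRp : R < 2 ^ p := s2
  -- Because `η ≤ γ / 2`, the perturbed arguments stay in the interval on which the Lipschitz
  -- constant `quantileLip α (γ / 2)` is valid.
  have hmem : ∀ e, |e| ≤ cdfError α p h → u + e ∈ Set.Icc (γ / 2) (1 - γ / 2) := fun e he => by
    have := abs_le.1 he
    constructor <;> linarith [hu.1, hu.2]
  have hlip : ∀ e, |e| ≤ cdfError α p h →
      |frechetInv α (u + e) - frechetInv α u| ≤ quantileLip α (γ / 2) * cdfError α p h :=
    fun e he => by
      have h1 := abs_frechetInv_sub_le hα (half_pos hγ) (hmem e he)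
        (by simpa using hmem 0 (by simpa using hη))
      refine h1.trans ?_
      gcongr
      simpa using he
  have upper : gridPoint p h R ≤ frechetInv α u + quantileLip α (γ / 2) * cdfError α p h := by
    -- If the search never moved, the first grid point lies below all quantiles in question.
    rcases s1 with h0 | h0
    · rw [h0]
      have := frechetInv_le_frechetInv hα hγ (by linarith [hu.2]) hu.1
      have := mul_nonneg hΛ hη
      linarith
    · have h1 := (abs_le.1 (abs_cdfFix_sub_le (h := h) hα hRp)).1
      have h2 : (cdfFix α p h R : ℝ) / 2 ^ p ≤ u := by
        rw [div_le_iff₀ hP, mul_comm]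
        exact (Nat.cast_le.2 h0).trans (Nat.floor_le (by positivity))
      have h3 := (abs_le.1 (hlip (cdfError α p h) (abs_of_nonneg hη).le)).2
      have h4 := hmem (cdfError α p h) (abs_of_nonneg hη).le
      rw [← frechetInv_frechetCdf hα (gridPoint_pos p h R)]
      have h5 := frechetInv_le_frechetInv hα (frechetCdf_mem_Ioo (α := α) (gridPoint_pos p h R)).1
        (v := u + cdfError α p h) (by linarith [h4.2]) (by linarith)
      linarith
  have lower : frechetInv α u - quantileLip α (γ / 2) * cdfError α p h - gridMesh p h * 2 ^ h
      ≤ gridPoint p h R := by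
    have hm := mul_nonneg (gridMesh_nonneg p h) (pow_pos (zero_lt_two (α := ℝ)) h).le
    -- If the search reached the end, the last grid point is `2 ^ h`, above all quantiles in
    -- question.
    rcases eq_or_ne (R + 1) (2 ^ p) with h0 | hR1
    · have h1 : gridPoint p h R = 2 ^ h := by
        have : (2 : ℝ) ^ p - 1 - R = 0 := by
          have : ((R + 1 : ℕ) : ℝ) = 2 ^ p := by rw [h0]; push_cast; rfl
          push_cast at this; linarith
        rw [gridPoint, this]; simp
      have := frechetInv_le_frechetInv hα hu0 (by linarith) hu.2
      have := mul_nonneg hΛ hη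
      linarith
    · have h0 := s3.resolve_left hR1
      replace hR1 : R + 1 < 2 ^ p := lt_of_le_of_ne s2 hR1
      have h1 := (abs_le.1 (abs_cdfFix_sub_le (h := h) hα hR1)).2
      have h2 : u ≤ (cdfFix α p h (R + 1) : ℝ) / 2 ^ p := by
        rw [le_div_iff₀ hP, mul_comm]
        -- For integers, failing the test means `U + 1 ≤ cdfFix`, so rounding `2^p u` down to `U`
        -- costs nothing.
        have h00 : (U : ℝ) + 1 ≤ cdfFix α p h (R + 1) := by exact_mod_cast Nat.succ_le_of_lt (not_le.1 h0)
        exact (Nat.lt_floor_add_one _).le.trans h00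
      have h3 := (abs_le.1 (hlip (-cdfError α p h) (by rw [abs_neg]; exact (abs_of_nonneg hη).le))).1
      have h4 := hmem (-cdfError α p h) (by rw [abs_neg]; exact (abs_of_nonneg hη).le)
      have h5 := frechetInv_le_frechetInv hα (u := u + -cdfError α p h) (by linarith [h4.1])
        (frechetCdf_mem_Ioo (α := α) (gridPoint_pos p h (R + 1))).2 (by linarith)
      rw [frechetInv_frechetCdf hα (gridPoint_pos p h _)] at h5
      have h6 : gridPoint p h R = gridPoint p h (R + 1) * Real.exp (-gridMesh p h) := by
        unfold gridPoint
        rw [mul_assoc, ← Real.exp_add]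
        congr 2
        push_cast
        ring
      have h7 : gridPoint p h (R + 1) ≤ 2 ^ h := by
        unfold gridPoint
        refine mul_le_of_le_one_right (by positivity) (Real.exp_le_one_iff.2 ?_)
        have : ((R + 1 : ℕ) : ℝ) + 1 ≤ 2 ^ p := by exact_mod_cast hR1
        have := mul_nonneg (gridMesh_nonneg p h) (by linarith : (0 : ℝ) ≤ 2 ^ p - 1 - (R + 1 : ℕ))
        linarith
      have h8 := Real.one_sub_le_exp_neg (gridMesh p h)
      have h9 := mul_le_mul_of_nonneg_left h8 (gridPoint_pos p h (R + 1)).le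
      have h10 := mul_le_mul_of_nonneg_right h7 (gridMesh_nonneg p h)
      rw [h6]
      linarith
  have hcast : ((2 ^ p - 1 - R : ℕ) : ℝ) = 2 ^ p - 1 - R := by
    rw [Nat.cast_sub (by omega), Nat.cast_sub (by omega)]; push_cast; rfl
  obtain ⟨q1, q2⟩ := powFix_approx (p := p) (gridMesh_nonneg p h)
    (show 2 ^ p - 1 - R < 2 ^ p by omega)
  rw [hcast] at q1 q2
  set W := powFix p (gridMesh p h) p (2 ^ p - 1 - R)
  have e1 : ((2 ^ h * W + 1 : ℕ) : ℝ) / 2 ^ p = 2 ^ h * (W / 2 ^ p) + 1 / 2 ^ p := by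
    push_cast; ring
  have hB : (0 : ℝ) ≤ 2 ^ h := by positivity
  have r1 : 2 ^ h * ((W : ℝ) / 2 ^ p) ≤ gridPoint p h R := mul_le_mul_of_nonneg_left q1 hB
  have r2 : gridPoint p h R ≤ 2 ^ h * ((W : ℝ) / 2 ^ p) + 2 * p * 2 ^ h / 2 ^ p := by
    have := mul_le_mul_of_nonneg_left q2 hB
    unfold gridPoint
    refine this.trans (le_of_eq ?_)
    ring
  rw [e1]
  have t1 : (0 : ℝ) ≤ 1 / 2 ^ p := by positivity
  have t2 : (0 : ℝ) ≤ 2 * p * 2 ^ h / 2 ^ p := by positivity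
  have t3 := mul_nonneg (gridMesh_nonneg p h) hB
  rw [abs_le]
  constructor <;> linarith

/-! A small language of assignments and its compilation into machine instructions -/

/-- Binary operations on words. -/
inductive WordOp : Type
  | add | sub | mul | and | xor | shr | lt

namespace WordOp

/-- The value of a binary operation. -/
def eval {w : ℕ} : WordOp → BitVec w → BitVec w → BitVec w
  | add, a, b => a + b
  | sub, a, b => a - b
  | mul, a, b => a * b
  | and, a, b => a &&& b
  | xor, a, b => a ^^^ b
  | shr, a, b => a >>> b.toNat
  | lt, a, b => if a.toNat < b.toNat then 1#w else 0#w

/-- The machine instruction of a binary operation. -/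
def instr {w R : ℕ} : WordOp → Fin R → Fin R → Fin R → Instr w R
  | add => .add
  | sub => .sub
  | mul => .mul
  | and => .and
  | xor => .xor
  | shr => .shr
  | lt => .lt

theorem exec_instr {w R : ℕ} (op : WordOp) (d a b : Fin R) (m : Fin R → BitVec w) :
    Instr.exec m (op.instr d a b) = Function.update m d (op.eval (m a) (m b)) := by
  cases op <;> rfl

end WordOp

/-- Expressions over words of `w` bits, with variables in `V`. -/
inductive WordExpr (w : ℕ) (V : Type) : Type
  | var (v : V)
  | const (c : BitVec w)
  | bin (op : WordOp) (a b : WordExpr w V)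
  | sel (c a b : WordExpr w V)

namespace WordExpr

variable {w : ℕ} {V : Type}

/-- The value of an expression. -/
def eval (s : V → BitVec w) : WordExpr w V → BitVec w
  | var v => s v
  | const c => c
  | bin op a b => op.eval (a.eval s) (b.eval s)
  | sel c a b => if c.eval s = 0#w then b.eval s else a.eval s

/-- The number of nodes of an expression. -/
def size : WordExpr w V → ℕ
  | var _ => 1
  | const _ => 1
  | bin _ a b => a.size + b.size + 1
  | sel c a b => c.size + a.size + b.size + 1

/-- Instructions that evaluate an expression into the temporary register `d`. -/
def compile {R : ℕ} (reg : V → Fin R) (tmp : ℕ → Fin R) : WordExpr w V → ℕ → List (Instr w R)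
  | var v, d => [.or (tmp d) (reg v) (reg v)]
  | const c, d => [.const (tmp d) c]
  | bin op a b, d =>
    a.compile reg tmp d ++ b.compile reg tmp (d + 1) ++ [op.instr (tmp d) (tmp d) (tmp (d + 1))]
  | sel c a b, d =>
    c.compile reg tmp d ++ a.compile reg tmp (d + 1) ++ b.compile reg tmp (d + 2) ++
      [.sel (tmp d) (tmp d) (tmp (d + 1)) (tmp (d + 2))]

theorem length_compile {R : ℕ} (reg : V → Fin R) (tmp : ℕ → Fin R) (e : WordExpr w V) (d : ℕ) :
    (e.compile reg tmp d).length = e.size := by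
  induction e generalizing d with
  | var v => rfl
  | const c => rfl
  | bin op a b iha ihb => simp [compile, size, iha, ihb, add_assoc]
  | sel c a b ihc iha ihb => simp [compile, size, ihc, iha, ihb, add_assoc]

theorem size_pos (e : WordExpr w V) : 0 < e.size := by cases e <;> simp [size]

end WordExpr

theorem runProgram_append {w R : ℕ} (p p' : List (Instr w R)) (m : Fin R → BitVec w) :
    runProgram (p ++ p') m = runProgram p' (runProgram p m) := List.foldl_append

/-- Registers for the variables, and `T` temporary registers. -/
structure RegisterLayout (V : Type) (R T : ℕ) where
  reg : V → Fin R
  tmp : ℕ → Fin R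
  reg_injective : Function.Injective reg
  tmp_injOn : ∀ i j, i < T → j < T → tmp i = tmp j → i = j
  reg_ne_tmp : ∀ v i, reg v ≠ tmp i

namespace RegisterLayout

variable {w : ℕ} {V : Type} {R T : ℕ} (L : RegisterLayout V R T)

/-- Stack discipline: code for a subexpression at depth `d` writes only temporaries from `d` on, so
results waiting below `d` and all variables survive. The size of the expression bounds the depth,
which keeps the temporaries in use distinct. -/
theorem run_compile (e : WordExpr w V) (d : ℕ) (hd : d + e.size ≤ T) (m : Fin R → BitVec w) :
    runProgram (e.compile L.reg L.tmp d) m (L.tmp d) = e.eval (m ∘ L.reg) ∧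
      (∀ i < d, runProgram (e.compile L.reg L.tmp d) m (L.tmp i) = m (L.tmp i)) ∧
      (runProgram (e.compile L.reg L.tmp d) m) ∘ L.reg = m ∘ L.reg := by
  have hne : ∀ i j, i < T → j < T → i ≠ j → L.tmp i ≠ L.tmp j := fun i j hi hj h h' =>
    h (L.tmp_injOn i j hi hj h')
  induction e generalizing d m with
  | var v =>
    simp only [WordExpr.size] at hd
    refine ⟨by simp [WordExpr.compile, runProgram, Instr.exec, WordExpr.eval], fun i hi => ?_, ?_⟩
    · simp [WordExpr.compile, runProgram, Instr.exec, hne i d (by omega) (by omega) hi.ne]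
    · ext1 v; simp [WordExpr.compile, runProgram, Instr.exec, L.reg_ne_tmp]
  | const c =>
    simp only [WordExpr.size] at hd
    refine ⟨by simp [WordExpr.compile, runProgram, Instr.exec, WordExpr.eval], fun i hi => ?_, ?_⟩
    · simp [WordExpr.compile, runProgram, Instr.exec, hne i d (by omega) (by omega) hi.ne]
    · ext1 v; simp [WordExpr.compile, runProgram, Instr.exec, L.reg_ne_tmp]
  | bin op a b iha ihb =>
    simp only [WordExpr.size] at hd
    have hb0 := b.size_pos
    obtain ⟨a1, a2, a3⟩ := iha d (by omega) m
    obtain ⟨b1, b2, b3⟩ := ihb (d + 1) (by omega) (runProgram (a.compile L.reg L.tmp d) m)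
    simp only [WordExpr.compile, runProgram_append]
    set m1 := runProgram (a.compile L.reg L.tmp d) m
    set m2 := runProgram (b.compile L.reg L.tmp (d + 1)) m1
    have h : runProgram [op.instr (L.tmp d) (L.tmp d) (L.tmp (d + 1))] m2
        = Function.update m2 (L.tmp d) (op.eval (a.eval (m ∘ L.reg)) (b.eval (m ∘ L.reg))) := by
      simp only [runProgram, List.foldl_cons, List.foldl_nil, WordOp.exec_instr]
      rw [b1, b2 d (by omega), a1, a3]
    rw [h]
    refine ⟨by simp [WordExpr.eval], fun i hi => ?_, ?_⟩
    · rw [Function.update_of_ne (hne i d (by omega) (by omega) hi.ne), b2 i (by omega), a2 i hi]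
    · rw [← a3, ← b3]
      ext1 v; simp [L.reg_ne_tmp]
  | sel c a b ihc iha ihb =>
    simp only [WordExpr.size] at hd
    have ha0 := a.size_pos
    have hb0 := b.size_pos
    obtain ⟨c1, c2, c3⟩ := ihc d (by omega) m
    obtain ⟨a1, a2, a3⟩ := iha (d + 1) (by omega) (runProgram (c.compile L.reg L.tmp d) m)
    obtain ⟨b1, b2, b3⟩ := ihb (d + 2) (by omega)
      (runProgram (a.compile L.reg L.tmp (d + 1)) (runProgram (c.compile L.reg L.tmp d) m))
    simp only [WordExpr.compile, runProgram_append]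
    set m1 := runProgram (c.compile L.reg L.tmp d) m
    set m2 := runProgram (a.compile L.reg L.tmp (d + 1)) m1
    set m3 := runProgram (b.compile L.reg L.tmp (d + 2)) m2
    have h : runProgram [Instr.sel (L.tmp d) (L.tmp d) (L.tmp (d + 1)) (L.tmp (d + 2))] m3
        = Function.update m3 (L.tmp d) ((c.sel a b).eval (m ∘ L.reg)) := by
      simp only [runProgram, List.foldl_cons, List.foldl_nil, Instr.exec, WordExpr.eval]
      rw [b1, b2 (d + 1) (by omega), b2 d (by omega), a1, a2 d (by omega), c1, a3, c3]
    rw [h]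
    refine ⟨by simp, fun i hi => ?_, ?_⟩
    · rw [Function.update_of_ne (hne i d (by omega) (by omega) hi.ne), b2 i (by omega),
        a2 i (by omega), c2 i hi]
    · rw [← c3, ← a3, ← b3]
      ext1 v; simp [L.reg_ne_tmp]

end RegisterLayout

/-- A list of assignments. -/
abbrev WordCode (w : ℕ) (V : Type) : Type := List (V × WordExpr w V)

namespace WordCode

set_option linter.unusedSectionVars false

variable {w : ℕ} {V : Type} [DecidableEq V]

/-- The effect of a list of assignments. -/
def exec (c : WordCode w V) (s : V → BitVec w) : V → BitVec w :=
  c.foldl (fun s a => Function.update s a.1 (a.2.eval s)) s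

theorem exec_nil (s : V → BitVec w) : exec [] s = s := rfl

theorem exec_cons (a : V × WordExpr w V) (c : WordCode w V) (s : V → BitVec w) :
    exec (a :: c) s = exec c (Function.update s a.1 (a.2.eval s)) := rfl

theorem exec_append (c c' : WordCode w V) (s : V → BitVec w) :
    exec (c ++ c') s = exec c' (exec c s) := List.foldl_append

/-- All expressions have at most `T` nodes. -/
def SizeLE (T : ℕ) (c : WordCode w V) : Prop := ∀ a ∈ c, a.2.size ≤ T

/-- Translation into machine instructions. -/
def compile {R T : ℕ} (L : RegisterLayout V R T) (c : WordCode w V) : List (Instr w R) :=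
  c.flatMap fun a => a.2.compile L.reg L.tmp 0 ++ [.or (L.reg a.1) (L.tmp 0) (L.tmp 0)]

theorem run_compile {R T : ℕ} (L : RegisterLayout V R T) (c : WordCode w V) (hc : c.SizeLE T)
    (m : Fin R → BitVec w) : runProgram (c.compile L) m ∘ L.reg = c.exec (m ∘ L.reg) := by
  induction c generalizing m with
  | nil => rfl
  | cons a c ih =>
    obtain ⟨h1, -, h3⟩ := L.run_compile a.2 0 (by simpa using hc a (by simp)) m
    rw [compile, List.flatMap_cons, runProgram_append, ← compile,
      ih (fun b hb => hc b (List.mem_cons_of_mem _ hb)), exec_cons]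
    congr 1
    rw [runProgram_append]
    ext1 v
    by_cases hv : v = a.1
    · subst hv; simp [runProgram, Instr.exec] at h1 ⊢; exact h1
    · have := congrFun h3 v
      simpa [runProgram, Instr.exec, hv, L.reg_injective.ne hv] using this

theorem length_compile_le {R T : ℕ} (L : RegisterLayout V R T) (c : WordCode w V)
    (hc : c.SizeLE T) : (c.compile L).length ≤ (T + 1) * c.length := by
  induction c with
  | nil => simp [compile]
  | cons a c ih =>
    have h1 := ih fun b hb => hc b (List.mem_cons_of_mem _ hb)
    have h2 := hc a (by simp)
    rw [compile, List.flatMap_cons, List.length_append, ← compile]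
    simp only [List.length_append, WordExpr.length_compile, List.length_cons, List.length_nil]
    linarith [mul_add (T + 1) c.length 1]

end WordCode

section

/-! Programs for the sketch -/

/-- Working variables of the sketching programs. -/
inductive WorkVar : Type
  | idx | val | num | den | crit | cur | hv | acc | y | cand | R | U | z | flag
  deriving DecidableEq

/-- Numbering of the working variables. -/
def WorkVar.index : WorkVar → Fin 14
  | idx => 0 | val => 1 | num => 2 | den => 3 | crit => 4 | cur => 5 | hv => 6 | acc => 7 | y => 8
  | cand => 9 | R => 10 | U => 11 | z => 12 | flag => 13

theorem WorkVar.index_injective : Function.Injective WorkVar.index := by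
  intro a b h
  cases a <;> cases b <;> first | rfl | exact absurd h (by decide)

/-- Variables of the sketching programs: the random words, the sketch, and working variables. -/
abbrev SketchVar (σ : Type) (K : ℕ) : Type := σ ⊕ Fin K ⊕ WorkVar

namespace SketchVar

variable {σ : Type} {K : ℕ}

/-- A random word. -/
abbrev seed (x : σ) : SketchVar σ K := Sum.inl x
/-- An entry of the sketch. -/
abbrev sk (j : Fin K) : SketchVar σ K := Sum.inr (Sum.inl j)
/-- A working variable. -/
abbrev wv (x : WorkVar) : SketchVar σ K := Sum.inr (Sum.inr x)

end SketchVar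

open SketchVar WordCode

/-! ### Code for powers, binary search and the quantile function -/

section Fragments

set_option linter.unusedSectionVars false

variable {w K : ℕ} {σ : Type} [DecidableEq σ]

theorem toNat_ofNat_of_lt {w n : ℕ} (h : n < 2 ^ w) : (BitVec.ofNat w n).toNat = n := by
  rw [BitVec.toNat_ofNat, Nat.mod_eq_of_lt h]

/-- The bit `t` of a variable. -/
def bitExpr (v : SketchVar σ K) (t : ℕ) : WordExpr w (SketchVar σ K) :=
  .bin .and (.bin .shr (.var v) (.const (BitVec.ofNat w t))) (.const 1#w)

theorem bitExpr_eval_eq_zero {v : SketchVar σ K} {t : ℕ} (ht : t < w)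
    (s : SketchVar σ K → BitVec w) :
    (bitExpr v t).eval s = 0#w ↔ (s v).toNat.testBit t = false := by
  have h1 : t < 2 ^ w := ht.trans Nat.lt_two_pow_self
  have hw : 1 % 2 ^ w = 1 := Nat.mod_eq_of_lt (Nat.one_lt_two_pow (by omega))
  simp only [bitExpr, WordExpr.eval, WordOp.eval, toNat_ofNat_of_lt h1]
  rw [← BitVec.toNat_inj]
  simp only [BitVec.toNat_and, BitVec.toNat_ushiftRight, BitVec.toNat_ofNat, hw, Nat.zero_mod,
    Nat.and_one_is_mod, Nat.testBit, Nat.one_and_eq_mod_two, bne_eq_false_iff_eq]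

/-- Code for `dst := powFix p lam n src`. -/
noncomputable def powCode (p : ℕ) (lam : ℝ) (n : ℕ) (src dst : SketchVar σ K) :
    WordCode w (SketchVar σ K) :=
  (dst, .const (BitVec.ofNat w (2 ^ p))) :: (List.range n).map fun t =>
    (dst, .sel (bitExpr src t)
      (.bin .shr (.bin .mul (.var dst) (.const (BitVec.ofNat w (expConst p lam t))))
        (.const (BitVec.ofNat w p))) (.var dst))

/-- Accumulator and constants stay at most `2 ^ p`, so `2 * p < w` excludes overflow of the
products. The source must differ from the target, since its bits are read while the target changes.
-/
theorem exec_powCode {p n : ℕ} {lam : ℝ} (hlam : 0 ≤ lam) {src dst : SketchVar σ K}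
    (hne : src ≠ dst) (hp : 2 * p < w) (hn : n ≤ w) (s : SketchVar σ K → BitVec w) :
    exec (powCode p lam n src dst) s
      = Function.update s dst (BitVec.ofNat w (powFix p lam n (s src).toNat)) := by
  have hp1 : 2 ^ p < 2 ^ w := Nat.pow_lt_pow_right one_lt_two (by omega)
  have hp2 : p < 2 ^ w := Nat.lt_two_pow_self.trans hp1
  induction n with
  | zero => simp [powCode, exec_cons, exec_nil, WordExpr.eval, powFix]
  | succ n ih =>
    have hcode : (powCode p lam (n + 1) src dst : WordCode w _) = powCode p lam n src dst ++
        [(dst, .sel (bitExpr src n)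
      (.bin .shr (.bin .mul (.var dst) (.const (BitVec.ofNat w (expConst p lam n))))
        (.const (BitVec.ofNat w p))) (.var dst))] := by simp [powCode, List.range_succ]
    rw [hcode, exec_append, ih (by omega), exec_cons, exec_nil]
    simp only [WordExpr.eval, bitExpr_eval_eq_zero (show n < w by omega), Function.update_of_ne hne,
      Function.update_self, WordOp.eval, Function.update_idem, powFix_succ, powStep]
    have hA : powFix p lam n (s src).toNat ≤ 2 ^ p := foldl_powStep_le hlam n _
    have hc : expConst p lam n ≤ 2 ^ p := expConst_le hlam n
    have hAc : powFix p lam n (s src).toNat * expConst p lam n < 2 ^ w :=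
      (Nat.mul_le_mul hA hc).trans_lt (by
        rw [← pow_add]; exact Nat.pow_lt_pow_right one_lt_two (by omega))
    congr 1
    by_cases hb : (s src).toNat.testBit n
    · simp only [hb, Bool.true_eq_false, if_false, if_true]
      rw [← BitVec.toNat_inj]
      rw [BitVec.toNat_ushiftRight, BitVec.toNat_mul, toNat_ofNat_of_lt hp2,
        toNat_ofNat_of_lt (hA.trans_lt hp1), toNat_ofNat_of_lt (hc.trans_lt hp1),
        Nat.mod_eq_of_lt hAc, toNat_ofNat_of_lt ((Nat.div_le_self _ _).trans_lt hAc),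
        Nat.shiftRight_eq_div_pow]
    · simp [hb]

theorem length_powCode (p n : ℕ) (lam : ℝ) (src dst : SketchVar σ K) :
    (powCode p lam n src dst : WordCode w _).length = n + 1 := by simp [powCode]

theorem sizeLE_powCode (p n : ℕ) (lam : ℝ) (src dst : SketchVar σ K) :
    (powCode p lam n src dst : WordCode w _).SizeLE 20 := by
  intro a ha
  simp only [powCode, List.mem_cons, List.mem_map] at ha
  rcases ha with rfl | ⟨t, -, rfl⟩ <;> simp [WordExpr.size, bitExpr]

/-- One step of the binary search. -/
noncomputable def searchBody (α : ℝ) (p h t : ℕ) : WordCode w (SketchVar σ K) :=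
  [(wv .cand, .bin .add (.var (wv .R)) (.const (BitVec.ofNat w (2 ^ t))))] ++
    powCode p (α * gridMesh p h) p (wv .cand) (wv .y) ++
    powCode p (gridScale α p h / 2 ^ p) (p + 1) (wv .y) (wv .acc) ++
    [(wv .R, .sel (.bin .lt (.var (wv .U)) (.var (wv .acc))) (.var (wv .R)) (.var (wv .cand)))]

theorem cdfFix_le {α : ℝ} (p h R : ℕ) : cdfFix α p h R ≤ 2 ^ p :=
  foldl_powStep_le (div_nonneg (Real.rpow_pos_of_pos (gridPoint_pos p h 0) _).le (by positivity)) _ _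

theorem one_ne_zero_bitVec (hw : 0 < w) : 1#w ≠ 0#w := by
  rw [Ne, ← BitVec.toNat_inj]
  simp [Nat.mod_eq_of_lt (Nat.one_lt_two_pow hw.ne')]

theorem exec_searchBody {α : ℝ} (hα : 0 ≤ α) {p h t r : ℕ} (hp : 2 * p < w) (hr : r + 2 ^ t ≤ 2 ^ p)
    {s : SketchVar σ K → BitVec w} (hs : s (wv .R) = BitVec.ofNat w r) :
    exec (searchBody α p h t) s (wv .R)
        = BitVec.ofNat w (searchStep (fun R => cdfFix α p h R ≤ (s (wv .U)).toNat) r t) ∧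
      ∀ v, v ∉ [wv .cand, wv .y, wv .acc, wv .R] → exec (searchBody α p h t) s v = s v := by
  have hp1 : 2 ^ p < 2 ^ w := Nat.pow_lt_pow_right one_lt_two (by omega)
  have hs0 : (0 : ℝ) ≤ gridScale α p h / 2 ^ p :=
    div_nonneg (Real.rpow_pos_of_pos (gridPoint_pos p h 0) _).le (by positivity)
  unfold searchBody
  rw [exec_append, exec_append, exec_append, exec_cons, exec_nil,
    exec_powCode (mul_nonneg hα (gridMesh_nonneg p h)) (by simp) hp (by omega),
    exec_powCode hs0 (by simp) hp (by omega), exec_cons, exec_nil]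
  have hy : powFix p (α * gridMesh p h) p (r + 2 ^ t) < 2 ^ w :=
    (foldl_powStep_le (mul_nonneg hα (gridMesh_nonneg p h)) _ _).trans_lt hp1
  have hc : cdfFix α p h (r + 2 ^ t) < 2 ^ w := (cdfFix_le p h _).trans_lt hp1
  constructor
  · simp only [Function.update_self, WordExpr.eval, WordOp.eval, hs, ← BitVec.ofNat_add,
      toNat_ofNat_of_lt (hr.trans_lt hp1), toNat_ofNat_of_lt hy]
    simp only [ne_eq, Sum.inr.injEq, reduceCtorEq, not_false_eq_true, Function.update_of_ne,
      Function.update_self]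
    rw [← cdfFix, toNat_ofNat_of_lt hc, searchStep]
    by_cases h1 : cdfFix α p h (r + 2 ^ t) ≤ (s (wv .U)).toNat
    · simp [h1, not_lt.2 h1]
    · simp [h1, not_le.1 h1, one_ne_zero_bitVec (show 0 < w by omega), hs]
  · intro v hv
    simp only [List.mem_cons, List.not_mem_nil, or_false, not_or] at hv
    simp [hv]

/-- Code for `z := quantileFix α p h U`. -/
noncomputable def quantileCode (α : ℝ) (p h : ℕ) : WordCode w (SketchVar σ K) :=
  [(wv .R, .const 0#w)] ++ (List.range p).reverse.flatMap (searchBody α p h) ++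
    [(wv .cand, .bin .sub (.const (BitVec.ofNat w (2 ^ p - 1))) (.var (wv .R)))] ++
    powCode p (gridMesh p h) p (wv .cand) (wv .acc) ++
    [(wv .z, .bin .add (.bin .mul (.const (BitVec.ofNat w (2 ^ h))) (.var (wv .acc))) (.const 1#w))]

/-- The unrolled search. The invariant `r + 2 ^ t ≤ 2 ^ p` keeps every candidate below `2 ^ p`. -/
theorem exec_searchLoop {α : ℝ} (hα : 0 ≤ α) {p h t r : ℕ} (hp : 2 * p < w)
    (hr : r + 2 ^ t ≤ 2 ^ p) {s : SketchVar σ K → BitVec w} (hs : s (wv .R) = BitVec.ofNat w r) :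
    exec ((List.range t).reverse.flatMap (searchBody α p h)) s (wv .R)
        = BitVec.ofNat w ((List.range t).reverse.foldl
          (searchStep (fun R => cdfFix α p h R ≤ (s (wv .U)).toNat)) r) ∧
      ∀ v, v ∉ [wv .cand, wv .y, wv .acc, wv .R] →
        exec ((List.range t).reverse.flatMap (searchBody α p h)) s v = s v := by
  induction t generalizing r s with
  | zero => simp [exec_nil, hs]
  | succ t ih =>
    rw [List.range_succ, List.reverse_append]
    simp only [List.reverse_singleton, List.cons_append, List.nil_append, List.foldl_cons,
      List.flatMap_cons, exec_append]
    rw [pow_succ, mul_two, ← add_assoc] at hr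
    obtain ⟨h1, h2⟩ := exec_searchBody (α := α) (h := h) (t := t) hα hp
      ((Nat.le_add_right _ _).trans hr) hs
    have hr' : searchStep (fun R => cdfFix α p h R ≤ (s (wv .U)).toNat) r t + 2 ^ t ≤ 2 ^ p := by
      unfold searchStep
      split_ifs
      · exact hr
      · exact (Nat.le_add_right _ _).trans hr
    obtain ⟨h3, h4⟩ := ih hr' h1
    rw [h2 (wv .U) (by simp)] at h3
    exact ⟨h3, fun v hv => (h4 v hv).trans (h2 v hv)⟩

theorem quantileFix_le (α : ℝ) (p h U : ℕ) : quantileFix α p h U ≤ 2 ^ (h + p) + 1 := by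
  unfold quantileFix
  rw [pow_add]
  exact Nat.add_le_add_right (Nat.mul_le_mul le_rfl (foldl_powStep_le (gridMesh_nonneg p h) _ _)) _

/-- The last product and sum are identities modulo `2 ^ w`, so no condition on `h` is needed here;
overflow is excluded where the value is used as a number. -/
theorem exec_quantileCode {α : ℝ} (hα : 0 ≤ α) {p h : ℕ} (hp : 2 * p < w)
    (s : SketchVar σ K → BitVec w) :
    exec (quantileCode α p h) s (wv .z)
        = BitVec.ofNat w (quantileFix α p h (s (wv .U)).toNat) ∧
      ∀ v, v ∉ [wv .cand, wv .y, wv .acc, wv .R, wv .z] → exec (quantileCode α p h) s v = s v := by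
  have hp1 : 2 ^ p < 2 ^ w := Nat.pow_lt_pow_right one_lt_two (by omega)
  unfold quantileCode
  rw [exec_append, exec_append, exec_append, exec_append, exec_cons, exec_nil]
  obtain ⟨h1, h2⟩ := exec_searchLoop (K := K) (σ := σ) (α := α) (h := h) (t := p) (r := 0)
    (s := Function.update s (wv .R) 0#w) hα hp (by simp) (by simp)
  rw [Function.update_of_ne (by simp), ← binSearch] at h1
  simp only [WordExpr.eval] at h1 h2 ⊢
  set s1 := exec ((List.range p).reverse.flatMap (searchBody α p h)) (Function.update s (wv .R) 0#w) with hs1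
  rw [exec_powCode (gridMesh_nonneg p h) (by simp) hp (by omega), exec_cons, exec_nil, exec_cons,
    exec_nil]
  simp only [WordExpr.eval]
  rw [← hs1]
  set r := binSearch (fun R => cdfFix α p h R ≤ (s (wv .U)).toNat) p with hrdef
  have hr : r + 1 ≤ 2 ^ p := (binSearch_spec _ p).2.1
  constructor
  · simp only [Function.update_self, WordOp.eval, h1]
    -- No borrow occurs, because the search returns at most `2 ^ p - 1`.
    have e1 : (BitVec.ofNat w (2 ^ p - 1) - BitVec.ofNat w r).toNat = 2 ^ p - 1 - r := by
      rw [BitVec.toNat_sub_of_le, toNat_ofNat_of_lt, toNat_ofNat_of_lt]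
      · omega
      · omega
      · rw [BitVec.le_def, toNat_ofNat_of_lt, toNat_ofNat_of_lt] <;> omega
    rw [e1, ← BitVec.ofNat_mul, ← BitVec.ofNat_add, quantileFix]
  · intro v hv
    simp only [List.mem_cons, List.not_mem_nil, or_false, not_or] at hv
    rw [Function.update_of_ne hv.2.2.2.2, Function.update_of_ne hv.2.2.1, Function.update_of_ne hv.1,
      h2 v (by simp [hv]), Function.update_of_ne hv.2.2.2.1]

theorem length_searchBody (α : ℝ) (p h t : ℕ) :
    (searchBody α p h t : WordCode w (SketchVar σ K)).length = 2 * p + 5 := by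
  simp only [searchBody, List.length_append, length_powCode, List.length_cons, List.length_nil]
  ring

theorem length_quantileCode (α : ℝ) (p h : ℕ) :
    (quantileCode α p h : WordCode w (SketchVar σ K)).length = p * (2 * p + 5) + p + 4 := by
  simp only [quantileCode, List.length_append, length_powCode, List.length_cons, List.length_nil,
    List.length_flatMap, length_searchBody, List.map_const', List.sum_replicate, List.length_reverse,
    List.length_range, smul_eq_mul]
  ring

theorem WordCode.SizeLE.append {T : ℕ} {V : Type} [DecidableEq V] {c c' : WordCode w V}
    (h : c.SizeLE T) (h' : c'.SizeLE T) : SizeLE T (c ++ c') := fun a ha =>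
  (List.mem_append.1 ha).elim (h a) (h' a)

theorem WordCode.SizeLE.flatMap {T : ℕ} {V ι : Type} [DecidableEq V] {c : ι → WordCode w V}
    (h : ∀ i, (c i).SizeLE T) (l : List ι) : SizeLE T (l.flatMap c) := fun a ha => by
  obtain ⟨i, -, hi⟩ := List.mem_flatMap.1 ha
  exact h i a hi

theorem sizeLE_searchBody (α : ℝ) (p h t : ℕ) :
    (searchBody α p h t : WordCode w (SketchVar σ K)).SizeLE 20 :=
  ((SizeLE.append (by simp [SizeLE, WordExpr.size]) (sizeLE_powCode _ _ _ _ _)).append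
    (sizeLE_powCode _ _ _ _ _)).append (by simp [SizeLE, WordExpr.size])

theorem sizeLE_quantileCode (α : ℝ) (p h : ℕ) :
    (quantileCode α p h : WordCode w (SketchVar σ K)).SizeLE 20 :=
  ((((SizeLE.append (by simp [SizeLE, WordExpr.size])
    (SizeLE.flatMap (sizeLE_searchBody α p h) _)).append
    (by simp [SizeLE, WordExpr.size])).append (sizeLE_powCode _ _ _ _ _)).append
    (by simp [SizeLE, WordExpr.size]))

/-! Hash functions and the path in the tree of the generator -/

/-- A random affine map over the field with two elements: the last word is the constant term, the
other words are the columns of the matrix. -/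
def affineHash (w : ℕ) (κ : Fin (w + 1) → BitVec w) (x : BitVec w) : BitVec w :=
  (List.finRange w).foldl
    (fun acc (b : Fin w) => acc ^^^ (if x.toNat.testBit b then κ b.castSucc else 0#w)) (κ (Fin.last w))

/-- Code for `hv := affineHash key cur`. -/
def hashCode (key : Fin (w + 1) → σ) : WordCode w (SketchVar σ K) :=
  (wv .hv, .var (seed (key (Fin.last w)))) :: (List.finRange w).map fun b : Fin w =>
    (wv .hv, .bin .xor (.var (wv .hv))
      (.sel (bitExpr (wv .cur) b) (.var (seed (key b.castSucc))) (.const 0#w)))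

theorem exec_hashCode (key : Fin (w + 1) → σ) (s : SketchVar σ K → BitVec w) :
    exec (hashCode key) s = Function.update s (wv .hv)
      (affineHash w (fun b => s (seed (key b))) (s (wv .cur))) := by
  have h : ∀ (l : List (Fin w)) (x : BitVec w), exec (l.map fun b : Fin w =>
      ((wv .hv : SketchVar σ K), (.bin .xor (.var (wv .hv))
      (.sel (bitExpr (wv .cur) b) (.var (seed (key b.castSucc))) (.const 0#w)) : WordExpr w _)))
      (Function.update s (wv .hv) x) = Function.update s (wv .hv) (l.foldl
        (fun acc (b : Fin w) => acc ^^^ (if (s (wv .cur)).toNat.testBit b then s (seed (key b.castSucc))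
          else 0#w)) x) := fun l => by
    induction l with
    | nil => intro x; rfl
    | cons b l ih =>
      intro x
      rw [List.map_cons, exec_cons, List.foldl_cons, ← ih]
      congr 1
      simp only [Function.update_idem, WordExpr.eval, bitExpr_eval_eq_zero b.2, WordOp.eval,
        Function.update_self]
      congr 2
      by_cases hb : (s (wv .cur)).toNat.testBit b <;> simp [hb]
  rw [hashCode, exec_cons]
  exact h _ _

/-- The block of the generator at a position with given binary digits. -/
def nisanPath {B : Type} (i : ℕ) : (k : ℕ) → (Fin k → B → B) → B → B
  | 0, _, x => x
  | k + 1, h, x => nisanPath i k (fun t => h t.castSucc) (if i.testBit k then h (Fin.last k) x else x)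

/-- The top binary digit of the position tells in which half the block lies, that is, whether the
last hash function is applied to the seed. One block therefore costs at most `k` hash evaluations,
and the list of `2 ^ k` blocks is never formed. -/
theorem nisanGenerator_getD {B : Type} (i k : ℕ) (h : Fin k → B → B) (x d : B) :
    (nisanGenerator k h x).getD (i % 2 ^ k) d = nisanPath i k h x := by
  induction k generalizing x with
  | zero => simp [nisanGenerator, nisanPath, Nat.mod_one]
  | succ k ih =>
    rw [nisanGenerator, nisanPath, Nat.mod_pow_succ, ← Nat.toNat_testBit]
    have hlt : i % 2 ^ k < 2 ^ k := Nat.mod_lt _ (by positivity)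
    by_cases hb : i.testBit k
    · rw [List.getD_append_right _ _ _ _ (by simp [length_nisanGenerator, hb])]
      rw [if_pos hb, ← ih]
      simp [length_nisanGenerator, hb]
    · rw [List.getD_append _ _ _ _ (by simpa [length_nisanGenerator, hb] using hlt)]
      rw [if_neg hb, ← ih]
      simp [hb]

/-- Code that replaces `cur` by the block at position `idx`. -/
def pathCode : (k : ℕ) → (Fin k → Fin (w + 1) → σ) → WordCode w (SketchVar σ K)
  | 0, _ => []
  | k + 1, key => hashCode (key (Fin.last k)) ++
      [(wv .cur, .sel (bitExpr (wv .idx) k) (.var (wv .hv)) (.var (wv .cur)))] ++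
      pathCode k fun t => key t.castSucc

theorem exec_pathCode {k : ℕ} (hk : k ≤ w) (key : Fin k → Fin (w + 1) → σ)
    (s : SketchVar σ K → BitVec w) :
    exec (pathCode k key) s (wv .cur) = nisanPath (s (wv .idx)).toNat k
        (fun t => affineHash w fun b => s (seed (key t b))) (s (wv .cur)) ∧
      ∀ v, v ∉ [wv .cur, wv .hv] → exec (pathCode k key) s v = s v := by
  induction k generalizing s with
  | zero => simp [pathCode, exec_nil, nisanPath]
  | succ k ih =>
    simp only [pathCode, exec_append, exec_hashCode, exec_cons, exec_nil]
    obtain ⟨h1, h2⟩ := ih (by omega) (fun t => key t.castSucc)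
      (Function.update (Function.update s (wv .hv)
        (affineHash w (fun b => s (seed (key (Fin.last k) b))) (s (wv .cur)))) (wv .cur)
        ((WordExpr.sel (bitExpr (wv .idx) k) (.var (wv .hv)) (.var (wv .cur))).eval
          (Function.update s (wv .hv)
            (affineHash w (fun b => s (seed (key (Fin.last k) b))) (s (wv .cur))))))
    constructor
    · rw [h1, nisanPath]
      simp only [WordExpr.eval, bitExpr_eval_eq_zero (show k < w by omega)]
      simp only [ne_eq, Sum.inr.injEq, reduceCtorEq, not_false_eq_true, Function.update_of_ne,
        Function.update_self]
      by_cases hb : (s (wv .idx)).toNat.testBit k <;> simp [hb]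
    · intro v hv
      rw [h2 v hv]
      simp only [List.mem_cons, List.not_mem_nil, or_false, not_or] at hv
      simp [hv]

theorem length_pathCode {k : ℕ} (key : Fin k → Fin (w + 1) → σ) :
    (pathCode k key : WordCode w (SketchVar σ K)).length = k * (w + 2) := by
  induction k with
  | zero => simp [pathCode]
  | succ k ih =>
    simp only [pathCode, hashCode, List.length_append, List.length_cons, List.length_map,
      List.length_finRange, List.length_nil, ih]
    ring

theorem sizeLE_pathCode {k : ℕ} (key : Fin k → Fin (w + 1) → σ) :
    (pathCode k key : WordCode w (SketchVar σ K)).SizeLE 20 := by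
  induction k with
  | zero => simp [pathCode, SizeLE]
  | succ k ih =>
    refine (SizeLE.append (fun a ha => ?_) (by simp [SizeLE, WordExpr.size, bitExpr])).append (ih _)
    simp only [hashCode, List.mem_cons, List.mem_map] at ha
    rcases ha with rfl | ⟨t, -, rfl⟩ <;> simp [WordExpr.size, bitExpr]

end Fragments

end

section

open SketchVar WordCode

/-! Minimal ratios -/

/-- One step of the search for the minimal ratio: numerator, denominator and a flag for ties. -/
def ratioStep (E z : ℕ) (q : ℕ × ℕ × ℕ) : ℕ × ℕ × ℕ :=
  if E * q.2.1 < q.1 * z then (E, z, 0) else if q.1 * z < E * q.2.1 then q else (q.1, q.2.1, 1)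

/-- Search for the minimal ratio along a list of indices. -/
def ratioScan {ι : Type} (E z : ι → ℕ) (l : List ι) (q : ℕ × ℕ × ℕ) : ℕ × ℕ × ℕ :=
  l.foldl (fun q j => ratioStep (E j) (z j) q) q

open Classical in
-- The initial pair `1 / 0` plays the role of infinity: cross-multiplication makes the first index
-- replace it, as `z > 0`. Afterwards the flag records whether the current minimum has been met
-- again, and a strictly smaller ratio resets it.
theorem ratioScan_spec {ι : Type} (E z : ι → ℕ) (hz : ∀ j, 0 < z j) (l : List ι) (hl : l.Nodup)
    (hne : l ≠ []) :
    ∃ j ∈ l, (ratioScan E z l (1, 0, 0)).1 = E j ∧ (ratioScan E z l (1, 0, 0)).2.1 = z j ∧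
      (∀ i ∈ l, (E j : ℝ) / z j ≤ (E i : ℝ) / z i) ∧
      (ratioScan E z l (1, 0, 0)).2.2
        = if ∃ i ∈ l, i ≠ j ∧ (E i : ℝ) / z i = (E j : ℝ) / z j then 1 else 0 := by
  have hlt : ∀ i j, E i * z j < E j * z i ↔ (E i : ℝ) / z i < (E j : ℝ) / z j := fun i j => by
    rw [div_lt_div_iff₀ (by exact_mod_cast hz i) (by exact_mod_cast hz j)]
    exact_mod_cast Iff.rfl
  induction l using List.reverseRecOn with
  | nil => exact absurd rfl hne
  | append_singleton l i ih =>
    have happ : ratioScan E z (l ++ [i]) (1, 0, 0)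
        = ratioStep (E i) (z i) (ratioScan E z l (1, 0, 0)) := by simp [ratioScan]
    rw [happ]
    have hil : i ∉ l := fun h => by
      have := (List.nodup_append.1 hl).2.2
      exact this i h i (by simp) rfl
    by_cases hl0 : l = []
    · subst hl0
      refine ⟨i, by simp, ?_⟩
      simp [ratioScan, ratioStep, hz i]
    obtain ⟨j, hj, h1, h2, h3, h4⟩ := ih (List.nodup_append.1 hl).1 hl0
    have hij : i ≠ j := fun h => hil (h ▸ hj)
    simp only [ratioStep, h1, h2]
    rw [mul_comm (E j) (z i)] at *
    simp only [mul_comm (z i) (E j), hlt]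
    rcases lt_trichotomy ((E i : ℝ) / z i) ((E j : ℝ) / z j) with h | h | h
    · refine ⟨i, by simp, ?_⟩
      rw [if_pos h]
      refine ⟨rfl, rfl, fun a ha => ?_, ?_⟩
      · rcases List.mem_append.1 ha with ha | ha
        · exact h.le.trans (h3 a ha)
        · rw [List.mem_singleton.1 ha]
      · rw [if_neg]
        rintro ⟨a, ha, hai, he⟩
        rcases List.mem_append.1 ha with ha | ha
        · exact absurd (h3 a ha) (by rw [he]; exact not_le.2 h)
        · exact hai (List.mem_singleton.1 ha)
    · refine ⟨j, by simp [hj], ?_⟩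
      rw [if_neg h.not_lt, if_neg h.symm.not_lt]
      refine ⟨rfl, rfl, fun a ha => ?_, ?_⟩
      · rcases List.mem_append.1 ha with ha | ha
        · exact h3 a ha
        · rw [List.mem_singleton.1 ha, h]
      · rw [if_pos]
        exact ⟨i, by simp, hij, h⟩
    · refine ⟨j, by simp [hj], ?_⟩
      rw [if_neg h.not_gt, if_pos h]
      refine ⟨h1, h2, fun a ha => ?_, ?_⟩
      · rcases List.mem_append.1 ha with ha | ha
        · exact h3 a ha
        · rw [List.mem_singleton.1 ha]; exact h.le
      · rw [h4]
        congr 1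
        refine propext ⟨fun ⟨a, ha, h'⟩ => ⟨a, by simp [ha], h'⟩, fun ⟨a, ha, h', h''⟩ => ?_⟩
        rcases List.mem_append.1 ha with ha | ha
        · exact ⟨a, ha, h', h''⟩
        · rw [List.mem_singleton.1 ha] at h''
          exact absurd h''.symm h.ne

theorem orderStat_zero {K : ℕ} (hK : 2 ≤ K) {g : Fin K → ℝ} {j : Fin K} (hj : ∀ i, g j ≤ g i) :
    orderStat g ⟨0, by omega⟩ = g j := by
  refine le_antisymm ?_ (hj _)
  have := Tuple.monotone_sort g (show (⟨0, by omega⟩ : Fin K) ≤ (Tuple.sort g).symm j from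
    Fin.mk_le_of_le_val (Nat.zero_le _))
  simpa [orderStat] using this

/-- Links the flag for ties to the order statistics. Of two indices with the minimal value, at least
one has a position other than `0` in the sorted order, so the value at position `1` is minimal too.
-/
theorem orderStat_zero_eq_one_iff {K : ℕ} (hK : 2 ≤ K) {g : Fin K → ℝ} {j : Fin K}
    (hj : ∀ i, g j ≤ g i) :
    orderStat g ⟨0, by omega⟩ = orderStat g ⟨1, by omega⟩ ↔ ∃ i, i ≠ j ∧ g i = g j := by
  constructor
  · intro h
    rw [orderStat_zero hK hj] at h
    have h0 := orderStat_zero hK hj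
    by_cases hs : Tuple.sort g ⟨0, by omega⟩ = j
    · refine ⟨Tuple.sort g ⟨1, by omega⟩, fun h' => ?_, h.symm⟩
      have := (Tuple.sort g).injective (hs.trans h'.symm)
      simp at this
    · exact ⟨_, hs, h0⟩
  · rintro ⟨i, hi, he⟩
    have hle : ∀ a : Fin K, 1 ≤ ((Tuple.sort g).symm a : ℕ) → orderStat g ⟨1, by omega⟩ ≤ g a :=
      fun a ha => by
        have := Tuple.monotone_sort g (show (⟨1, by omega⟩ : Fin K) ≤ (Tuple.sort g).symm a from
          Fin.mk_le_of_le_val ha)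
        simpa [orderStat] using this
    rw [orderStat_zero hK hj]
    refine le_antisymm (hj _) ?_
    by_cases h1 : 1 ≤ ((Tuple.sort g).symm j : ℕ)
    · exact hle j h1
    · refine (hle i ?_).trans he.le
      have : ((Tuple.sort g).symm i : ℕ) ≠ (Tuple.sort g).symm j := fun h =>
        hi ((Tuple.sort g).symm.injective (Fin.ext h))
      omega

/-! ### Code for the entries of the sketch and for the minimal ratio -/

section Loops

variable {w K : ℕ} {σ : Type} [DecidableEq σ]

set_option linter.unusedSectionVars false

/-- The number formed by the leading `p` bits of the `j`-th piece of `l` bits. -/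
def pieceVal (l p : ℕ) (x : BitVec w) (j : ℕ) : ℕ := x.toNat / 2 ^ (j * l + (l - p)) % 2 ^ p

/-- Code for `U := pieceVal l p cur j` followed by `z := quantileFix α p h U`. -/
noncomputable def frechetCode (α : ℝ) (p h l j : ℕ) : WordCode w (SketchVar σ K) :=
  [(wv .U, .bin .and (.bin .shr (.var (wv .cur)) (.const (BitVec.ofNat w (j * l + (l - p)))))
    (.const (BitVec.ofNat w (2 ^ p - 1))))] ++ quantileCode α p h

/-- Variables changed by `frechetCode`. -/
def frechetDirty : List (SketchVar σ K) :=
  [wv .cand, wv .y, wv .acc, wv .R, wv .z, wv .U]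

theorem exec_frechetCode {α : ℝ} (hα : 0 ≤ α) {p h l j : ℕ} (hp : 2 * p < w)
    (hj : j * l + (l - p) < w) (s : SketchVar σ K → BitVec w) :
    exec (frechetCode α p h l j) s (wv .z)
        = BitVec.ofNat w (quantileFix α p h (pieceVal l p (s (wv .cur)) j)) ∧
      ∀ v, v ∉ frechetDirty → exec (frechetCode α p h l j) s v = s v := by
  have hp1 : 2 ^ p < 2 ^ w := Nat.pow_lt_pow_right one_lt_two (by omega)
  unfold frechetCode
  rw [exec_append, exec_cons, exec_nil]
  simp only [WordExpr.eval, WordOp.eval, toNat_ofNat_of_lt (hj.trans Nat.lt_two_pow_self)]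
  set U := s (wv .cur) >>> (j * l + (l - p)) &&& BitVec.ofNat w (2 ^ p - 1) with hU
  have hUval : U.toNat = pieceVal l p (s (wv .cur)) j := by
    rw [hU, BitVec.toNat_and, BitVec.toNat_ushiftRight, toNat_ofNat_of_lt ((Nat.sub_le _ _).trans_lt hp1),
      Nat.and_two_pow_sub_one_eq_mod, Nat.shiftRight_eq_div_pow, pieceVal]
  obtain ⟨h1, h2⟩ := exec_quantileCode (h := h) hα hp (Function.update s (wv .U) U)
  constructor
  · rw [h1, Function.update_self, hUval]
  · intro v hv
    simp only [frechetDirty, List.mem_cons, List.not_mem_nil, or_false, not_or] at hv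
    rw [h2 v (by simp [hv]), Function.update_of_ne hv.2.2.2.2.2]

/-- Update of the `j`-th entry of the sketch. -/
noncomputable def sketchBody (α : ℝ) (p h l : ℕ) (j : Fin K) : WordCode w (SketchVar σ K) :=
  frechetCode α p h l j ++
    [(sk j, .sel (.bin .lt (.var (sk j)) (.bin .mul (.var (wv .val)) (.var (wv .z))))
      (.bin .mul (.var (wv .val)) (.var (wv .z))) (.var (sk j)))]

theorem exec_sketchBody {α : ℝ} (hα : 0 ≤ α) {p h l : ℕ} {j : Fin K} (hp : 2 * p < w)
    (hj : j * l + (l - p) < w) {s : SketchVar σ K → BitVec w}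
    (hv : (s (wv .val)).toNat * (2 ^ (h + p) + 1) < 2 ^ w) (hz : 2 ^ (h + p) + 1 < 2 ^ w) :
    (exec (sketchBody α p h l j) s (sk j)).toNat = max (s (sk j)).toNat
        ((s (wv .val)).toNat * quantileFix α p h (pieceVal l p (s (wv .cur)) j)) ∧
      ∀ v, v ∉ frechetDirty → v ≠ sk j → exec (sketchBody α p h l j) s v = s v := by
  obtain ⟨h1, h2⟩ := exec_frechetCode (h := h) hα hp hj s
  unfold sketchBody
  rw [exec_append, exec_cons, exec_nil]
  have e1 := h2 (sk j) (by simp [frechetDirty])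
  have e2 := h2 (wv .val) (by simp [frechetDirty])
  have hq := quantileFix_le α p h (pieceVal l p (s (wv .cur)) j)
  have hm : (s (wv .val)).toNat * quantileFix α p h (pieceVal l p (s (wv .cur)) j) < 2 ^ w :=
    (Nat.mul_le_mul le_rfl hq).trans_lt hv
  constructor
  · simp only [Function.update_self, WordExpr.eval, WordOp.eval, h1, e1, e2, BitVec.toNat_mul,
      toNat_ofNat_of_lt (hq.trans_lt hz), Nat.mod_eq_of_lt hm]
    by_cases h : (s (sk j)).toNat <
        (s (wv .val)).toNat * quantileFix α p h (pieceVal l p (s (wv .cur)) j)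
    · rw [if_pos h, if_neg (one_ne_zero_bitVec (by omega)), max_eq_right h.le, BitVec.toNat_mul,
        toNat_ofNat_of_lt (hq.trans_lt hz), Nat.mod_eq_of_lt hm]
    · rw [if_neg h, if_pos rfl, max_eq_left (not_lt.1 h)]
  · intro v hv hne
    rw [Function.update_of_ne hne, h2 v hv]

theorem exec_sketchLoop {α : ℝ} (hα : 0 ≤ α) {p h l : ℕ} (hp : 2 * p < w)
    (hj : ∀ j : Fin K, j * l + (l - p) < w) (hz : 2 ^ (h + p) + 1 < 2 ^ w) (L : List (Fin K))
    (hL : L.Nodup) {s : SketchVar σ K → BitVec w}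
    (hv : (s (wv .val)).toNat * (2 ^ (h + p) + 1) < 2 ^ w) :
    (∀ j ∈ L, (exec (L.flatMap (sketchBody α p h l)) s (sk j)).toNat = max (s (sk j)).toNat
        ((s (wv .val)).toNat * quantileFix α p h (pieceVal l p (s (wv .cur)) j))) ∧
      ∀ v, v ∉ frechetDirty → (∀ j ∈ L, v ≠ sk j) →
        exec (L.flatMap (sketchBody α p h l)) s v = s v := by
  induction L generalizing s with
  | nil => simp [exec_nil]
  | cons i L ih =>
    rw [List.flatMap_cons, exec_append]
    obtain ⟨h1, h2⟩ := exec_sketchBody hα hp (hj i) hv hz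
    have e1 := h2 (wv .val) (by simp [frechetDirty]) (by simp)
    have e2 := h2 (wv .cur) (by simp [frechetDirty]) (by simp)
    obtain ⟨h3, h4⟩ := ih (List.nodup_cons.1 hL).2 (s := exec (sketchBody α p h l i) s)
      (by rw [e1]; exact hv)
    constructor
    · intro j hjm
      by_cases hji : j = i
      · subst hji
        rw [h4 (sk j) (by simp [frechetDirty]) (fun a ha hja => by
          have : j = a := by simpa using hja
          exact (List.nodup_cons.1 hL).1 (this ▸ ha)), h1]
      · rw [h3 j ((List.mem_cons.1 hjm).resolve_left hji), e1, e2,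
          h2 (sk j) (by simp [frechetDirty]) (by simpa using hji)]
    · intro v hv hne
      rw [h4 v hv (fun j hj => hne j (List.mem_cons_of_mem _ hj)), h2 v hv (hne i (by simp))]

/-- Comparison of the `j`-th ratio with the minimal ratio found before. -/
noncomputable def ratioBody (α : ℝ) (p h l : ℕ) (j : Fin K) : WordCode w (SketchVar σ K) :=
  frechetCode α p h l j ++
    [(wv .flag, .bin .lt (.bin .mul (.var (sk j)) (.var (wv .den)))
        (.bin .mul (.var (wv .num)) (.var (wv .z)))),
      (wv .crit, .sel (.var (wv .flag)) (.const 0#w)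
        (.sel (.bin .lt (.bin .mul (.var (wv .num)) (.var (wv .z)))
          (.bin .mul (.var (sk j)) (.var (wv .den)))) (.var (wv .crit)) (.const 1#w))),
      (wv .num, .sel (.var (wv .flag)) (.var (sk j)) (.var (wv .num))),
      (wv .den, .sel (.var (wv .flag)) (.var (wv .z)) (.var (wv .den)))]

/-- The memory holds a numerator, a denominator and a flag. -/
def HoldsRatio (s : SketchVar σ K → BitVec w) (q : ℕ × ℕ × ℕ) : Prop :=
  s (wv .num) = BitVec.ofNat w q.1 ∧ s (wv .den) = BitVec.ofNat w q.2.1 ∧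
    s (wv .crit) = BitVec.ofNat w q.2.2

/-- Variables changed by `ratioBody`. -/
def ratioDirty : List (SketchVar σ K) :=
  frechetDirty ++ [wv .flag, wv .crit, wv .num, wv .den]

/-- Both cross products are at most `(A + 1) * (2 ^ (h + p) + 1)`, so the comparison is exact; `A +
1` rather than `A` makes room for the initial numerator `1`. The flag for ties is assigned before
numerator and denominator, since it still needs their old values. -/
theorem exec_ratioBody {α : ℝ} (hα : 0 ≤ α) {p h l : ℕ} {j : Fin K} (hp : 2 * p < w)
    (hj : j * l + (l - p) < w) {s : SketchVar σ K → BitVec w} {q : ℕ × ℕ × ℕ}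
    (hs : HoldsRatio s q) {A : ℕ} (hA : (A + 1) * (2 ^ (h + p) + 1) < 2 ^ w)
    (hE : (s (sk j)).toNat ≤ A) (hq1 : q.1 ≤ A + 1) (hq2 : q.2.1 ≤ 2 ^ (h + p) + 1) :
    HoldsRatio (exec (ratioBody α p h l j) s) (ratioStep (s (sk j)).toNat
        (quantileFix α p h (pieceVal l p (s (wv .cur)) j)) q) ∧
      (∀ v, v ∉ ratioDirty → exec (ratioBody α p h l j) s v = s v) := by
  obtain ⟨h1, h2⟩ := exec_frechetCode (h := h) hα hp hj s
  have hz := quantileFix_le α p h (pieceVal l p (s (wv .cur)) j)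
  set z := quantileFix α p h (pieceVal l p (s (wv .cur)) j)
  have b1 : A + 1 < 2 ^ w := (Nat.le_mul_of_pos_right _ (Nat.succ_pos _)).trans_lt hA
  have b2 : 2 ^ (h + p) + 1 < 2 ^ w := (Nat.le_mul_of_pos_left _ (by omega)).trans_lt hA
  have b3 : (s (sk j)).toNat * q.2.1 < 2 ^ w :=
    (Nat.mul_le_mul (by omega) hq2).trans_lt hA
  have b4 : q.1 * z < 2 ^ w := (Nat.mul_le_mul hq1 hz).trans_lt hA
  obtain ⟨g1, g2, g3⟩ := hs
  have e1 := h2 (sk j) (by simp [frechetDirty])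
  have e2 := h2 (wv .num) (by simp [frechetDirty])
  have e3 := h2 (wv .den) (by simp [frechetDirty])
  have e4 := h2 (wv .crit) (by simp [frechetDirty])
  rw [g1] at e2
  rw [g2] at e3
  rw [g3] at e4
  unfold ratioBody
  rw [exec_append, exec_cons, exec_cons, exec_cons, exec_cons, exec_nil]
  set s1 := exec (frechetCode α p h l j) s
  constructor
  · have hone := one_ne_zero_bitVec (show 0 < w by omega)
    simp only [HoldsRatio, WordExpr.eval, WordOp.eval]
    simp only [ne_eq, Sum.inr.injEq, reduceCtorEq, not_false_eq_true, Function.update_of_ne,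
      Function.update_self]
    simp only [h1, e1, e2, e3, e4, BitVec.toNat_mul, toNat_ofNat_of_lt (hq1.trans_lt b1),
      toNat_ofNat_of_lt (hq2.trans_lt b2), toNat_ofNat_of_lt (hz.trans_lt b2),
      Nat.mod_eq_of_lt b3, Nat.mod_eq_of_lt b4]
    unfold ratioStep
    by_cases c1 : (s (sk j)).toNat * q.2.1 < q.1 * z
    · simp [c1, hone]
    · by_cases c2 : q.1 * z < (s (sk j)).toNat * q.2.1 <;> simp [c1, c2, hone]
  · intro v hv
    simp only [ratioDirty, List.mem_append, not_or, List.mem_cons, List.not_mem_nil, or_false] at hv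
    rw [Function.update_of_ne hv.2.2.2.2, Function.update_of_ne hv.2.2.2.1,
      Function.update_of_ne hv.2.2.1, Function.update_of_ne hv.2.1, h2 v hv.1]

theorem exec_ratioLoop {α : ℝ} (hα : 0 ≤ α) {p h l : ℕ} (hp : 2 * p < w)
    (hj : ∀ j : Fin K, j * l + (l - p) < w) {A : ℕ} (hA : (A + 1) * (2 ^ (h + p) + 1) < 2 ^ w)
    (L : List (Fin K)) {s : SketchVar σ K → BitVec w} {q : ℕ × ℕ × ℕ}
    (hs : HoldsRatio s q) (hE : ∀ j : Fin K, (s (sk j)).toNat ≤ A) (hq1 : q.1 ≤ A + 1)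
    (hq2 : q.2.1 ≤ 2 ^ (h + p) + 1) :
    HoldsRatio (exec (L.flatMap (ratioBody α p h l)) s) (ratioScan (fun j => (s (sk j)).toNat)
        (fun j => quantileFix α p h (pieceVal l p (s (wv .cur)) j)) L q) := by
  induction L generalizing s q with
  | nil => exact hs
  | cons i L ih =>
    rw [List.flatMap_cons, exec_append]
    obtain ⟨h1, h2⟩ := exec_ratioBody hα hp (hj i) hs hA (hE i) hq1 hq2
    have e1 := h2 (wv .cur) (by simp [ratioDirty, frechetDirty])
    have e2 : ∀ j, exec (ratioBody α p h l i) s (sk j) = s (sk j) := fun j =>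
      h2 (sk j) (by simp [ratioDirty, frechetDirty])
    have := ih h1 (fun j => by rw [e2]; exact hE j) (by
      unfold ratioStep; split_ifs
      · exact (hE i).trans (Nat.le_succ A)
      · exact hq1
      · exact hq1) (by
      unfold ratioStep; split_ifs
      · exact quantileFix_le _ _ _ _
      · exact hq2
      · exact hq2)
    simp only [e1, e2] at this
    exact this

end Loops

end

section

open SketchVar WordCode

/-! The family of random affine maps -/

/-- Additivity of the affine map in its key, the reason why all fibres have the same size. -/
theorem foldl_xor_xor {w : ℕ} {ι : Type} (c : ι → Bool) (κ μ : ι → BitVec w) (l : List ι)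
    (a b : BitVec w) :
    l.foldl (fun acc i => acc ^^^ (if c i then κ i ^^^ μ i else 0#w)) (a ^^^ b)
      = l.foldl (fun acc i => acc ^^^ (if c i then κ i else 0#w)) a
        ^^^ l.foldl (fun acc i => acc ^^^ (if c i then μ i else 0#w)) b := by
  induction l generalizing a b with
  | nil => rfl
  | cons i l ih =>
    simp only [List.foldl_cons]
    rw [← ih]
    congr 1
    by_cases h : c i
    · simp only [h, if_true]; ac_rfl
    · simp [h]

theorem foldl_xor_single {w : ℕ} {ι : Type} [DecidableEq ι] (c : ι → Bool) (b₀ : ι) (u v : BitVec w)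
    (l : List ι) (hl : l.Nodup) :
    l.foldl (fun acc i => acc ^^^ (if c i then (if i = b₀ then v else 0#w) else 0#w)) u
      = u ^^^ (if b₀ ∈ l ∧ c b₀ then v else 0#w) := by
  induction l generalizing u with
  | nil => simp
  | cons i l ih =>
    rw [List.nodup_cons] at hl
    rw [List.foldl_cons, ih _ hl.2]
    by_cases h : i = b₀
    · subst h; by_cases hc : c i <;> simp [hl.1, hc]
    · simp [h, Ne.symm h]

theorem affineHash_xor {w : ℕ} (κ μ : Fin (w + 1) → BitVec w) (x : BitVec w) :
    affineHash w (fun b => κ b ^^^ μ b) x = affineHash w κ x ^^^ affineHash w μ x :=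
  foldl_xor_xor (fun b : Fin w => x.toNat.testBit b) (fun b => κ b.castSucc) (fun b => μ b.castSucc) _
    (κ (Fin.last w)) (μ (Fin.last w))

/-- The words differ in some bit `b₀`. Take as constant term the value wanted at the word whose bit
is `0`, as column `b₀` the difference of the two values, and zero for the other columns. -/
theorem exists_affineHash_eq {w : ℕ} {x x' : BitVec w} (hx : x ≠ x') (y y' : BitVec w) :
    ∃ μ, affineHash w μ x = y ∧ affineHash w μ x' = y' := by
  have hbit : ∃ b : Fin w, x.toNat.testBit b ≠ x'.toNat.testBit b := by
    by_contra! h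
    exact hx (BitVec.eq_of_getLsbD_eq fun i hi => by simpa [BitVec.testBit_toNat] using h ⟨i, hi⟩)
  obtain ⟨b₀, hb⟩ := hbit
  have key : ∀ (u v z : BitVec w), affineHash w (Fin.snoc (fun b : Fin w => if b = b₀ then v else 0#w) u :
      Fin (w + 1) → BitVec w) z = u ^^^ (if z.toNat.testBit b₀ then v else 0#w) := fun u v z => by
    have := foldl_xor_single (fun b : Fin w => z.toNat.testBit b) b₀ u v (List.finRange w)
      (List.nodup_finRange w)
    simpa [affineHash] using this
  have hcancel : ∀ a b : BitVec w, a ^^^ (a ^^^ b) = b := fun a b => by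
    rw [← BitVec.xor_assoc, BitVec.xor_self, BitVec.zero_xor]
  by_cases h1 : x.toNat.testBit b₀
  · have h2 : x'.toNat.testBit b₀ = false := by
      rw [h1] at hb; simpa using hb.symm
    refine ⟨Fin.snoc (fun b : Fin w => if b = b₀ then y' ^^^ y else 0#w) y', ?_, ?_⟩ <;>
      simp [key, h1, h2, hcancel]
  · have h2 : x'.toNat.testBit b₀ = true := by
      rw [Bool.eq_false_iff.2 h1] at hb; simpa using hb.symm
    refine ⟨Fin.snoc (fun b : Fin w => if b = b₀ then y ^^^ y' else 0#w) y, ?_, ?_⟩ <;>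
      simp [key, h1, h2, hcancel]

theorem card_bitVec (w : ℕ) : Nat.card (BitVec w) = 2 ^ w := by
  rw [Nat.card_congr (BitVec.equivFin (m := w)).toEquiv, Nat.card_eq_fintype_card, Fintype.card_fin]

/-- The pair of values is additive in the key and takes every value, so adding a suitable key maps
any fibre bijectively onto any other. The `(2 ^ w) ^ 2` fibres have equal size and partition the set
of keys. -/
theorem card_affineHash_fiber {w : ℕ} {x x' : BitVec w} (hx : x ≠ x') (y y' : BitVec w) :
    Nat.card {κ // affineHash w κ x = y ∧ affineHash w κ x' = y'} * (2 ^ w) ^ 2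
      = Nat.card (Fin (w + 1) → BitVec w) := by
  have hself : ∀ a b : BitVec w, a ^^^ b ^^^ b = a := fun a b => by
    rw [BitVec.xor_assoc, BitVec.xor_self, BitVec.xor_zero]
  have hfib : ∀ q : BitVec w × BitVec w,
      Nat.card {κ // (affineHash w κ x, affineHash w κ x') = q}
        = Nat.card {κ // affineHash w κ x = y ∧ affineHash w κ x' = y'} := fun q => by
    obtain ⟨μ, h1, h2⟩ := exists_affineHash_eq hx (q.1 ^^^ y) (q.2 ^^^ y')
    have hinv : Function.Involutive
        (fun κ : Fin (w + 1) → BitVec w => fun b => κ b ^^^ μ b) := fun κ => by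
      ext1 b; exact hself _ _
    refine Nat.card_congr (hinv.toPerm.subtypeEquiv fun κ => ?_)
    simp only [Function.Involutive.coe_toPerm, affineHash_xor, h1, h2, Prod.ext_iff]
    have e : ∀ a b c : BitVec w, a = b ↔ a ^^^ (b ^^^ c) = c := fun a b c => by
      constructor
      · rintro rfl; rw [← BitVec.xor_assoc, BitVec.xor_self, BitVec.zero_xor]
      · intro h
        have := congrArg (· ^^^ (b ^^^ c)) h
        simp only [hself] at this
        rw [this, BitVec.xor_comm, hself]
    rw [← e, ← e]
  have := Nat.card_congr (Equiv.sigmaFiberEquiv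
    fun κ : Fin (w + 1) → BitVec w => (affineHash w κ x, affineHash w κ x'))
  rw [← this, Nat.card_sigma]
  simp_rw [hfib]
  rw [Finset.sum_const, Finset.card_univ, smul_eq_mul, Fintype.card_prod, ← Nat.card_eq_fintype_card,
    card_bitVec]
  ring

/-- The pairwise independent family of all affine maps over the field with two elements. -/
def affineFamily (w : ℕ) : HashFamily w (w + 1) where
  hash := affineHash w
  pairwise _ _ hx y y' := card_affineHash_fiber hx y y'

/-! The pseudo-random variables and the streaming machine -/

/-- Pseudo-random `α`-Fréchet variables: pieces of `l` bits, of which the leading `p` are used. -/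
noncomputable def frechetNisan (α : ℝ) {N : ℕ} (K p h l : ℕ) {k : ℕ} (hN : N ≤ 2 ^ k) :
    NisanVariables N K where
  w := K * l
  k := k
  q := K * l + 1
  l := l
  D := 2 ^ p
  family := affineFamily (K * l)
  table x := quantileFix α p h (x.toNat / 2 ^ (l - p))
  enough_blocks := hN
  enough_bits := le_rfl
  D_pos := by positivity

/-- Registers of the streaming machine. -/
abbrev RegisterIndex (σ : Type) (K : ℕ) : Type := σ ⊕ Fin K ⊕ Fin 14 ⊕ Fin 20

/-- The arrangement of the variables and of twenty temporary words in the memory. -/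
noncomputable def sketchLayout (σ : Type) [Fintype σ] (K : ℕ) :
    RegisterLayout (SketchVar σ K) (Fintype.card (RegisterIndex σ K)) 20 where
  reg v := Fintype.equivFin (RegisterIndex σ K)
    (Sum.map id (Sum.map id fun x => Sum.inl (WorkVar.index x)) v)
  tmp i := Fintype.equivFin (RegisterIndex σ K)
    (Sum.inr (Sum.inr (Sum.inr ⟨i % 20, Nat.mod_lt _ (by norm_num)⟩)))
  reg_injective := (Fintype.equivFin _).injective.comp
    (Sum.map_injective.2 ⟨Function.injective_id, Sum.map_injective.2
      ⟨Function.injective_id, Sum.inl_injective.comp WorkVar.index_injective⟩⟩)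
  tmp_injOn i j hi hj h := by
    simpa [Nat.mod_eq_of_lt hi, Nat.mod_eq_of_lt hj] using h
  reg_ne_tmp v i h := by
    have h := (Fintype.equivFin _).injective h
    rcases v with x | j | x <;> simp at h

/-! ### The machine and its correctness -/

section Machine

variable {k w : ℕ}

/-- Code that loads the block at position `idx` into `cur`. -/
def blockCode (k w K : ℕ) : WordCode w (SketchVar (Option (Fin k × Fin (w + 1))) K) :=
  [(wv .cur, .var (seed none))] ++ pathCode k fun t b => some (t, b)

/-- Code for a stream item. -/
noncomputable def updateCode (α : ℝ) (p h l k w K : ℕ) :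
    WordCode w (SketchVar (Option (Fin k × Fin (w + 1))) K) :=
  blockCode k w K ++ (List.finRange K).flatMap (sketchBody α p h l)

/-- Code for a query. -/
noncomputable def queryCode (α : ℝ) (p h l k w K : ℕ) :
    WordCode w (SketchVar (Option (Fin k × Fin (w + 1))) K) :=
  [(wv .num, .const 1#w), (wv .den, .const 0#w), (wv .crit, .const 0#w)] ++
    blockCode k w K ++ (List.finRange K).flatMap (ratioBody α p h l)

/-- The streaming machine that maintains the sketch and answers queries. -/
noncomputable def sketchMachine (α : ℝ) (p h l k w K : ℕ) :
    StreamMachine w (Option (Fin k × Fin (w + 1))) where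
  R := Fintype.card (RegisterIndex (Option (Fin k × Fin (w + 1))) K)
  seedReg := ⟨fun x => (sketchLayout _ K).reg (seed x),
    (sketchLayout _ K).reg_injective.comp Sum.inl_injective⟩
  idxReg := (sketchLayout _ K).reg (wv .idx)
  valReg := (sketchLayout _ K).reg (wv .val)
  numReg := (sketchLayout _ K).reg (wv .num)
  denReg := (sketchLayout _ K).reg (wv .den)
  critReg := (sketchLayout _ K).reg (wv .crit)
  update := (updateCode α p h l k w K).compile (sketchLayout _ K)
  query := (queryCode α p h l k w K).compile (sketchLayout _ K)

/-- The block at position `i`. -/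
def blockVal {k w : ℕ} (sd : Option (Fin k × Fin (w + 1)) → BitVec w) (i : ℕ) : BitVec w :=
  nisanPath i k (fun t => affineHash w fun b => sd (some (t, b))) (sd none)

theorem exec_blockCode {K : ℕ} (hk : k ≤ w)
    (s : SketchVar (Option (Fin k × Fin (w + 1))) K → BitVec w) :
    exec (blockCode k w K) s (wv .cur) = blockVal (fun x => s (seed x)) (s (wv .idx)).toNat ∧
      ∀ v, v ∉ [wv .cur, wv .hv] → exec (blockCode k w K) s v = s v := by
  unfold blockCode
  rw [exec_append, exec_cons, exec_nil]
  obtain ⟨h1, h2⟩ := exec_pathCode hk (fun t b => some (t, b))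
    (Function.update s (wv .cur) ((WordExpr.var (seed none)).eval s))
  constructor
  · rw [h1]
    simp [WordExpr.eval, blockVal]
  · intro v hv
    rw [h2 v hv]
    simp only [List.mem_cons, List.not_mem_nil, or_false, not_or] at hv
    rw [Function.update_of_ne hv.1]

theorem sizeLE_frechetCode {σ : Type} [DecidableEq σ] {K : ℕ} (α : ℝ) (p h l j : ℕ) :
    (frechetCode α p h l j : WordCode w (SketchVar σ K)).SizeLE 20 :=
  SizeLE.append (by simp [SizeLE, WordExpr.size]) (sizeLE_quantileCode α p h)

theorem sizeLE_sketchBody {σ : Type} [DecidableEq σ] {K : ℕ} (α : ℝ) (p h l : ℕ) (j : Fin K) :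
    (sketchBody α p h l j : WordCode w (SketchVar σ K)).SizeLE 20 := by
  unfold sketchBody
  exact (sizeLE_frechetCode α p h l j).append (by simp [SizeLE, WordExpr.size])

theorem sizeLE_ratioBody {σ : Type} [DecidableEq σ] {K : ℕ} (α : ℝ) (p h l : ℕ) (j : Fin K) :
    (ratioBody α p h l j : WordCode w (SketchVar σ K)).SizeLE 20 := by
  unfold ratioBody
  exact (sizeLE_frechetCode α p h l j).append (by simp [SizeLE, WordExpr.size])

theorem sizeLE_blockCode (k w K : ℕ) : (blockCode k w K).SizeLE 20 :=
  SizeLE.append (by simp [SizeLE, WordExpr.size]) (sizeLE_pathCode _)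

theorem sizeLE_updateCode (α : ℝ) (p h l k w K : ℕ) : (updateCode α p h l k w K).SizeLE 20 :=
  (sizeLE_blockCode k w K).append (SizeLE.flatMap (sizeLE_sketchBody α p h l) _)

theorem sizeLE_queryCode (α : ℝ) (p h l k w K : ℕ) : (queryCode α p h l k w K).SizeLE 20 :=
  (SizeLE.append (by simp [SizeLE, WordExpr.size]) (sizeLE_blockCode k w K)).append
    (SizeLE.flatMap (sizeLE_ratioBody α p h l) _)

theorem length_blockCode (k w K : ℕ) : (blockCode k w K).length = k * (w + 2) + 1 := by
  simp only [blockCode, List.length_append, length_pathCode, List.length_cons, List.length_nil]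
  ring

theorem length_updateCode (α : ℝ) (p h l k w K : ℕ) :
    (updateCode α p h l k w K).length = k * (w + 2) + 1 + K * (p * (2 * p + 5) + p + 6) := by
  simp only [updateCode, sketchBody, frechetCode, List.length_append, length_blockCode,
    List.length_flatMap, length_quantileCode, List.length_cons, List.length_nil, List.map_const',
    List.sum_replicate, List.length_finRange, smul_eq_mul]
  ring

theorem length_queryCode (α : ℝ) (p h l k w K : ℕ) :
    (queryCode α p h l k w K).length = k * (w + 2) + 4 + K * (p * (2 * p + 5) + p + 9) := by
  simp only [queryCode, ratioBody, frechetCode, List.length_append, length_blockCode,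
    List.length_flatMap, length_quantileCode, List.length_cons, List.length_nil, List.map_const',
    List.sum_replicate, List.length_finRange, smul_eq_mul]
  ring

/-- The numerator of a pseudo-random variable. -/
noncomputable def varNum (α : ℝ) (p h l : ℕ) {k w : ℕ} (sd : Option (Fin k × Fin (w + 1)) → BitVec w)
    (j i : ℕ) : ℕ :=
  quantileFix α p h (pieceVal l p (blockVal sd i) j)

/-- The maximum of `v z(i)` over the items `(i, v)` of a stream. -/
def streamMax {N : ℕ} (z : ℕ → ℕ) (stream : List (Fin N × ℕ)) (a : ℕ) : ℕ :=
  stream.foldl (fun a item => max a (item.2 * z item.1)) a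

theorem streamMax_spec {N : ℕ} (z : ℕ → ℕ) (stream : List (Fin N × ℕ)) (a : ℕ) :
    a ≤ streamMax z stream a ∧ (∀ item ∈ stream, item.2 * z item.1 ≤ streamMax z stream a) ∧
      (streamMax z stream a = a ∨ ∃ item ∈ stream, streamMax z stream a = item.2 * z item.1) := by
  induction stream generalizing a with
  | nil => simp [streamMax]
  | cons it l ih =>
    obtain ⟨h1, h2, h3⟩ := ih (max a (it.2 * z it.1))
    have e : streamMax z (it :: l) a = streamMax z l (max a (it.2 * z it.1)) := rfl
    rw [e]
    refine ⟨(le_max_left _ _).trans h1, fun item hi => ?_, ?_⟩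
    · rcases List.mem_cons.1 hi with rfl | hi
      · exact (le_max_right _ _).trans h1
      · exact h2 item hi
    · rcases h3 with h3 | ⟨item, hi, h3⟩
      · rcases max_choice a (it.2 * z it.1) with h | h
        · left; rw [h3, h]
        · right; exact ⟨it, by simp, by rw [h3, h]⟩
      · right; exact ⟨item, List.mem_cons_of_mem _ hi, h3⟩

theorem streamSignal_spec {N : ℕ} (stream : List (Fin N × ℕ)) (i : Fin N) :
    (∀ item ∈ stream, item.1 = i → item.2 ≤ streamSignal stream i) ∧
      (streamSignal stream i = 0 ∨ ∃ item ∈ stream, item.1 = i ∧ item.2 = streamSignal stream i) := by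
  induction stream with
  | nil => simp [streamSignal]
  | cons it l ih =>
    obtain ⟨h1, h2⟩ := ih
    have e : streamSignal (it :: l) i
        = if it.1 = i then max it.2 (streamSignal l i) else streamSignal l i := rfl
    rw [e]
    by_cases hi : it.1 = i
    · rw [if_pos hi]
      refine ⟨fun item hm he => ?_, Or.inr ?_⟩
      · rcases List.mem_cons.1 hm with rfl | hm
        · exact le_max_left _ _
        · exact (h1 item hm he).trans (le_max_right _ _)
      · rcases le_total (streamSignal l i) it.2 with h | h
        · exact ⟨it, by simp, hi, (max_eq_left h).symm⟩
        · rw [max_eq_right h]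
          rcases h2 with h2 | ⟨item, hm, h'⟩
          · exact ⟨it, by simp, hi, by omega⟩
          · exact ⟨item, List.mem_cons_of_mem _ hm, h'⟩
    · rw [if_neg hi]
      refine ⟨fun item hm he => ?_, ?_⟩
      · rcases List.mem_cons.1 hm with rfl | hm
        · exact absurd he hi
        · exact h1 item hm he
      · rcases h2 with h2 | ⟨item, hm, h'⟩
        · exact Or.inl h2
        · exact Or.inr ⟨item, List.mem_cons_of_mem _ hm, h'⟩

/-- The variables are non-negative, so maximising over repeated items of one index first or over the
whole stream at once gives the same value. Hence the sketch can be updated item by item, in any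
order. -/
theorem iSup_streamSignal_mul {N : ℕ} [Nonempty (Fin N)] (z : ℕ → ℕ) (stream : List (Fin N × ℕ))
    {D : ℝ} (hD : 0 ≤ D) :
    (⨆ i : Fin N, (streamSignal stream i : ℝ) * ((z i : ℝ) / D)) = streamMax z stream 0 / D := by
  obtain ⟨-, h2, h3⟩ := streamMax_spec z stream 0
  refine le_antisymm (ciSup_le fun i => ?_) ?_
  · rw [← mul_div_assoc]
    gcongr
    rcases (streamSignal_spec stream i).2 with h | ⟨item, hm, hi, he⟩
    · rw [h]; simp
    · have := h2 item hm
      rw [hi, he] at this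
      exact_mod_cast this
  · have hle : ∀ i, (streamSignal stream i : ℝ) * ((z i : ℝ) / D)
        ≤ ⨆ i : Fin N, (streamSignal stream i : ℝ) * ((z i : ℝ) / D) := fun i =>
      le_ciSup (f := fun i : Fin N => (streamSignal stream i : ℝ) * ((z i : ℝ) / D))
        (Set.finite_range _).bddAbove i
    rcases h3 with h | ⟨item, hm, he⟩
    · rw [h]
      refine le_trans ?_ (hle (Classical.arbitrary _))
      simp only [Nat.cast_zero, zero_div]
      positivity
    · refine le_trans ?_ (hle item.1)
      rw [he, ← mul_div_assoc]
      have := (streamSignal_spec stream item.1).1 item hm rfl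
      push_cast
      gcongr

/-- Numerical conditions under which no word overflows. -/
structure WordBounds (p h l k w K M : ℕ) : Prop where
  hp : 2 * p < w
  hk : k ≤ w
  hl : ∀ j : Fin K, j * l + (l - p) < w
  hM : (M * (2 ^ (h + p) + 1) + 1) * (2 ^ (h + p) + 1) < 2 ^ w

variable {α : ℝ} {p h l K M N : ℕ}

theorem WordBounds.var_lt (H : WordBounds p h l k w K M) : 2 ^ (h + p) + 1 < 2 ^ w :=
  (Nat.le_mul_of_pos_left _ (Nat.succ_pos _)).trans_lt H.hM

theorem WordBounds.mul_lt (H : WordBounds p h l k w K M) : M * (2 ^ (h + p) + 1) < 2 ^ w :=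
  (Nat.lt_succ_self _).trans ((Nat.le_mul_of_pos_right _ (Nat.succ_pos _)).trans_lt H.hM)

theorem WordBounds.val_lt (H : WordBounds p h l k w K M) : M < 2 ^ w :=
  (Nat.le_mul_of_pos_right _ (Nat.succ_pos _)).trans_lt H.mul_lt

theorem WordBounds.idx_lt (H : WordBounds p h l k w K M) (hN : N ≤ 2 ^ k) (i : Fin N) :
    (i : ℕ) < 2 ^ w :=
  i.2.trans_le (hN.trans (Nat.pow_le_pow_right (by norm_num) H.hk))

theorem exec_updateCode (hα : 0 ≤ α) (H : WordBounds p h l k w K M)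
    {s : SketchVar (Option (Fin k × Fin (w + 1))) K → BitVec w} (hv : (s (wv .val)).toNat ≤ M) :
    (∀ j : Fin K, (exec (updateCode α p h l k w K) s (sk j)).toNat = max (s (sk j)).toNat
        ((s (wv .val)).toNat * varNum α p h l (fun x => s (seed x)) j (s (wv .idx)).toNat)) ∧
      ∀ x, exec (updateCode α p h l k w K) s (seed x) = s (seed x) := by
  obtain ⟨h1, h2⟩ := exec_blockCode (K := K) H.hk s
  have e1 := h2 (wv .val) (by simp)
  obtain ⟨h3, h4⟩ := exec_sketchLoop hα H.hp H.hl H.var_lt (List.finRange K)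
    (List.nodup_finRange K) (s := exec (blockCode k w K) s)
    (by rw [e1]; exact (Nat.mul_le_mul_right _ hv).trans_lt H.mul_lt)
  unfold updateCode
  rw [exec_append]
  refine ⟨fun j => ?_, fun x => ?_⟩
  · rw [h3 j (List.mem_finRange j), e1, h1, h2 (sk j) (by simp), varNum]
  · rw [h4 _ (by simp [frechetDirty]) (by simp), h2 _ (by simp)]

/-- The variables in the memory of the machine. -/
noncomputable def machineVars {α : ℝ} {p h l k w K : ℕ}
    (m : Fin (sketchMachine α p h l k w K).R → BitVec w) :
    SketchVar (Option (Fin k × Fin (w + 1))) K → BitVec w :=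
  m ∘ (sketchLayout _ K).reg

theorem machineVars_init (sd : Option (Fin k × Fin (w + 1)) → BitVec w) :
    (∀ x, machineVars ((sketchMachine α p h l k w K).init sd) (seed x) = sd x) ∧
      ∀ j : Fin K, machineVars ((sketchMachine α p h l k w K).init sd) (sk j) = 0#w := by
  refine ⟨fun x => (sketchMachine α p h l k w K).seedReg.injective.extend_apply sd
    (fun _ => 0#w) x, fun j => ?_⟩
  refine Function.extend_apply' sd (fun _ => 0#w) _ ?_
  rintro ⟨x, hx⟩
  have := (sketchLayout (Option (Fin k × Fin (w + 1))) K).reg_injective hx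
  simp at this

theorem machineVars_step (m : Fin (sketchMachine α p h l k w K).R → BitVec w) (item : Fin N × ℕ) :
    machineVars ((sketchMachine α p h l k w K).step m item)
      = exec (updateCode α p h l k w K) (Function.update (Function.update (machineVars m)
          (wv .idx) (BitVec.ofNat w item.1)) (wv .val) (BitVec.ofNat w item.2)) := by
  refine (WordCode.run_compile _ _ (sizeLE_updateCode α p h l k w K) _).trans ?_
  congr 1
  refine (Function.update_comp_eq_of_injective _ (sketchLayout _ K).reg_injective _ _).trans ?_
  congr 1
  exact Function.update_comp_eq_of_injective _ (sketchLayout _ K).reg_injective _ _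

theorem machineVars_final (sd : Option (Fin k × Fin (w + 1)) → BitVec w) (stream : List (Fin N × ℕ))
    (i₀ : Fin N) :
    machineVars ((sketchMachine α p h l k w K).final sd stream i₀)
      = exec (queryCode α p h l k w K) (Function.update (machineVars
          (stream.foldl (sketchMachine α p h l k w K).step ((sketchMachine α p h l k w K).init sd)))
          (wv .idx) (BitVec.ofNat w i₀)) := by
  refine (WordCode.run_compile _ _ (sizeLE_queryCode α p h l k w K) _).trans ?_
  congr 1
  exact Function.update_comp_eq_of_injective _ (sketchLayout _ K).reg_injective _ _

/-- The invariant of the stream: the random words are never overwritten, so blocks can be recomputed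
at any time, and every entry of the sketch is the maximum so far, small enough not to overflow. -/
theorem machineVars_stream (hα : 0 ≤ α) (H : WordBounds p h l k w K M) (hN : N ≤ 2 ^ k)
    (sd : Option (Fin k × Fin (w + 1)) → BitVec w) (stream : List (Fin N × ℕ))
    (hM : ∀ item ∈ stream, item.2 ≤ M) {m : Fin (sketchMachine α p h l k w K).R → BitVec w}
    (hm : ∀ x, machineVars m (seed x) = sd x) :
    (∀ x, machineVars (stream.foldl (sketchMachine α p h l k w K).step m) (seed x) = sd x) ∧
      ∀ j : Fin K, (machineVars (stream.foldl (sketchMachine α p h l k w K).step m) (sk j)).toNat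
        = streamMax (varNum α p h l sd j) stream (machineVars m (sk j)).toNat := by
  induction stream generalizing m with
  | nil => exact ⟨hm, fun j => rfl⟩
  | cons item stream ih =>
    have hv : item.2 ≤ M := hM item (by simp)
    have hv' := toNat_ofNat_of_lt (hv.trans_lt H.val_lt)
    have hi' := toNat_ofNat_of_lt (H.idx_lt hN item.1)
    obtain ⟨h1, h2⟩ := exec_updateCode (α := α) hα H (s := Function.update (Function.update
      (machineVars m) (wv .idx) (BitVec.ofNat w item.1)) (wv .val) (BitVec.ofNat w item.2))
      (by rw [Function.update_self, hv']; exact hv)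
    rw [← machineVars_step] at h1 h2
    rw [List.foldl_cons]
    obtain ⟨h3, h4⟩ := ih (fun it hit => hM it (List.mem_cons_of_mem _ hit))
      (m := (sketchMachine α p h l k w K).step m item) (fun x => by rw [h2]; simp [hm])
    refine ⟨h3, fun j => ?_⟩
    rw [h4, h1]
    simp only [ne_eq, Sum.inr.injEq, reduceCtorEq, not_false_eq_true, Function.update_of_ne,
      Function.update_self, hv', hi', hm]
    rfl

theorem final_holdsRatio (hα : 0 ≤ α) (H : WordBounds p h l k w K M) (hN : N ≤ 2 ^ k)
    (sd : Option (Fin k × Fin (w + 1)) → BitVec w) (stream : List (Fin N × ℕ))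
    (hM : ∀ item ∈ stream, item.2 ≤ M) (i₀ : Fin N) :
    HoldsRatio (machineVars ((sketchMachine α p h l k w K).final sd stream i₀))
      (ratioScan (fun j : Fin K => streamMax (varNum α p h l sd j) stream 0)
        (fun j : Fin K => varNum α p h l sd j i₀) (List.finRange K) (1, 0, 0)) := by
  rw [machineVars_final]
  obtain ⟨i1, i2⟩ := machineVars_init (α := α) (p := p) (h := h) (l := l) (K := K) sd
  obtain ⟨h1, h2⟩ := machineVars_stream hα H hN sd stream hM i1
  simp only [i2, BitVec.toNat_ofNat, Nat.zero_mod] at h2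
  set s := machineVars (stream.foldl (sketchMachine α p h l k w K).step
    ((sketchMachine α p h l k w K).init sd))
  set s1 := exec [(wv .num, .const 1#w), (wv .den, .const 0#w), (wv .crit, .const 0#w)]
    (Function.update s (wv .idx) (BitVec.ofNat w i₀)) with hs1
  have hs1' : ∀ v, v ∉ [wv .num, wv .den, wv .crit, wv .idx] → s1 v = s v := fun v hv => by
    simp only [List.mem_cons, List.not_mem_nil, or_false, not_or] at hv
    simp [hs1, exec_cons, exec_nil, hv]
  have hidx : s1 (wv .idx) = BitVec.ofNat w i₀ := by simp [hs1, exec_cons, exec_nil]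
  have hr1 : HoldsRatio s1 (1, 0, 0) := by
    simp [HoldsRatio, hs1, exec_cons, exec_nil, WordExpr.eval]
  obtain ⟨b1, b2⟩ := exec_blockCode (K := K) H.hk s1
  have hcur : exec (blockCode k w K) s1 (wv .cur) = blockVal sd i₀ := by
    rw [b1, hidx, toNat_ofNat_of_lt (H.idx_lt hN i₀)]
    congr 1
    ext1 x
    rw [hs1' _ (by simp), h1]
  have hsk : ∀ j, (exec (blockCode k w K) s1 (sk j)).toNat
      = streamMax (varNum α p h l sd j) stream 0 := fun j => by
    rw [b2 _ (by simp), hs1' _ (by simp), h2]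
  have hE : ∀ j, (exec (blockCode k w K) s1 (sk j)).toNat ≤ M * (2 ^ (h + p) + 1) := fun j => by
    rw [hsk]
    rcases (streamMax_spec (varNum α p h l sd j) stream 0).2.2 with h0 | ⟨item, hm, h0⟩
    · rw [h0]; exact Nat.zero_le _
    · rw [h0]; exact Nat.mul_le_mul (hM item hm) (quantileFix_le _ _ _ _)
  have hr2 : HoldsRatio (exec (blockCode k w K) s1) (1, 0, 0) := by
    refine ⟨?_, ?_, ?_⟩
    · rw [b2 _ (by simp)]; exact hr1.1
    · rw [b2 _ (by simp)]; exact hr1.2.1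
    · rw [b2 _ (by simp)]; exact hr1.2.2
  have := exec_ratioLoop hα H.hp H.hl H.hM (List.finRange K) hr2 hE (by simp) (by simp)
  rw [hcur] at this
  simp only [hsk] at this
  unfold queryCode
  rw [exec_append, exec_append]
  exact this

theorem extractLsb'_toNat_div {w l p : ℕ} (hpl : p ≤ l) (x : BitVec w) (j : ℕ) :
    (x.extractLsb' (j * l) l).toNat / 2 ^ (l - p) = pieceVal l p x j := by
  rw [BitVec.extractLsb'_toNat, Nat.shiftRight_eq_div_pow, pieceVal,
    show (2 : ℕ) ^ l = 2 ^ (l - p) * 2 ^ p by rw [← pow_add]; congr 1; omega,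
    Nat.mod_mul_right_div_self, Nat.div_div_eq_div_mul, ← pow_add]

theorem frechetNisan_vars (hN : N ≤ 2 ^ k) (hpl : p ≤ l)
    (sd : Option (Fin k × Fin (K * l + 1)) → BitVec (K * l)) (j : Fin K) (i : Fin N) :
    (frechetNisan α K p h l hN).vars sd j i = (varNum α p h l sd j i : ℝ) / 2 ^ p := by
  have hb : (frechetNisan α K p h l hN).block sd i = blockVal sd i := by
    have := nisanGenerator_getD (i : ℕ) k (fun t => affineHash (K * l) fun b => sd (some (t, b)))
      (sd none) 0#(K * l)
    rw [Nat.mod_eq_of_lt (i.2.trans_le hN)] at this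
    exact this
  let F : BitVec (K * l) → ℝ := fun x =>
    ((quantileFix α p h ((x.extractLsb' (j * l) l).toNat / 2 ^ (l - p)) : ℕ) : ℝ) / ((2 ^ p : ℕ) : ℝ)
  have hF : (frechetNisan α K p h l hN).vars sd j i = F (blockVal sd i) :=
    Eq.trans (show _ = F ((frechetNisan α K p h l hN).block sd i) from rfl) (congrArg F hb)
  rw [hF]
  simp only [F, extractLsb'_toNat_div hpl, varNum]
  push_cast
  rfl

/-- The purpose of the `+ 1` in `quantileFix`: denominators never vanish. -/
theorem varNum_pos (sd : Option (Fin k × Fin (w + 1)) → BitVec w) (j i : ℕ) :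
    0 < varNum α p h l sd j i := by
  unfold varNum quantileFix; omega

/-- The common denominator `2 ^ p` cancels, so the real ratios are quotients of the integers in the
memory. -/
theorem sketchRatio_frechetNisan (hN : N ≤ 2 ^ k) (hpl : p ≤ l)
    (sd : Option (Fin k × Fin (K * l + 1)) → BitVec (K * l)) (stream : List (Fin N × ℕ)) (i₀ : Fin N)
    (j : Fin K) :
    sketchRatio (fun i => (streamSignal stream i : ℝ)) ((frechetNisan α K p h l hN).vars sd) i₀ j
      = (streamMax (varNum α p h l sd j) stream 0 : ℝ) / varNum α p h l sd j i₀ := by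
  have : Nonempty (Fin N) := ⟨i₀⟩
  unfold sketchRatio sketch
  have e : ∀ i, (frechetNisan α K p h l hN).vars sd j i = (varNum α p h l sd j i : ℝ) / 2 ^ p :=
    frechetNisan_vars hN hpl sd j
  simp_rw [e]
  rw [iSup_streamSignal_mul (fun i => varNum α p h l sd j i) stream (by positivity)]
  have := varNum_pos (α := α) (p := p) (h := h) (l := l) sd j i₀
  field_simp

/-- Estimate and criterion depend only on the minimal ratio and on whether it is attained twice,
which is what the scan computes. Numerator and denominator fit into words, so the reported quotient
is the minimum itself. -/
theorem sketchMachine_correct (hα : 0 ≤ α) (hK : 2 ≤ K) (hN : N ≤ 2 ^ k) (hpl : p ≤ l)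
    (H : WordBounds p h l k (K * l) K M)
    (sd : Option (Fin k × Fin (K * l + 1)) → BitVec (K * l)) (stream : List (Fin N × ℕ))
    (hM : ∀ item ∈ stream, item.2 ≤ M) (i₀ : Fin N) :
    (sketchMachine α p h l k (K * l) K).estimate sd stream i₀
        = pointEstimate hK (fun i => (streamSignal stream i : ℝ))
          ((frechetNisan α K p h l hN).vars sd) i₀ ∧
      (sketchMachine α p h l k (K * l) K).crit sd stream i₀
        = criterion hK (fun i => (streamSignal stream i : ℝ))
          ((frechetNisan α K p h l hN).vars sd) i₀ := by
  classical
  obtain ⟨f1, f2, f3⟩ := final_holdsRatio hα H hN sd stream hM i₀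
  obtain ⟨j, -, r1, r2, r3, r4⟩ := ratioScan_spec
    (fun j : Fin K => streamMax (varNum α p h l sd j) stream 0)
    (fun j : Fin K => varNum α p h l sd j i₀) (fun j => varNum_pos sd j i₀) (List.finRange K)
    (List.nodup_finRange K) (by
      intro h0
      have := congrArg List.length h0
      simp at this
      omega)
  have hg := sketchRatio_frechetNisan (α := α) (h := h) hN hpl sd stream i₀
  have hmin : ∀ i, sketchRatio (fun i => (streamSignal stream i : ℝ))
      ((frechetNisan α K p h l hN).vars sd) i₀ j ≤ sketchRatio (fun i => (streamSignal stream i : ℝ))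
      ((frechetNisan α K p h l hN).vars sd) i₀ i := fun i => by
    rw [hg, hg]; exact r3 i (List.mem_finRange i)
  rw [r1] at f1
  rw [r2] at f2
  rw [r4] at f3
  have hE : streamMax (varNum α p h l sd j) stream 0 < 2 ^ (K * l) := by
    rcases (streamMax_spec (varNum α p h l sd j) stream 0).2.2 with h0 | ⟨item, hm, h0⟩
    · rw [h0]; positivity
    · rw [h0]
      exact (Nat.mul_le_mul (hM item hm) (quantileFix_le _ _ _ _)).trans_lt H.mul_lt
  have hz : varNum α p h l sd j i₀ < 2 ^ (K * l) := (quantileFix_le _ _ _ _).trans_lt H.var_lt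
  constructor
  · rw [pointEstimate, orderStat_zero hK hmin, hg, StreamMachine.estimate]
    change ((machineVars ((sketchMachine α p h l k (K * l) K).final sd stream i₀) (wv .num)).toNat : ℝ)
      / ((machineVars ((sketchMachine α p h l k (K * l) K).final sd stream i₀) (wv .den)).toNat : ℝ)
      = _
    rw [f1, f2, toNat_ofNat_of_lt hE, toNat_ofNat_of_lt hz]
  · change (machineVars ((sketchMachine α p h l k (K * l) K).final sd stream i₀) (wv .crit)).toNat = _
    rw [f3, toNat_ofNat_of_lt, criterion]
    · simp only [orderStat_zero_eq_one_iff hK hmin, hg, List.mem_finRange, true_and]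
    · have := H.hp
      have : 1 < 2 ^ (K * l) := Nat.one_lt_two_pow (by omega)
      split_ifs <;> omega

end Machine

end

section

open scoped BigOperators
open MeasureTheory ProbabilityTheory

/-! The sketch as an automaton -/

/-- The maximum of `f(i) z(i)` over `i < n`. -/
def partialMax (f z : ℕ → ℕ) : ℕ → ℕ
  | 0 => 0
  | n + 1 => max (partialMax f z n) (f n * z n)

theorem partialMax_spec (f z : ℕ → ℕ) (n : ℕ) :
    (∀ i < n, f i * z i ≤ partialMax f z n) ∧
      (partialMax f z n = 0 ∨ ∃ i < n, partialMax f z n = f i * z i) := by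
  induction n with
  | zero => simp [partialMax]
  | succ n ih =>
    obtain ⟨h1, h2⟩ := ih
    refine ⟨fun i hi => ?_, ?_⟩
    · rcases Nat.lt_succ_iff_lt_or_eq.1 hi with hi | rfl
      · exact (h1 i hi).trans (le_max_left _ _)
      · exact le_max_right _ _
    · rcases max_choice (partialMax f z n) (f n * z n) with h | h
      · rw [partialMax, h]
        rcases h2 with h2 | ⟨i, hi, h2⟩
        · exact Or.inl h2
        · exact Or.inr ⟨i, hi.trans (Nat.lt_succ_self n), h2⟩
      · exact Or.inr ⟨n, Nat.lt_succ_self n, h⟩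

theorem iSup_mul_eq_partialMax {N : ℕ} [Nonempty (Fin N)] (f z : ℕ → ℕ) {D : ℝ} (hD : 0 ≤ D) :
    (⨆ i : Fin N, (f i : ℝ) * ((z i : ℝ) / D)) = partialMax f z N / D := by
  obtain ⟨h1, h2⟩ := partialMax_spec f z N
  refine le_antisymm (ciSup_le fun i => ?_) ?_
  · rw [← mul_div_assoc]
    gcongr
    exact_mod_cast h1 i i.2
  · have hle : ∀ i : Fin N, (f i : ℝ) * ((z i : ℝ) / D) ≤ ⨆ i : Fin N, (f i : ℝ) * ((z i : ℝ) / D) := fun i =>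
      le_ciSup (f := fun i : Fin N => (f i : ℝ) * ((z i : ℝ) / D)) (Set.finite_range _).bddAbove i
    rcases h2 with h | ⟨i, hi, he⟩
    · rw [h]
      refine le_trans ?_ (hle (Classical.arbitrary _))
      simp only [Nat.cast_zero, zero_div]
      positivity
    · refine le_trans (le_of_eq ?_) (hle ⟨i, hi⟩)
      rw [he, ← mul_div_assoc]
      push_cast
      rfl

/-- States of the sketching automaton: the sketch, and the variables at the queried index. -/
abbrev SketchState (K V : ℕ) : Type := (Fin K → Fin (V + 1)) × (Fin K → Fin (V + 1))

/-- Transitions of the automaton that computes the sketch of a fixed signal. -/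
def sketchTransition {B : Type} (K V N : ℕ) (f : ℕ → ℕ) (i₀ : ℕ) (ζ : ℕ → B → ℕ) (o : ℕ)
    (s : SketchState K V) (b : B) : SketchState K V :=
  if o < N then (fun j => Fin.ofNat (V + 1) (max (s.1 j) (f o * ζ j b)),
    fun j => if o = i₀ then Fin.ofNat (V + 1) (ζ j b) else s.2 j) else s

/-- No entry exceeds `V`, so the reduction modulo `V + 1` in the transitions is never active, and
blocks after the `N`-th change nothing. -/
theorem run_sketchTransition {B : Type} {K V N : ℕ} {f : ℕ → ℕ} {i₀ : ℕ} {ζ : ℕ → B → ℕ}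
    (hζ : ∀ j b, ζ j b ≤ V) (hf : ∀ i < N, ∀ j b, f i * ζ j b ≤ V) (hi₀ : i₀ < N) (L : List B)
    (hL : N ≤ L.length) (d : B) (j : Fin K) :
    ((runAutomaton (sketchTransition K V N f i₀ ζ) 0 (0, 0) L).1 j : ℕ)
        = partialMax f (fun i => ζ j (L.getD i d)) N ∧
      ((runAutomaton (sketchTransition K V N f i₀ ζ) 0 (0, 0) L).2 j : ℕ) = ζ j (L.getD i₀ d) := by
  have hmax : ∀ n ≤ N, partialMax f (fun i => ζ j (L.getD i d)) n ≤ V := fun n hn => by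
    rcases (partialMax_spec f (fun i => ζ j (L.getD i d)) n).2 with h | ⟨i, hi, h⟩
    · rw [h]; exact Nat.zero_le _
    · rw [h]; exact hf i (hi.trans_le hn) _ _
  have key : ∀ n ≤ L.length,
      ((runAutomaton (sketchTransition K V N f i₀ ζ) 0 (0, 0) (L.take n)).1 j : ℕ)
        = partialMax f (fun i => ζ j (L.getD i d)) (min n N) ∧
      ((runAutomaton (sketchTransition K V N f i₀ ζ) 0 (0, 0) (L.take n)).2 j : ℕ)
        = if i₀ < n then ζ j (L.getD i₀ d) else 0 := fun n => by
    induction n with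
    | zero => simp [runAutomaton, partialMax]
    | succ n ih =>
      intro hn
      obtain ⟨h1, h2⟩ := ih (by omega)
      have hLn : L.take (n + 1) = L.take n ++ [L.getD n d] := by
        rw [List.take_add_one]
        simp [List.getD, List.getElem?_eq_getElem (show n < L.length by omega)]
      have hlen : (L.take n).length = n := by rw [List.length_take]; omega
      rw [hLn, runAutomaton_append, hlen, zero_add]
      set s := runAutomaton (sketchTransition K V N f i₀ ζ) 0 (0, 0) (L.take n)
      simp only [runAutomaton, sketchTransition]
      by_cases hnN : n < N
      · rw [if_pos hnN]
        rw [min_eq_left hnN.le] at h1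
        rw [min_eq_left (by omega), partialMax]
        constructor
        · simp only [h1, Fin.val_ofNat]
          refine Nat.mod_eq_of_lt (Nat.lt_succ_of_le ?_)
          exact max_le (hmax n hnN.le) (hf n hnN _ _)
        · by_cases hni : n = i₀
          · subst hni
            simp only [if_true, Fin.val_ofNat, Nat.lt_succ_self]
            exact Nat.mod_eq_of_lt (Nat.lt_succ_of_le (hζ _ _))
          · simp only [hni, if_false, h2]
            congr 1
            exact propext (by omega)
      · rw [if_neg hnN, h1, h2]
        refine ⟨by congr 1; omega, ?_⟩
        rw [if_pos (by omega), if_pos (by omega)]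
  obtain ⟨h1, h2⟩ := key L.length le_rfl
  rw [List.take_length] at h1 h2
  rw [min_eq_right hL] at h1
  rw [if_pos (by omega)] at h2
  exact ⟨h1, h2⟩

/-- The event that the two smallest of the given ratios agree but differ from `c`. -/
def BadRatios {K : ℕ} (hK : 2 ≤ K) (c : ℝ) (g : Fin K → ℝ) : Prop :=
  orderStat g ⟨0, by omega⟩ ≠ c ∧ orderStat g ⟨0, by omega⟩ = orderStat g ⟨1, by omega⟩

theorem badRatios_sketchRatio_iff {N K : ℕ} (hK : 2 ≤ K) (f : Fin N → ℝ) (z : Fin K → Fin N → ℝ)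
    (i₀ : Fin N) : BadRatios hK (f i₀) (sketchRatio f z i₀) ↔
      pointEstimate hK f z i₀ ≠ f i₀ ∧ criterion hK f z i₀ = 1 := by
  simp [BadRatios, pointEstimate, criterion]

theorem sketchRatio_eq_run {B : Type} {K V N : ℕ} {f : ℕ → ℕ} {i₀ : Fin N} {ζ : ℕ → B → ℕ}
    (hζ : ∀ j b, ζ j b ≤ V) (hζ0 : ∀ j b, 0 < ζ j b) (hf : ∀ i < N, ∀ j b, f i * ζ j b ≤ V) (L : List B)
    (hL : N ≤ L.length) (d : B) {D : ℝ} (hD : 0 < D) :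
    (fun j => ((runAutomaton (sketchTransition K V N f i₀ ζ) 0 (0, 0) L).1 j : ℝ) /
        ((runAutomaton (sketchTransition K V N f i₀ ζ) 0 (0, 0) L).2 j : ℝ))
      = sketchRatio (fun i : Fin N => (f i : ℝ)) (fun j i => (ζ j (L.getD i d) : ℝ) / D) i₀ := by
  have : Nonempty (Fin N) := ⟨i₀⟩
  ext1 j
  obtain ⟨h1, h2⟩ := run_sketchTransition hζ hf i₀.2 L hL d j
  rw [sketchRatio, sketch, iSup_mul_eq_partialMax f (fun i => ζ j (L.getD i d)) hD.le]
  rw [← h1, ← h2]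
  have : (((runAutomaton (sketchTransition K V N f i₀ ζ) 0 (0, 0) L).2 j : ℕ) : ℝ) ≠ 0 := by
    rw [h2]; exact_mod_cast (hζ0 _ _).ne'
  field_simp

/-! Truly random blocks -/

/-- A block of `K * l` bits is the concatenation of its pieces, so uniform blocks yield independent
uniform pieces. -/
theorem extract_bijective (K l N : ℕ) : Function.Bijective
    (fun (b : Fin N → BitVec (K * l)) (q : Fin K × Fin N) =>
      (b q.2).extractLsb' ((q.1 : ℕ) * l) l) := by
  rw [Fintype.bijective_iff_injective_and_card]
  constructor
  · intro b b' h
    ext1 i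
    refine BitVec.eq_of_getLsbD_eq fun m hm => ?_
    have hl : 0 < l := Nat.pos_of_ne_zero fun h0 => by subst h0; simp at hm
    have hj : m / l < K := Nat.div_lt_of_lt_mul (by rwa [mul_comm] at hm)
    have h1 := congrArg (fun x => BitVec.getLsbD x (m % l)) (congrFun h (⟨m / l, hj⟩, i))
    simpa [BitVec.getLsbD_extractLsb', Nat.mod_lt _ hl, Nat.div_add_mod'] using h1
  · simp only [← Nat.card_eq_fintype_card, Nat.card_fun, card_bitVec, Nat.card_prod, Nat.card_fin]
    rw [← pow_mul, ← pow_mul]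
    congr 1
    ring

instance isProbabilityMeasure_unitInterval :
    IsProbabilityMeasure (volume.restrict (Set.Ioo (0 : ℝ) 1)) := ⟨by simp⟩

/-- Every configuration of digits contains an open dyadic box of measure `1 / 2^(l |ι|)`, and the
boxes are disjoint. Only an inequality is needed, so the boundaries of the boxes play no role. -/
theorem card_div_le_measure {ι : Type} [Fintype ι] {l : ℕ} (A : Set (ι → BitVec l)) :
    (Nat.card A : ℝ) / Nat.card (ι → BitVec l) ≤
      (Measure.pi fun _ : ι => volume.restrict (Set.Ioo (0 : ℝ) 1)).real
        {ω | (fun q => BitVec.ofNat l ⌊(2 : ℝ) ^ l * ω q⌋₊) ∈ A} := by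
  classical
  have hP : (0 : ℝ) < 2 ^ l := by positivity
  let box : (ι → BitVec l) → Set (ι → ℝ) := fun c => Set.univ.pi fun q =>
    Set.Ioo (((c q).toNat : ℝ) / 2 ^ l) (((c q).toNat + 1 : ℝ) / 2 ^ l)
  have hval : ∀ c, ∀ ω ∈ box c, (fun q => BitVec.ofNat l ⌊(2 : ℝ) ^ l * ω q⌋₊) = c := by
    intro c ω hω
    ext1 q
    have h := hω q (Set.mem_univ q)
    rw [Set.mem_Ioo, div_lt_iff₀ hP, lt_div_iff₀ hP] at h
    have : ⌊(2 : ℝ) ^ l * ω q⌋₊ = (c q).toNat := by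
      rw [Nat.floor_eq_iff]
      · constructor <;> linarith [h.1, h.2]
      · have : (0 : ℝ) ≤ (c q).toNat := Nat.cast_nonneg _
        linarith [h.1]
    rw [this]
    simp
  have hbox : ∀ c, (Measure.pi fun _ : ι => volume.restrict (Set.Ioo (0 : ℝ) 1)) (box c)
      = ENNReal.ofReal (1 / (Nat.card (ι → BitVec l) : ℝ)) := by
    intro c
    have h1 : ∀ q, (volume.restrict (Set.Ioo (0 : ℝ) 1))
        (Set.Ioo (((c q).toNat : ℝ) / 2 ^ l) (((c q).toNat + 1 : ℝ) / 2 ^ l))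
        = ENNReal.ofReal (1 / 2 ^ l) := fun q => by
      rw [Measure.restrict_apply measurableSet_Ioo, Set.inter_eq_left.2, Real.volume_Ioo]
      · congr 1; ring
      · refine Set.Ioo_subset_Ioo (by positivity) ?_
        rw [div_le_one hP]
        exact_mod_cast (c q).isLt
    rw [Measure.pi_pi]
    simp_rw [h1]
    rw [Finset.prod_const, ← ENNReal.ofReal_pow (by positivity), Finset.card_univ, Nat.card_fun,
      card_bitVec, Nat.card_eq_fintype_card]
    congr 1
    push_cast
    rw [div_pow, one_pow]
  have hsub : (⋃ c ∈ A.toFinset, box c) ⊆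
      {ω | (fun q => BitVec.ofNat l ⌊(2 : ℝ) ^ l * ω q⌋₊) ∈ A} := by
    intro ω hω
    simp only [Set.mem_iUnion, Set.mem_toFinset, exists_prop] at hω
    obtain ⟨c, hc, hω⟩ := hω
    rw [Set.mem_ofPred_eq, hval c ω hω]
    exact hc
  have hdisj : ((A.toFinset : Finset (ι → BitVec l)) : Set (ι → BitVec l)).PairwiseDisjoint box := by
    intro c _ c' _ hne
    refine Set.disjoint_left.2 fun ω h h' => hne ?_
    rw [← hval c ω h, hval c' ω h']
  refine le_trans (le_of_eq ?_) (measureReal_mono hsub)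
  rw [measureReal_def, measure_biUnion_finset hdisj
    (fun c _ => MeasurableSet.univ_pi fun q => measurableSet_Ioo)]
  simp_rw [hbox]
  rw [Finset.sum_const, Set.toFinset_card, nsmul_eq_mul, ENNReal.toReal_mul, ENNReal.toReal_natCast,
    ENNReal.toReal_ofReal (by positivity), Nat.card_eq_fintype_card]
  ring

theorem expect_ite_eq_card_div {ι : Type} [Fintype ι] (A : Set ι) [DecidablePred (· ∈ A)] :
    (𝔼 x, if x ∈ A then (1 : ℝ) else 0) = (Nat.card A : ℝ) / Nat.card ι := by
  rw [Fintype.expect_eq_sum_div_card, Finset.sum_boole, Nat.card_eq_fintype_card,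
    Nat.card_eq_fintype_card, Fintype.card_subtype]

open Classical in
-- The bound for independent variables is applied to the product of uniform laws, with the
-- coordinates as `U` and the table at their leading digits as `Z`.
theorem expect_blocks_le {α C : ℝ} (hC : FailureBound.{0} α C) {N K l : ℕ} (hK : 2 ≤ K) {δ γ β : ℝ}
    (hδ : 0 < δ) (hγ : 0 < γ) (hγδ : γ < δ / (4 * K * N)) (hβ : β ≤ C * precisionScale α δ N K)
    (T : BitVec l → ℝ)
    (hT : ∀ u ∈ Set.Icc γ (1 - γ), |T (BitVec.ofNat l ⌊(2 : ℝ) ^ l * u⌋₊) - frechetInv α u| ≤ β)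
    {f : Fin N → ℝ} (hf : ∀ i, 0 ≤ f i) (i₀ : Fin N) :
    (𝔼 b : Fin N → BitVec (K * l), if BadRatios hK (f i₀)
        (sketchRatio f (fun j i => T ((b i).extractLsb' ((j : ℕ) * l) l)) i₀)
        then (1 : ℝ) else 0) ≤ δ := by
  let A : Set (Fin K × Fin N → BitVec l) :=
    {c | BadRatios hK (f i₀) (sketchRatio f (fun j i => T (c (j, i))) i₀)}
  let Z : ℝ → ℝ := fun u => T (BitVec.ofNat l ⌊(2 : ℝ) ^ l * u⌋₊)
  have hZ : Measurable Z :=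
    (measurable_from_top (f := fun n : ℕ => T (BitVec.ofNat l n))).comp
      (Nat.measurable_floor.comp (measurable_const_mul _))
  have h1 : (𝔼 b : Fin N → BitVec (K * l), if BadRatios hK (f i₀)
        (sketchRatio f (fun j i => T ((b i).extractLsb' ((j : ℕ) * l) l)) i₀)
        then (1 : ℝ) else 0) = (Nat.card A : ℝ) / Nat.card (Fin K × Fin N → BitVec l) := by
    rw [← expect_ite_eq_card_div A]
    exact Fintype.expect_equiv (Equiv.ofBijective _ (extract_bijective K l N)) _ _ fun b => rfl
  rw [h1]
  refine (card_div_le_measure A).trans ?_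
  have h2 := hC N K hK δ γ β hδ hγ hγδ hβ (Fin K × Fin N → ℝ)
    (Measure.pi fun _ => volume.restrict (Set.Ioo (0 : ℝ) 1))
    (fun j i ω => ω (j, i)) (fun j i ω => Z (ω (j, i)))
    (fun j i => measurable_pi_apply _) (fun j i => hZ.comp (measurable_pi_apply _))
    (fun j i => (measurePreserving_eval (fun _ : Fin K × Fin N =>
      volume.restrict (Set.Ioo (0 : ℝ) 1)) (j, i)).map_eq)
    (iIndepFun_pi (X := fun (_ : Fin K × Fin N) (u : ℝ) => (u, Z u))
      fun _ => (measurable_id.prodMk hZ).aemeasurable)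
    (Filter.Eventually.of_forall fun ω j i hu => hT _ hu) f hf i₀
  refine le_trans (le_of_eq ?_) h2
  congr 1
  ext ω
  exact badRatios_sketchRatio_iff hK f (fun j i => Z (ω (j, i))) i₀

/-! The failure probability of the pseudo-random sketch -/

theorem affineHash_pairwise {w : ℕ} [DecidableEq (BitVec w)] (x x' : BitVec w) (hx : x ≠ x')
    (y y' : BitVec w) :
    ((Finset.univ.filter fun κ => affineHash w κ x = y ∧ affineHash w κ x' = y').card : ℝ)
      * (Fintype.card (BitVec w) : ℝ) ^ 2 = Fintype.card (Fin (w + 1) → BitVec w) := by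
  have h := card_affineHash_fiber hx y y'
  rw [Nat.card_eq_fintype_card, Fintype.card_subtype, ← card_bitVec w, Nat.card_eq_fintype_card,
    Nat.card_eq_fintype_card] at h
  exact_mod_cast h

theorem seedProb_eq_expect {k w : ℕ} (A : (Option (Fin k × Fin (w + 1)) → BitVec w) → Prop)
    [DecidablePred A] :
    seedProb A = 𝔼 κ : Fin k → Fin (w + 1) → BitVec w, 𝔼 x : BitVec w,
      if A (fun o => o.elim x fun q => κ q.1 q.2) then (1 : ℝ) else 0 := by
  have h1 : seedProb A = 𝔼 sd, if A sd then (1 : ℝ) else 0 :=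
    (expect_ite_eq_card_div {sd | A sd}).symm
  rw [h1, Finset.expect_comm, ← Finset.expect_product', Finset.univ_product_univ]
  refine Fintype.expect_equiv ((Equiv.piOptionEquivProd).trans
    ((Equiv.refl _).prodCongr (Equiv.curry _ _ _))) _ _ fun sd => ?_
  congr 2
  ext1 o
  rcases o with _ | q <;> rfl

open Classical in
-- Failure is a property of the final state of the automaton that reads the blocks in the order of
-- the indices. Random blocks give at most `δ`; the second summand is the error of the generator for
-- `(V + 1)^(2K)` states.
theorem seedProb_frechetNisan_le {α C : ℝ} (hC : FailureBound.{0} α C) {N K l p h k M : ℕ} (hK : 2 ≤ K)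
    (hN : N ≤ 2 ^ k) (hpl : p ≤ l) {δ γ β : ℝ} (hδ : 0 < δ) (hγ : 0 < γ) (hγδ : γ < δ / (4 * K * N))
    (hβ : β ≤ C * precisionScale α δ N K) (hT : (frechetNisan α K p h l hN).Precise α γ β)
    {f : Fin N → ℕ} (hf : ∀ i, f i ≤ M) (i₀ : Fin N) :
    seedProb (fun sd : Option (Fin k × Fin (K * l + 1)) → BitVec (K * l) =>
        pointEstimate hK (fun i => (f i : ℝ)) ((frechetNisan α K p h l hN).vars sd) i₀ ≠ f i₀ ∧
        criterion hK (fun i => (f i : ℝ)) ((frechetNisan α K p h l hN).vars sd) i₀ = 1)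
      ≤ δ + 2 ^ k * (((((M + 1) * (2 ^ (h + p) + 1) + 1 : ℕ) : ℝ) ^ (2 * K)) ^ 2
          * (1 / √((2 : ℝ) ^ (K * l)))) := by
  -- The factor `M + 1` makes `V` a bound both for the variables and for their products with the
  -- signal.
  set V := (M + 1) * (2 ^ (h + p) + 1) with hV
  let f' : ℕ → ℕ := fun i => if hi : i < N then f ⟨i, hi⟩ else 0
  have hf' : ∀ i : Fin N, f' i = f i := fun i => by simp [f']
  let ζ : ℕ → BitVec (K * l) → ℕ := fun j x => quantileFix α p h (pieceVal l p x j)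
  have hζV : ∀ j x, ζ j x ≤ V := fun j x =>
    (quantileFix_le _ _ _ _).trans (Nat.le_mul_of_pos_left _ (Nat.succ_pos _))
  have hζ0 : ∀ j x, 0 < ζ j x := fun j x => by simp only [ζ, quantileFix]; omega
  have hfV : ∀ i < N, ∀ j x, f' i * ζ j x ≤ V := fun i hi j x => by
    refine Nat.mul_le_mul ?_ (quantileFix_le _ _ _ _)
    have := hf ⟨i, hi⟩
    simp only [f', hi, dite_true]
    omega
  have hD : (0 : ℝ) < 2 ^ p := by positivity
  have hfun : (fun i : Fin N => (f' i : ℝ)) = fun i => (f i : ℝ) := by ext1 i; rw [hf']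
  let bad : SketchState K V → Prop := fun s =>
    BadRatios hK (f i₀) fun j => ((s.1 j : ℕ) : ℝ) / ((s.2 j : ℕ) : ℝ)
  have hstep : ∀ o, N ≤ o → ∀ a b, sketchTransition K V N f' i₀ ζ o a b = a := fun o ho a b => by
    simp [sketchTransition, not_lt.2 ho]
  have main := expect_nisan_le (H := Fin (K * l + 1) → BitVec (K * l)) (hash := affineHash (K * l))
    affineHash_pairwise hN hstep (0, 0) bad
  have hcard : (Fintype.card (SketchState K V) : ℝ) = ((V + 1 : ℕ) : ℝ) ^ (2 * K) := by
    simp only [Fintype.card_prod, Fintype.card_fun, Fintype.card_fin]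
    push_cast
    ring
  have hcardB : (Fintype.card (BitVec (K * l)) : ℝ) = 2 ^ (K * l) := by
    rw [← Nat.card_eq_fintype_card, card_bitVec]; push_cast; rfl
  rw [hcard, hcardB] at main
  have hleft : seedProb (fun sd : Option (Fin k × Fin (K * l + 1)) → BitVec (K * l) =>
        pointEstimate hK (fun i => (f i : ℝ)) ((frechetNisan α K p h l hN).vars sd) i₀ ≠ f i₀ ∧
        criterion hK (fun i => (f i : ℝ)) ((frechetNisan α K p h l hN).vars sd) i₀ = 1)
      = 𝔼 κ : Fin k → Fin (K * l + 1) → BitVec (K * l), 𝔼 x,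
        (if bad (runAutomaton (sketchTransition K V N f' i₀ ζ) 0 (0, 0)
          (nisanGenerator k (fun t => affineHash (K * l) (κ t)) x)) then (1 : ℝ) else 0) := by
    rw [seedProb_eq_expect]
    refine Finset.expect_congr rfl fun κ _ => Finset.expect_congr rfl fun x _ => ?_
    congr 1
    simp only [bad]
    rw [← badRatios_sketchRatio_iff,
      sketchRatio_eq_run hζV hζ0 hfV _ (by rw [length_nisanGenerator]; exact hN) 0#(K * l) hD, hfun]
    refine congrArg (BadRatios hK (f i₀ : ℝ)) (congrArg (fun z => sketchRatio _ z i₀) ?_)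
    ext j i
    rw [frechetNisan_vars hN hpl, varNum, blockVal, ← nisanGenerator_getD (i : ℕ) k _ _ 0#(K * l),
      Nat.mod_eq_of_lt (i.2.trans_le hN)]
    rfl
  have hright : (𝔼 b : Fin N → BitVec (K * l),
      if bad (runAutomaton (sketchTransition K V N f' i₀ ζ) 0 (0, 0) (List.ofFn b))
        then (1 : ℝ) else 0) ≤ δ := by
    refine le_trans (le_of_eq ?_) (expect_blocks_le hC hK hδ hγ hγδ hβ
      (fun x : BitVec l => (quantileFix α p h (x.toNat / 2 ^ (l - p)) : ℝ) / 2 ^ p)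
      (fun u hu => by
        have := hT u hu
        have e : ((frechetNisan α K p h l hN).D : ℝ) = 2 ^ p := by
          change ((2 ^ p : ℕ) : ℝ) = _; push_cast; rfl
        rw [e] at this
        exact this) (f := fun i => (f i : ℝ)) (fun i => Nat.cast_nonneg _) i₀)
    refine Finset.expect_congr rfl fun b _ => ?_
    congr 1
    simp only [bad]
    rw [sketchRatio_eq_run hζV hζ0 hfV _ (by simp) 0#(K * l) hD, hfun]
    refine congrArg (BadRatios hK (f i₀ : ℝ)) (congrArg (fun z => sketchRatio _ z i₀) ?_)
    ext j i
    simp only [ζ, extractLsb'_toNat_div hpl]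
    simp
  rw [hleft]
  exact main.trans (add_le_add hright le_rfl)

end

/-! Choice of the parameters -/

/-- The first point is `2^(-h) exp (gridMesh)`, and the hypothesis makes the mesh at most `ln 2`. -/
theorem gridPoint_zero_le {p h : ℕ} (hp : 2 * h ≤ 2 ^ p) : gridPoint p h 0 ≤ 2 / 2 ^ h := by
  have hP : (0 : ℝ) < 2 ^ p := by positivity
  have e : -(gridMesh p h * (2 ^ p - 1 - ((0 : ℕ) : ℝ))) = gridMesh p h - 2 * (h * Real.log 2) := by
    unfold gridMesh; field_simp; push_cast; ring
  have h1 : gridMesh p h ≤ Real.log 2 := by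
    unfold gridMesh
    rw [div_le_iff₀ hP, mul_comm (Real.log 2)]
    have : (2 * h : ℝ) ≤ 2 ^ p := by exact_mod_cast hp
    have := Real.log_nonneg (x := 2) (by norm_num)
    gcongr
  unfold gridPoint
  rw [e]
  calc (2 : ℝ) ^ h * Real.exp (gridMesh p h - 2 * (h * Real.log 2))
      ≤ 2 ^ h * Real.exp (Real.log 2 - 2 * (h * Real.log 2)) := by gcongr
    _ = 2 / 2 ^ h := by
      rw [Real.exp_sub, Real.exp_log two_pos, two_mul, Real.exp_add, Real.exp_nat_mul,
        Real.exp_log two_pos]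
      field_simp

theorem le_gridPoint_zero (p h : ℕ) : 1 / 2 ^ h ≤ gridPoint p h 0 := by
  have hP : (0 : ℝ) < 2 ^ p := by positivity
  have e : -(gridMesh p h * (2 ^ p - 1 - ((0 : ℕ) : ℝ))) = gridMesh p h - 2 * (h * Real.log 2) := by
    unfold gridMesh; field_simp; push_cast; ring
  have h1 := gridMesh_nonneg p h
  unfold gridPoint
  rw [e]
  calc 1 / 2 ^ h = (2 : ℝ) ^ h * Real.exp (0 - 2 * (h * Real.log 2)) := by
        rw [Real.exp_sub, Real.exp_zero, two_mul, Real.exp_add, Real.exp_nat_mul,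
          Real.exp_log two_pos]
        field_simp
    _ ≤ _ := by gcongr

theorem gridScale_le {α : ℝ} {s : ℕ} (hα : 0 < α) (hs : α ≤ s) (p h : ℕ) :
    gridScale α p h ≤ 2 ^ (h * s) := by
  unfold gridScale
  calc gridPoint p h 0 ^ (-α) ≤ (1 / 2 ^ h : ℝ) ^ (-α) :=
        Real.rpow_le_rpow_of_nonpos (by positivity) (le_gridPoint_zero p h) (by linarith)
    _ = ((2 : ℝ) ^ h) ^ α := by
        rw [one_div, Real.inv_rpow (by positivity), Real.rpow_neg (by positivity), inv_inv]
    _ ≤ ((2 : ℝ) ^ h) ^ (s : ℝ) := Real.rpow_le_rpow_of_exponent_le (one_le_pow₀ (by norm_num)) hs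
    _ = 2 ^ (h * s) := by rw [Real.rpow_natCast, pow_mul]

theorem frechetInv_one_sub_le {α : ℝ} {s g : ℕ} (hα : 0 < α) (hs : 1 / α ≤ s) (hg : 1 ≤ g) :
    frechetInv α (1 - 1 / 2 ^ g) ≤ 2 ^ (g * s) := by
  have h2 : (2 : ℝ) ≤ 2 ^ g := by simpa using pow_le_pow_right₀ (one_le_two (α := ℝ)) hg
  have h3 : (1 : ℝ) / 2 ^ g ≤ 1 / 2 := by gcongr
  have hlog : 1 / 2 ^ g ≤ Real.log (1 / (1 - 1 / 2 ^ g)) := by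
    rw [one_div (1 - _), Real.log_inv]
    have := Real.log_le_sub_one_of_pos (x := 1 - 1 / 2 ^ g) (by linarith)
    linarith
  unfold frechetInv
  calc _ ≤ (1 / 2 ^ g : ℝ) ^ (-(1 / α)) :=
        Real.rpow_le_rpow_of_nonpos (by positivity) hlog (by have : 0 < 1 / α := by positivity
                                                             linarith)
    _ = ((2 : ℝ) ^ g) ^ (1 / α) := by
        rw [one_div ((2 : ℝ) ^ g), Real.inv_rpow (by positivity), Real.rpow_neg (by positivity),
          inv_inv]
    _ ≤ ((2 : ℝ) ^ g) ^ (s : ℝ) := Real.rpow_le_rpow_of_exponent_le (one_le_pow₀ (by norm_num)) hs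
    _ = 2 ^ (g * s) := by rw [Real.rpow_natCast, pow_mul]

theorem le_frechetInv {α : ℝ} {s g : ℕ} (hα : 0 < α) (hs : 1 / α ≤ s) (hg : 1 ≤ g) :
    1 / 2 ^ (g * s) ≤ frechetInv α (1 / 2 ^ g) := by
  have h2 : (2 : ℝ) ≤ 2 ^ g := by simpa using pow_le_pow_right₀ (one_le_two (α := ℝ)) hg
  have hlog : Real.log (1 / (1 / 2 ^ g)) ≤ 2 ^ g := by
    rw [one_div_one_div]
    exact (Real.log_le_sub_one_of_pos (by positivity)).trans (by linarith)
  have hlog0 : 0 < Real.log (1 / (1 / 2 ^ g)) := by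
    rw [one_div_one_div]
    exact Real.log_pos (by linarith)
  have ha : 0 < 1 / α := by positivity
  unfold frechetInv
  calc (1 : ℝ) / 2 ^ (g * s) = 1 / ((2 : ℝ) ^ g) ^ (s : ℝ) := by rw [Real.rpow_natCast, pow_mul]
    _ ≤ 1 / ((2 : ℝ) ^ g) ^ (1 / α) := by
        gcongr
        linarith
    _ = ((2 : ℝ) ^ g) ^ (-(1 / α)) := by rw [Real.rpow_neg (by positivity), one_div]
    _ ≤ _ := Real.rpow_le_rpow_of_nonpos hlog0 hlog (by linarith)

theorem quantileLip_le {α : ℝ} {s : ℕ} (hα : 0 < α) (hs : 1 / α ≤ s) (g : ℕ) :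
    quantileLip α (1 / 2 ^ g) ≤ 2 ^ (s + g * (s + 2)) := by
  have hs2 : (s : ℝ) ≤ 2 ^ s := by exact_mod_cast (Nat.lt_two_pow_self (n := s)).le
  have e : ((1 : ℝ) / 2 ^ g) ^ (-(1 / α) - 1) = ((2 : ℝ) ^ g) ^ (1 / α + 1) := by
    rw [one_div ((2 : ℝ) ^ g), Real.inv_rpow (by positivity), ← Real.rpow_neg (by positivity)]
    congr 1; ring
  have h1 : ((2 : ℝ) ^ g) ^ (1 / α + 1) ≤ 2 ^ (g * (s + 1)) := by
    calc _ ≤ ((2 : ℝ) ^ g) ^ ((s + 1 : ℕ) : ℝ) :=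
          Real.rpow_le_rpow_of_exponent_le (one_le_pow₀ (by norm_num)) (by push_cast; linarith)
      _ = _ := by rw [Real.rpow_natCast, pow_mul]
  unfold quantileLip
  rw [e]
  calc 1 / α * ((2 : ℝ) ^ g) ^ (1 / α + 1) / (1 / 2 ^ g)
      = 1 / α * ((2 : ℝ) ^ g) ^ (1 / α + 1) * 2 ^ g := by field_simp
    _ ≤ 2 ^ s * 2 ^ (g * (s + 1)) * 2 ^ g := by gcongr; exact hs.trans hs2
    _ = _ := by rw [← pow_add, ← pow_add]; congr 1; ring

/-- With `p = 2r` digits, half of them absorb the factor `p + 1` of the rounding errors. -/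
theorem succ_div_two_pow_le (r : ℕ) : ((2 * r : ℕ) + 1 : ℝ) / 2 ^ (2 * r) ≤ 2 / 2 ^ r := by
  have : (r + 1 : ℝ) ≤ 2 ^ r := by exact_mod_cast Nat.lt_two_pow_self (n := r)
  rw [two_mul r, pow_add, div_le_div_iff₀ (by positivity) (by positivity), ← mul_assoc]
  have h1 : ((r + r : ℕ) + 1 : ℝ) ≤ 2 * 2 ^ r := by push_cast; linarith
  gcongr

theorem two_pow_div_two_pow_le {a b r : ℕ} (h : a + b ≤ r) : (2 : ℝ) ^ a / 2 ^ r ≤ 1 / 2 ^ b := by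
  rw [div_le_div_iff₀ (by positivity) (by positivity), one_mul, ← pow_add]
  exact pow_le_pow_right₀ one_le_two h

theorem cdfError_le {α : ℝ} {s : ℕ} (hα : 0 < α) (hs : α ≤ s) (r h : ℕ) :
    cdfError α (2 * r) h ≤ 2 ^ (h * s + 3) / 2 ^ r := by
  have h1 := gridScale_le hα hs (2 * r) h
  have h2 : (1 : ℝ) ≤ 2 ^ (h * s) := one_le_pow₀ (by norm_num)
  have h3 := succ_div_two_pow_le r
  unfold cdfError
  calc _ = 2 * (1 + gridScale α (2 * r) h) * ((((2 * r : ℕ) : ℝ) + 1) / 2 ^ (2 * r)) := by ring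
    _ ≤ 2 * (2 ^ (h * s) + 2 ^ (h * s)) * (2 / 2 ^ r) := by
        gcongr
    _ = _ := by ring

/-- Bits and range of the approximate quantile function that suffice for a given precision. -/
theorem exists_quantile_parameters {α : ℝ} (hα : 0 < α) :
    ∃ c : ℕ, ∀ g m : ℕ, 1 ≤ g → ∃ p h : ℕ, 1 ≤ p ∧ p ≤ c * (g + m) ∧ h ≤ c * (g + m) ∧
      ∀ u ∈ Set.Icc ((1 : ℝ) / 2 ^ g) (1 - 1 / 2 ^ g),
        |(quantileFix α p h ⌊(2 : ℝ) ^ p * u⌋₊ : ℝ) / 2 ^ p - frechetInv α u| ≤ 1 / 2 ^ m := by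
  obtain ⟨s, hs⟩ := exists_nat_ge (max α (1 / α))
  have hs1 : α ≤ s := (le_max_left _ _).trans hs
  have hs2 : 1 / α ≤ s := (le_max_right _ _).trans hs
  refine ⟨2 * (14 + 3 * s + 4 + (s + 1) * (s + 2)), fun g m hg => ?_⟩
  -- Chosen so that `2 / 2^h = 2^(-gs)` lies below the quantile of `2^(-g)` and `2^h` above that of
  -- `1 - 2^(-g)`.
  obtain ⟨h, hh⟩ : ∃ h, h = g * s + 1 := ⟨_, rfl⟩
  -- Collects all exponents, so that each of the four errors is at most `2^(-(m+2))` and the error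
  -- of the distribution function at most `2^(-(g+1))`.
  obtain ⟨r, hr⟩ : ∃ r, r = m + 11 + s + (g + 1) * (s + 2) + h * (s + 2) + g := ⟨_, rfl⟩
  have hr_le : r ≤ (14 + 3 * s + 4 + (s + 1) * (s + 2)) * (g + m) := by
    subst hr hh
    obtain ⟨g, rfl⟩ := Nat.exists_eq_add_of_le' hg
    ring_nf
    nlinarith [Nat.zero_le (s * m), Nat.zero_le (s * s * m), Nat.zero_le (s*g), Nat.zero_le (s*s*g)]
  have hhr : 2 * h ≤ r := by
    have : h * 2 ≤ h * (s + 2) := Nat.mul_le_mul_left _ (by omega)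
    omega
  have hp2 : 2 * h ≤ 2 ^ (2 * r) :=
    hhr.trans ((Nat.lt_two_pow_self).le.trans (Nat.pow_le_pow_right (by norm_num) (by omega)))
  have e1 : h * (s + 2) = h * s + 2 * h := by ring
  refine ⟨2 * r, h, by omega, by linarith [hr_le], by linarith [hr_le], fun u hu => ?_⟩
  have hcdf := cdfError_le hα hs1 r h
  have hhalf : (1 : ℝ) / 2 ^ g / 2 = 1 / 2 ^ (g + 1) := by rw [pow_succ]; field_simp
  have hlip := quantileLip_le hα hs2 (g + 1)
  have hcdf0 : 0 ≤ cdfError α (2 * r) h := by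
    have : 0 ≤ gridScale α (2 * r) h := (Real.rpow_pos_of_pos (gridPoint_pos _ h 0) _).le
    unfold cdfError; positivity
  have main := quantileFix_precise hα (γ := 1 / 2 ^ g) (by positivity) (p := 2 * r) (h := h)
    ((gridPoint_zero_le hp2).trans (by
      refine le_trans (le_of_eq ?_) (le_frechetInv hα hs2 hg)
      rw [hh, pow_succ]; field_simp))
    ((frechetInv_one_sub_le hα hs2 hg).trans (pow_le_pow_right₀ one_le_two (by omega)))
    (by
      rw [hhalf]
      exact hcdf.trans (two_pow_div_two_pow_le (by omega))) hu
  refine main.trans ?_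
  rw [hhalf]
  have t1 : quantileLip α (1 / 2 ^ (g + 1)) * cdfError α (2 * r) h ≤ 1 / 2 ^ (m + 2) := by
    calc _ ≤ (2 : ℝ) ^ (s + (g + 1) * (s + 2)) * (2 ^ (h * s + 3) / 2 ^ r) := by gcongr
      _ = 2 ^ (s + (g + 1) * (s + 2) + (h * s + 3)) / 2 ^ r := by rw [pow_add _ _ (h * s + 3)]; ring
      _ ≤ _ := two_pow_div_two_pow_le (by omega)
  have hh2 : (h : ℝ) ≤ 2 ^ h := by exact_mod_cast (Nat.lt_two_pow_self (n := h)).le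
  have hlog2 : Real.log 2 ≤ 1 := by linarith [Real.log_two_lt_d9]
  have hlog0 : 0 ≤ Real.log 2 := Real.log_nonneg (by norm_num)
  have hrr : (1 : ℝ) / 2 ^ (2 * r) ≤ 1 / 2 ^ r := by
    gcongr
    · norm_num
    · omega
  have t2 : gridMesh (2 * r) h * 2 ^ h ≤ 1 / 2 ^ (m + 2) := by
    unfold gridMesh
    calc 2 * h * Real.log 2 / 2 ^ (2 * r) * 2 ^ h
        = 2 * h * Real.log 2 * 2 ^ h * (1 / 2 ^ (2 * r)) := by ring
      _ ≤ 2 * 2 ^ h * 1 * 2 ^ h * (1 / 2 ^ r) := by gcongr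
      _ = 2 ^ (2 * h + 1) / 2 ^ r := by ring
      _ ≤ _ := two_pow_div_two_pow_le (by omega)
  have t3 : 2 * ((2 * r : ℕ) : ℝ) * 2 ^ h / 2 ^ (2 * r) ≤ 1 / 2 ^ (m + 2) := by
    have := succ_div_two_pow_le r
    calc 2 * ((2 * r : ℕ) : ℝ) * 2 ^ h / 2 ^ (2 * r)
        ≤ 2 * ((2 * r : ℕ) + 1 : ℝ) * 2 ^ h / 2 ^ (2 * r) := by gcongr; linarith
      _ = 2 * 2 ^ h * (((2 * r : ℕ) + 1 : ℝ) / 2 ^ (2 * r)) := by ring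
      _ ≤ 2 * 2 ^ h * (2 / 2 ^ r) := by gcongr
      _ = 2 ^ (h + 2) / 2 ^ r := by ring
      _ ≤ _ := two_pow_div_two_pow_le (by omega)
  have t4 : (1 : ℝ) / 2 ^ (2 * r) ≤ 1 / 2 ^ (m + 2) := by
    gcongr
    · norm_num
    · omega
  have e : (1 : ℝ) / 2 ^ m = 4 * (1 / 2 ^ (m + 2)) := by rw [pow_add]; field_simp; norm_num
  rw [e]
  linarith

/-- Here `N K² / δ ≤ 2^(4n)`, so the logarithm is at most `2^(n+2)`; the required number of digits
is linear in `n`. -/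
theorem le_precisionScale {α δ : ℝ} {s n N K : ℕ} (hα : 0 < α) (hs : 1 / α ≤ s) (hn : 1 ≤ n)
    (hN0 : 1 ≤ N) (hN : N ≤ 2 ^ n) (hK0 : 2 ≤ K) (hK : K ≤ 2 ^ n) (hδ : 1 / 2 ^ n ≤ δ) (hδ1 : δ ≤ 1) :
    1 / 2 ^ ((3 + 3 * s) * n) ≤ precisionScale α δ N K := by
  have hδ0 : 0 < δ := lt_of_lt_of_le (by positivity) hδ
  have hN' : (N : ℝ) ≤ 2 ^ n := by exact_mod_cast hN
  have hK' : (K : ℝ) ≤ 2 ^ n := by exact_mod_cast hK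
  have hN1 : (1 : ℝ) ≤ N := by exact_mod_cast hN0
  have hK1 : (2 : ℝ) ≤ K := by exact_mod_cast hK0
  have hx1 : 1 < N * (K : ℝ) ^ 2 / δ := by
    rw [lt_div_iff₀ hδ0]; nlinarith
  have hx2 : N * (K : ℝ) ^ 2 / δ ≤ 2 ^ (4 * n) := by
    calc N * (K : ℝ) ^ 2 / δ ≤ 2 ^ n * (2 ^ n) ^ 2 / (1 / 2 ^ n) := by gcongr
      _ = _ := by field_simp; ring
  have hlog0 := Real.log_pos hx1
  have hlog : Real.log (N * (K : ℝ) ^ 2 / δ) ≤ 2 ^ (n + 2) := by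
    have hn2 : (n : ℝ) ≤ 2 ^ n := by exact_mod_cast (Nat.lt_two_pow_self (n := n)).le
    calc _ ≤ Real.log (2 ^ (4 * n)) := Real.log_le_log (by linarith) hx2
      _ = 4 * n * Real.log 2 := by rw [Real.log_pow]; push_cast; ring
      _ ≤ 4 * 2 ^ n * 1 := by
          gcongr
          linarith [Real.log_two_lt_d9]
      _ = _ := by ring
  have hpow : Real.log (N * (K : ℝ) ^ 2 / δ) ^ (1 / α) ≤ 2 ^ ((n + 2) * s) := by
    calc _ ≤ ((2 : ℝ) ^ (n + 2)) ^ (1 / α) := by gcongr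
      _ ≤ ((2 : ℝ) ^ (n + 2)) ^ (s : ℝ) :=
          Real.rpow_le_rpow_of_exponent_le (one_le_pow₀ (by norm_num)) hs
      _ = _ := by rw [Real.rpow_natCast, pow_mul]
  unfold precisionScale
  calc (1 : ℝ) / 2 ^ ((3 + 3 * s) * n) ≤ 1 / 2 ^ (3 * n + (n + 2) * s) := by
        gcongr
        · norm_num
        · obtain ⟨n, rfl⟩ := Nat.exists_eq_add_of_le' hn
          nlinarith [Nat.zero_le (n * s)]
    _ = 1 / 2 ^ n / ((2 ^ n) ^ 2 * 2 ^ ((n + 2) * s)) := by rw [pow_add]; field_simp; ring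
    _ ≤ _ := by gcongr

/-- Dropping the last `l - p` of the `l` leading digits of `u` leaves its `p` leading digits, so the
longer pieces needed against the automaton do not affect the precision. -/
theorem frechetNisan_precise {α : ℝ} {N K p h l k g m : ℕ} (hN : N ≤ 2 ^ k) (hpl : p ≤ l)
    (H : ∀ u ∈ Set.Icc ((1 : ℝ) / 2 ^ g) (1 - 1 / 2 ^ g),
      |(quantileFix α p h ⌊(2 : ℝ) ^ p * u⌋₊ : ℝ) / 2 ^ p - frechetInv α u| ≤ 1 / 2 ^ m) :
    (frechetNisan α K p h l hN).Precise α (1 / 2 ^ g) (1 / 2 ^ m) := by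
  intro u hu
  have hu1 : u < 1 := by
    have : (0 : ℝ) < 1 / 2 ^ g := by positivity
    linarith [hu.2]
  have hu0 : 0 ≤ u := le_trans (by positivity) hu.1
  have hlt : ⌊(2 : ℝ) ^ l * u⌋₊ < 2 ^ l := by
    rw [Nat.floor_lt (by positivity)]
    push_cast
    nlinarith [show (0 : ℝ) < 2 ^ l by positivity]
  have e : ⌊(2 : ℝ) ^ l * u⌋₊ / 2 ^ (l - p) = ⌊(2 : ℝ) ^ p * u⌋₊ := by
    rw [← Nat.floor_div_natCast]
    congr 1
    obtain ⟨d, rfl⟩ := Nat.exists_eq_add_of_le hpl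
    rw [Nat.add_sub_cancel_left, pow_add]
    push_cast
    field_simp
  have := H u hu
  simp only [frechetNisan, BitVec.toNat_ofNat, Nat.mod_eq_of_lt hlt, e]
  push_cast
  exact this

/-- The square of the number of states is at most `2^(4K(n+h+p+2))`, and blocks of `2Kq` bits give
`√|B| = 2^(Kq)`. The remaining `2n` digits pay for `2 ^ k` and for `δ`. -/
theorem failure_error_le {δ : ℝ} {n K M k h p q : ℕ} (hk : k ≤ n) (hM : M < 2 ^ n)
    (hδ : 1 / 2 ^ n ≤ δ) (hq : 2 * n + 4 * K * (n + h + p + 2) ≤ K * q) :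
    (2 : ℝ) ^ k * (((((M + 1) * (2 ^ (h + p) + 1) + 1 : ℕ) : ℝ) ^ (2 * K)) ^ 2
      * (1 / √((2 : ℝ) ^ (K * (2 * q))))) ≤ δ := by
  have e : √((2 : ℝ) ^ (K * (2 * q))) = 2 ^ (K * q) := by
    rw [show K * (2 * q) = K * q * 2 by ring, pow_mul, Real.sqrt_sq (by positivity)]
  have hV : (M + 1) * (2 ^ (h + p) + 1) + 1 ≤ 2 ^ (n + h + p + 2) := by
    have h1 : 1 ≤ 2 ^ (h + p) := Nat.one_le_two_pow
    calc _ ≤ 2 ^ n * (2 ^ (h + p) + 2 ^ (h + p)) + 2 ^ n * (2 ^ (h + p) + 2 ^ (h + p)) := by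
          gcongr
          · exact hM
          · exact (Nat.mul_pos (by positivity) (by positivity))
      _ = _ := by ring
  have hV' : (((M + 1) * (2 ^ (h + p) + 1) + 1 : ℕ) : ℝ) ≤ 2 ^ (n + h + p + 2) := by
    exact_mod_cast hV
  rw [e]
  calc _ ≤ (2 : ℝ) ^ n * (((2 ^ (n + h + p + 2)) ^ (2 * K)) ^ 2 * (1 / 2 ^ (K * q))) := by
        gcongr
        norm_num
    _ = 2 ^ (n + 4 * K * (n + h + p + 2)) / 2 ^ (K * q) := by
        rw [pow_add _ n, ← pow_mul, ← pow_mul,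
          show (n + h + p + 2) * (2 * K * 2) = 4 * K * (n + h + p + 2) by ring]
        ring
    _ ≤ 1 / 2 ^ n := two_pow_div_two_pow_le (by omega)
    _ ≤ δ := hδ

theorem wordBounds_of_le {n K M k h p q : ℕ} (hK : 2 ≤ K) (hk : k ≤ n) (hM : M < 2 ^ n) (hp : 1 ≤ p)
    (hq : 2 * n + 4 * (n + h + p + 2) ≤ q) : WordBounds p h (2 * q) k (K * (2 * q)) K M where
  hp := by nlinarith
  hk := by nlinarith
  hl j := by
    have h1 : (j + 1) * (2 * q) ≤ K * (2 * q) := Nat.mul_le_mul_right _ j.2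
    rw [add_mul, one_mul] at h1
    omega
  hM := by
    have h1 : 1 ≤ 2 ^ (h + p) := Nat.one_le_two_pow
    calc _ ≤ (2 ^ n * (2 ^ (h + p) + 2 ^ (h + p)) + 2 ^ n * (2 ^ (h + p) + 2 ^ (h + p)))
            * (2 ^ (h + p) + 2 ^ (h + p)) := by
          gcongr
          exact (Nat.mul_pos (by positivity) (by positivity))
      _ = 2 ^ (n + 2 * h + 2 * p + 3) := by ring
      _ < 2 ^ (K * (2 * q)) := Nat.pow_lt_pow_right (by norm_num) (by nlinarith)

/-! ### Storage and time, and their comparison with the cost scale -/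

theorem card_registerIndex (k w K : ℕ) :
    Fintype.card (RegisterIndex (Option (Fin k × Fin (w + 1))) K) = k * (w + 1) + 1 + (K + 34) := by
  simp [RegisterIndex]

/-- Words have at most `y²` bits, and there are `O(y³)` registers and instructions. Bounding the
length of a register number by the number of registers is crude but still polynomial. -/
theorem cost_sketchMachine_le (α : ℝ) {p h l k K y : ℕ} (hy : 1 ≤ y) (hp : p ≤ y) (hl : l ≤ y)
    (hk : k ≤ y) (hK : K ≤ y) :
    (sketchMachine α p h l k (K * l) K).storage ≤ 300000 * y ^ 6 ∧
      (sketchMachine α p h l k (K * l) K).opsPerItem ≤ 300000 * y ^ 7 := by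
  have hw : K * l ≤ y ^ 2 := by rw [pow_two]; gcongr
  have hpow : ∀ m t, m ≤ t → y ^ m ≤ y ^ t := fun m t => Nat.pow_le_pow_right hy
  have p1 := hpow 1 3 (by norm_num)
  have p0 := hpow 0 3 (by norm_num)
  have p2 := hpow 2 3 (by norm_num)
  rw [pow_one] at p1
  rw [pow_zero] at p0
  have hR : (sketchMachine α p h l k (K * l) K).R ≤ 40 * y ^ 3 := by
    show Fintype.card _ ≤ _
    rw [card_registerIndex]
    calc _ ≤ y * (y ^ 2 + 1) + 1 + (y + 34) := by gcongr
      _ = y ^ 3 + 2 * y + 35 := by ring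
      _ ≤ _ := by omega
  have hu : (sketchMachine α p h l k (K * l) K).update.length ≤ 21 * (25 * y ^ 3) := by
    refine (WordCode.length_compile_le _ _ (sizeLE_updateCode _ _ _ _ _ _ _)).trans ?_
    rw [length_updateCode]
    gcongr
    calc _ ≤ y * (y ^ 2 + 2) + 1 + y * (y * (2 * y + 5) + y + 6) := by gcongr
      _ = 3 * y ^ 3 + 6 * y ^ 2 + 8 * y + 1 := by ring
      _ ≤ _ := by omega
  have hq : (sketchMachine α p h l k (K * l) K).query.length ≤ 21 * (25 * y ^ 3) := by
    refine (WordCode.length_compile_le _ _ (sizeLE_queryCode _ _ _ _ _ _ _)).trans ?_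
    rw [length_queryCode]
    gcongr
    calc _ ≤ y * (y ^ 2 + 2) + 4 + y * (y * (2 * y + 5) + y + 9) := by gcongr
      _ = 3 * y ^ 3 + 6 * y ^ 2 + 11 * y + 4 := by ring
      _ ≤ _ := by omega
  constructor
  · unfold StreamMachine.storage
    have hs : Nat.size (sketchMachine α p h l k (K * l) K).R ≤ 40 * y ^ 3 :=
      (Nat.size_le.2 Nat.lt_two_pow_self).trans hR
    have p5 := hpow 5 6 (by norm_num)
    calc _ ≤ 40 * y ^ 3 * y ^ 2 + (21 * (25 * y ^ 3) + 21 * (25 * y ^ 3))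
            * (4 * y ^ 3 + 4 * (40 * y ^ 3) + y ^ 3) := by
          gcongr
          · omega
          · exact hw.trans p2
      _ = 40 * y ^ 5 + 173250 * y ^ 6 := by ring
      _ ≤ _ := by omega
  · unfold StreamMachine.opsPerItem
    calc _ ≤ 21 * (25 * y ^ 3) * (y ^ 2) ^ 2 := by gcongr
      _ = 525 * y ^ 7 := by ring
      _ ≤ _ := by omega

/-- The cost scale may be below `1`, but `log₂ N ≥ 1`, `ln(1/δ) ≥ ln 2 ≥ 1/2` and `ε^α ≤ 1`; after
doubling it dominates constants and its powers increase. -/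
theorem one_le_two_mul_costScale {α δ ε : ℝ} {N : ℕ} (hα : 0 < α) (hN : 2 ≤ N) (hδ : 0 < δ)
    (hδ2 : δ ≤ 1 / 2) (hε : 0 < ε) (hε1 : ε < 1) :
    1 ≤ 2 * costScale α δ ε N ∧ Real.logb 2 N ≤ 2 * costScale α δ ε N ∧
      Real.logb 2 (1 / δ) ≤ 2 * costScale α δ ε N := by
  have hl2 : 1 / 2 ≤ Real.log 2 := by linarith [Real.log_two_gt_d9]
  have hL : 1 ≤ Real.logb 2 N := by
    rw [Real.le_logb_iff_rpow_le one_lt_two (by positivity), Real.rpow_one]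
    exact_mod_cast hN
  have hD : Real.log 2 ≤ Real.log (1 / δ) := by
    refine Real.log_le_log two_pos ?_
    rw [le_div_iff₀ hδ]; linarith
  have he : ε ^ α ≤ 1 := Real.rpow_le_one hε.le hε1.le hα.le
  have he0 : 0 < ε ^ α := Real.rpow_pos_of_pos hε α
  have hQ : Real.logb 2 N * Real.log (1 / δ) ≤ costScale α δ ε N := by
    unfold costScale
    rw [le_div_iff₀ he0]
    have : 0 ≤ Real.logb 2 N * Real.log (1 / δ) := mul_nonneg (by linarith) (by linarith)
    nlinarith
  have h3 : Real.logb 2 (1 / δ) ≤ 2 * Real.log (1 / δ) := by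
    unfold Real.logb
    rw [div_le_iff₀ (by linarith)]
    nlinarith
  refine ⟨?_, ?_, ?_⟩ <;> nlinarith

/-- A common bound for the size of the sketch and the numbers of bits of the other parameters. -/
noncomputable def instanceSize (N K M : ℕ) (δ : ℝ) : ℕ :=
  K + Nat.size M + Nat.clog 2 N + ⌈Real.logb 2 (1 / δ)⌉₊ + 1

theorem instanceSize_le {α δ ε : ℝ} {N K M a b : ℕ} (hα : 0 < α) (hN : 2 ≤ N) (hδ : 0 < δ)
    (hδ2 : δ ≤ 1 / 2) (hε : 0 < ε) (hε1 : ε < 1) (hK : (K : ℝ) ≤ a * costScale α δ ε N ^ b)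
    (hM : (Nat.size M : ℝ) ≤ a * costScale α δ ε N ^ b) :
    (instanceSize N K M δ : ℝ) ≤ (2 * a + 5) * (2 * costScale α δ ε N) ^ (b + 1) := by
  obtain ⟨h1, h2, h3⟩ := one_le_two_mul_costScale hα hN hδ hδ2 hε hε1
  set Q := costScale α δ ε N
  have hb : Q ^ b ≤ (2 * Q) ^ (b + 1) := by
    calc Q ^ b ≤ (2 * Q) ^ b := by gcongr <;> linarith
      _ ≤ _ := pow_le_pow_right₀ h1 (by omega)
  have hb1 : 2 * Q ≤ (2 * Q) ^ (b + 1) := le_self_pow₀ h1 (by omega)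
  have hN' : (Nat.clog 2 N : ℝ) ≤ 2 * (2 * Q) := by
    rw [← Real.natCeil_logb_natCast]
    have := Nat.ceil_lt_add_one (a := Real.logb 2 N)
      (Real.logb_nonneg one_lt_two (by exact_mod_cast (by omega : 1 ≤ N)))
    push_cast at this ⊢
    linarith
  have hD : (⌈Real.logb 2 (1 / δ)⌉₊ : ℝ) ≤ 2 * (2 * Q) := by
    have := Nat.ceil_lt_add_one (a := Real.logb 2 (1 / δ))
      (Real.logb_nonneg one_lt_two (by rw [le_div_iff₀ hδ]; linarith))
    linarith
  have ha : a * Q ^ b ≤ a * (2 * Q) ^ (b + 1) := by gcongr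
  unfold instanceSize
  push_cast
  linarith

theorem le_instanceSize {N K M : ℕ} {δ : ℝ} (hδ : 0 < δ) :
    1 ≤ instanceSize N K M δ ∧ K ≤ instanceSize N K M δ ∧ M < 2 ^ instanceSize N K M δ ∧
      Nat.clog 2 N ≤ instanceSize N K M δ ∧ 1 / 2 ^ instanceSize N K M δ ≤ δ / 2 := by
  refine ⟨by unfold instanceSize; omega, by unfold instanceSize; omega, ?_,
    by unfold instanceSize; omega, ?_⟩
  · exact (Nat.lt_size_self M).trans_le
      (Nat.pow_le_pow_right (by norm_num) (by unfold instanceSize; omega))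
  · have h1 : 1 / δ ≤ 2 ^ ⌈Real.logb 2 (1 / δ)⌉₊ := by
      calc 1 / δ = (2 : ℝ) ^ Real.logb 2 (1 / δ) :=
            (Real.rpow_logb two_pos (by norm_num) (by positivity)).symm
        _ ≤ (2 : ℝ) ^ (⌈Real.logb 2 (1 / δ)⌉₊ : ℝ) :=
            Real.rpow_le_rpow_of_exponent_le one_le_two (Nat.le_ceil _)
        _ = _ := Real.rpow_natCast _ _
    -- The summand `1` of `instanceSize` gives `δ / 2` instead of `δ`.
    have h2 : (2 : ℝ) ^ (⌈Real.logb 2 (1 / δ)⌉₊ + 1) ≤ 2 ^ instanceSize N K M δ :=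
      pow_le_pow_right₀ one_le_two (by unfold instanceSize; omega)
    rw [pow_succ] at h2
    rw [div_le_div_iff₀ (by positivity) two_pos]
    rw [div_le_iff₀ hδ] at h1
    nlinarith

/-! ### Assembly -/

theorem streamSignal_le {N M : ℕ} {stream : List (Fin N × ℕ)} (hM : ∀ item ∈ stream, item.2 ≤ M)
    (i : Fin N) : streamSignal stream i ≤ M := by
  rcases (streamSignal_spec stream i).2 with h | ⟨item, hm, -, h⟩
  · omega
  · exact h ▸ hM item hm

/-- All parameters are linear in a common size `n` of the instance, which is polynomial in the cost
scale. Half of `δ` goes to the sketch with truly random blocks, the other half to the error of the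
generator. -/
theorem exists_streaming_sketch {α C : ℝ} (hα : 0 < α) (hC0 : 0 < C) (hC : FailureBound.{0} α C)
    (a b : ℕ) :
    ∃ (A : ℝ) (e : ℕ),
      ∀ (N K M : ℕ) (hK : 2 ≤ K) (δ ε : ℝ), 2 ≤ N → 0 < δ → δ ≤ 1 / 2 → 0 < ε → ε < 1 →
        (K : ℝ) ≤ a * costScale α δ ε N ^ b →
        (Nat.size M : ℝ) ≤ a * costScale α δ ε N ^ b →
        ∃ (G : NisanVariables N K) (S : StreamMachine G.w G.SeedIndex),
          (∃ γ β : ℝ, 0 < γ ∧ γ < δ / (4 * K * N) ∧ β ≤ C * precisionScale α δ N K ∧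
            G.Precise α γ β) ∧
          (S.storage : ℝ) ≤ A * costScale α δ ε N ^ e ∧
          (S.opsPerItem : ℝ) ≤ A * costScale α δ ε N ^ e ∧
          ∀ stream : List (Fin N × ℕ), (∀ item ∈ stream, item.2 ≤ M) → ∀ i₀ : Fin N,
            (∀ seed : G.SeedIndex → BitVec G.w,
              S.estimate seed stream i₀ =
                pointEstimate hK (fun i => (streamSignal stream i : ℝ)) (G.vars seed) i₀ ∧
              S.crit seed stream i₀ =
                criterion hK (fun i => (streamSignal stream i : ℝ)) (G.vars seed) i₀) ∧
            seedProb (fun seed : G.SeedIndex → BitVec G.w =>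
              S.estimate seed stream i₀ ≠ (streamSignal stream i₀ : ℝ) ∧
              S.crit seed stream i₀ = 1) ≤ δ := by
  obtain ⟨c, hc⟩ := exists_quantile_parameters hα
  obtain ⟨s, hs⟩ := exists_nat_ge (1 / α)
  obtain ⟨d, hd⟩ := exists_nat_ge (1 / C)
  have hCd : 1 / 2 ^ d ≤ C := by
    have : (d : ℝ) ≤ 2 ^ d := by exact_mod_cast (Nat.lt_two_pow_self (n := d)).le
    rw [div_le_iff₀ (by positivity), mul_comm, ← div_le_iff₀ hC0]
    linarith
  -- Makes `t * n` a common bound for `k`, `K`, `p` and the piece length `2q = 12n + 8h + 8p + 16`;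
  -- here `n ≥ K ≥ 2`.
  obtain ⟨t, ht⟩ : ∃ t, t = 20 + 16 * (c * (7 + d + (3 + 3 * s))) := ⟨_, rfl⟩
  refine ⟨300000 * ((t * (2 * a + 5)) * 2 ^ (b + 1)) ^ 7, (b + 1) * 7,
    fun N K M hK δ ε hN hδ hδ2 hε hε1 hKQ hMQ => ?_⟩
  obtain ⟨h1, -, -⟩ := one_le_two_mul_costScale hα hN hδ hδ2 hε hε1
  have hnQ := instanceSize_le hα hN hδ hδ2 hε hε1 hKQ hMQ
  obtain ⟨n1, nK, nM, nN, nδ⟩ := le_instanceSize (N := N) (K := K) (M := M) hδ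
  generalize instanceSize N K M δ = n at hnQ n1 nK nM nN nδ
  have hNk : N ≤ 2 ^ Nat.clog 2 N := Nat.le_pow_clog one_lt_two N
  generalize Nat.clog 2 N = k at nN hNk
  have hNn : N ≤ 2 ^ n := hNk.trans (Nat.pow_le_pow_right (by norm_num) nN)
  have hKn : K ≤ 2 ^ n := nK.trans Nat.lt_two_pow_self.le
  -- `4KN ≤ 2^(2n+2)` and `δ/2 ≥ 2^(-n)`, so `γ = 2^(-g)` is strictly below the allowed bound for
  -- `δ/2`.
  obtain ⟨g, hg⟩ : ∃ g, g = 3 * n + 4 := ⟨_, rfl⟩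
  -- `2^(-d) ≤ C`, and the second summand is the exponent of the lower bound for `precisionScale`.
  obtain ⟨m, hm⟩ : ∃ m, m = d + (3 + 3 * s) * n := ⟨_, rfl⟩
  obtain ⟨p, h, hp1, hp, hh, hprec⟩ := hc g m (by omega)
  have hgm : c * (g + m) ≤ c * (7 + d + (3 + 3 * s)) * n := by
    rw [mul_assoc]
    gcongr
    subst hg hm
    nlinarith
  obtain ⟨q, hq⟩ : ∃ q, q = 2 * n + 4 * (n + h + p + 2) := ⟨_, rfl⟩
  have hpl : p ≤ 2 * q := by omega
  have hγ : (1 : ℝ) / 2 ^ g < δ / 2 / (4 * K * N) := by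
    have hK0 : (0 : ℝ) < K := by exact_mod_cast (by omega : 0 < K)
    have hN0 : (0 : ℝ) < N := by exact_mod_cast (by omega : 0 < N)
    have hK' : (K : ℝ) ≤ 2 ^ n := by exact_mod_cast hKn
    have hN' : (N : ℝ) ≤ 2 ^ n := by exact_mod_cast hNn
    rw [lt_div_iff₀ (by positivity)]
    calc 1 / 2 ^ g * (4 * K * N : ℝ) ≤ 1 / 2 ^ g * (4 * 2 ^ n * 2 ^ n) := by gcongr
      _ = 1 / 2 ^ n * (1 / 4) := by rw [hg, pow_add, mul_comm 3 n, pow_mul]; field_simp; norm_num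
      _ < 1 / 2 ^ n := mul_lt_of_lt_one_right (by positivity) (by norm_num)
      _ ≤ _ := nδ
  -- Needed twice: at `δ` for the stated precision and at `δ / 2` for the failure probability.
  have hβ : ∀ δ' : ℝ, 1 / 2 ^ n ≤ δ' → δ' ≤ 1 → (1 : ℝ) / 2 ^ m ≤ C * precisionScale α δ' N K := by
    intro δ' h1 h2
    calc (1 : ℝ) / 2 ^ m = 1 / 2 ^ d * (1 / 2 ^ ((3 + 3 * s) * n)) := by
          rw [hm, pow_add]; field_simp
      _ ≤ _ := by
          gcongr
          exact le_precisionScale hα hs n1 (by omega) hNn hK hKn h1 h2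
  have hprecise := frechetNisan_precise (K := K) hNk hpl hprec
  have hB : WordBounds p h (2 * q) k (K * (2 * q)) K M :=
    wordBounds_of_le hK nN nM hp1 (by omega)
  have hcost := cost_sketchMachine_le α (p := p) (h := h) (l := 2 * q) (k := k) (K := K) (y := t * n)
    (Nat.mul_pos (by omega) n1) (by subst ht; nlinarith) (by subst ht hq; nlinarith)
    (by subst ht; nlinarith) (by subst ht; nlinarith)
  have hle : ((t * n : ℕ) : ℝ) ≤ t * (2 * a + 5) * (2 * costScale α δ ε N) ^ (b + 1) := by
    push_cast
    rw [mul_assoc]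
    gcongr
  have hle' : 300000 * ((t * n : ℕ) : ℝ) ^ 7
      ≤ 300000 * ((t * (2 * a + 5)) * 2 ^ (b + 1)) ^ 7 * costScale α δ ε N ^ ((b + 1) * 7) := by
    calc _ ≤ 300000 * (t * (2 * a + 5) * (2 * costScale α δ ε N) ^ (b + 1)) ^ 7 := by gcongr
      _ = _ := by rw [mul_pow 2, pow_mul]; ring
  have hty : 1 ≤ t * n := Nat.mul_pos (by omega) n1
  refine ⟨frechetNisan α K p h (2 * q) hNk, sketchMachine α p h (2 * q) k (K * (2 * q)) K,
    ⟨1 / 2 ^ g, 1 / 2 ^ m, by positivity, hγ.trans ?_, hβ δ (by linarith) (by linarith), hprecise⟩,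
    le_trans ?_ hle', le_trans ?_ hle', fun stream hstream i₀ => ?_⟩
  · gcongr
    linarith
  · exact_mod_cast hcost.1.trans (Nat.mul_le_mul_left _ (Nat.pow_le_pow_right hty (by norm_num)))
  · exact_mod_cast hcost.2
  · have hcorrect := fun sd => sketchMachine_correct hα.le hK hNk hpl hB sd stream hstream i₀
    refine ⟨hcorrect, ?_⟩
    have e : (fun seed : Option (Fin k × Fin (K * (2 * q) + 1)) → BitVec (K * (2 * q)) =>
        (sketchMachine α p h (2 * q) k (K * (2 * q)) K).estimate seed stream i₀
          ≠ (streamSignal stream i₀ : ℝ) ∧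
        (sketchMachine α p h (2 * q) k (K * (2 * q)) K).crit seed stream i₀ = 1)
        = fun seed => pointEstimate hK (fun i => (streamSignal stream i : ℝ))
            ((frechetNisan α K p h (2 * q) hNk).vars seed) i₀ ≠ (streamSignal stream i₀ : ℝ) ∧
          criterion hK (fun i => (streamSignal stream i : ℝ))
            ((frechetNisan α K p h (2 * q) hNk).vars seed) i₀ = 1 := by
      funext sd
      rw [(hcorrect sd).1, (hcorrect sd).2]
    refine (le_of_eq (congrArg seedProb e)).trans ?_
    refine (seedProb_frechetNisan_le hC (δ := δ / 2) hK hNk hpl (by linarith) (by positivity) hγ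
      (hβ _ nδ (by linarith)) hprecise (f := streamSignal stream)
      (streamSignal_le hstream) i₀).trans ?_
    have := failure_error_le (K := K) (h := h) (p := p) (q := q) nN nM nδ (by
      have h2 : 2 * n ≤ K * (2 * n) := Nat.le_mul_of_pos_left _ (by omega)
      calc _ ≤ K * (2 * n) + 4 * K * (n + h + p + 2) := Nat.add_le_add_right h2 _
        _ = K * q := by rw [hq]; ring)
    linarith

theorem theorem6 (α : ℝ) (hα : 0 < α) :
    ∃ C : ℝ, 0 < C ∧
      -- the sketch in terms of independent variables of precision `β`
      (∀ (N K : ℕ) (hK : 2 ≤ K) (δ γ β : ℝ), 0 < δ → 0 < γ → γ < δ / (4 * K * N) →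
        β ≤ C * precisionScale α δ N K →
        ∀ (Ω : Type*) [MeasurableSpace Ω] (P : MeasureTheory.Measure Ω)
          [MeasureTheory.IsProbabilityMeasure P] (U Z : Fin K → Fin N → Ω → ℝ),
          (∀ j i, Measurable (U j i)) → (∀ j i, Measurable (Z j i)) →
          (∀ j i, P.map (U j i) = MeasureTheory.volume.restrict (Set.Ioo 0 1)) →
          ProbabilityTheory.iIndepFun
            (fun (p : Fin K × Fin N) (ω : Ω) => (U p.1 p.2 ω, Z p.1 p.2 ω)) P →
          (∀ᵐ ω ∂P, ∀ j i, U j i ω ∈ Set.Icc γ (1 - γ) →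
            |Z j i ω - frechetInv α (U j i ω)| ≤ β) →
          ∀ (f : Fin N → ℝ), (∀ i, 0 ≤ f i) → ∀ i₀ : Fin N,
            P.real {ω | pointEstimate hK f (fun j i => Z j i ω) i₀ ≠ f i₀ ∧
              criterion hK f (fun j i => Z j i ω) i₀ = 1} ≤ δ) ∧
      -- the algorithm with small storage and few operations per stream item
      (∀ a b : ℕ, ∃ (A : ℝ) (e : ℕ),
        ∀ (N K M : ℕ) (hK : 2 ≤ K) (δ ε : ℝ), 2 ≤ N → 0 < δ → δ ≤ 1 / 2 → 0 < ε → ε < 1 →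
          (K : ℝ) ≤ a * costScale α δ ε N ^ b →
          (Nat.size M : ℝ) ≤ a * costScale α δ ε N ^ b →
          ∃ (G : NisanVariables N K) (S : StreamMachine G.w G.SeedIndex),
            (∃ γ β : ℝ, 0 < γ ∧ γ < δ / (4 * K * N) ∧ β ≤ C * precisionScale α δ N K ∧
              G.Precise α γ β) ∧
            (S.storage : ℝ) ≤ A * costScale α δ ε N ^ e ∧
            (S.opsPerItem : ℝ) ≤ A * costScale α δ ε N ^ e ∧
            ∀ stream : List (Fin N × ℕ), (∀ item ∈ stream, item.2 ≤ M) → ∀ i₀ : Fin N,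
              (∀ seed : G.SeedIndex → BitVec G.w,
                S.estimate seed stream i₀ =
                  pointEstimate hK (fun i => (streamSignal stream i : ℝ)) (G.vars seed) i₀ ∧
                S.crit seed stream i₀ =
                  criterion hK (fun i => (streamSignal stream i : ℝ)) (G.vars seed) i₀) ∧
              seedProb (fun seed : G.SeedIndex → BitVec G.w =>
                S.estimate seed stream i₀ ≠ (streamSignal stream i₀ : ℝ) ∧
                S.crit seed stream i₀ = 1) ≤ δ) := by
  obtain ⟨c, hc, hlip⟩ := exists_frechetCdf_lipschitz hα
  have hC : 0 < 1 / (8 * c) := by positivity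
  exact ⟨1 / (8 * c), hC, failureBound_of_lipschitz hα hc hlip,
    exists_streaming_sketch hα hC (failureBound_of_lipschitz hα hc hlip)⟩
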